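/- **Proposition (Rigidity of Reeb Periodicity).** A cosymplectic manifold $(M,\eta,\omega)$ of dimension $2n+1$ $(n\ge 0)$ is a smooth manifold without boundary (Hausdorff, second countable, not necessarily compact) with a smooth closed $1$-form $\eta$ and a smooth closed $2$-form $\omega$ such that $\eta\wedge\omega^n$ vanishes nowhere. Its Reeb vector field $\xi$ is defined by $\eta(\xi)=1$ and $\iota_\xi\omega=0$. The manifold is called regular if $\xi$ is complete, with flow $(\psi_t)_{t\in\mathbb R}$, and the space $B$ of orbits of $\psi$ is a smooth (Hausdorff, second countable) manifold of dimension $2n$ such that the projection $\pi:M\to B$ is a smooth submersion (for connected $M$, $\pi$ is then a principal bundle with group $S^1$ or $\mathbb R$ acting through the Reeb flow). The Reeb flow is periodic if $\psi_T=\mathrm{id}_M$ for some $T>0$. The group $\mathrm{Cosymp}(M,\eta,\omega)$ consists of the smooth diffeomorphisms $\varphi:M\to M$ with $\varphi^*\eta=\eta$ and $\varphi^*\omega=\omega$. Let $(M_1,\eta_1,\omega_1)$ and $(M_2,\eta_2,\omega_2)$ be connected regular cosymplectic manifolds (possibly of different dimensions) whose groups $\mathrm{Cosymp}(M_1,\eta_1,\omega_1)$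 and $\mathrm{Cosymp}(M_2,\eta_2,\omega_2)$ are isomorphic as abstract groups (in particular, this is the case if they are isomorphic as topological groups for the $C^\infty$ compact-open topology). If the Reeb flow of $M_1$ is periodic, then the Reeb flow of $M_2$ is also periodic. -/

import Mathlib

open scoped Manifold

namespace Cosymplectic

/-! ### Differential forms on a manifold modelled on `ℝ^m` -/

section Forms

variable {m : ℕ} {M : Type*} [TopologicalSpace M] [ChartedSpace (EuclideanSpace ℝ (Fin m)) M]

variable (m M) in
/-- A (not necessarily smooth) differential `k`-form on `M`: an alternating `k`-linear form on
every tangent space. -/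
abbrev DForm (k : ℕ) : Type _ :=
  (x : M) → (TangentSpace (𝓡 m) x) [⋀^Fin k]→L[ℝ] ℝ

/-- The pullback `f^* α` of a differential form under a map `f : M → M`. -/
noncomputable def DForm.pullback {k : ℕ} (f : M → M) (α : DForm m M k) : DForm m M k :=
  fun x => (α (f x)).compContinuousLinearMap (mfderiv (𝓡 m) (𝓡 m) f x)

theorem DForm.pullback_id {k : ℕ} (α : DForm m M k) : α.pullback id = α := by
  funext x
  ext v
  simp [DForm.pullback, mfderiv_id]

theorem DForm.pullback_comp {k : ℕ} {f g : M → M} (hf : MDifferentiable (𝓡 m) (𝓡 m) f)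
    (hg : MDifferentiable (𝓡 m) (𝓡 m) g) (α : DForm m M k) :
    α.pullback (f ∘ g) = (α.pullback f).pullback g := by
  funext x
  simp only [DForm.pullback, mfderiv_comp x (hf (g x)) (hg x)]
  rfl

/-- The expression of a differential form in a chart `e`, that is, the pullback of the form under
the inverse of `e`: a form on the open set `e.target` of `ℝ^m`. -/
noncomputable def DForm.inChart {k : ℕ} (α : DForm m M k)
    (e : OpenPartialHomeomorph M (EuclideanSpace ℝ (Fin m))) (y : EuclideanSpace ℝ (Fin m)) :
    (EuclideanSpace ℝ (Fin m)) [⋀^Fin k]→L[ℝ] ℝ :=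
  (α (e.symm y)).compContinuousLinearMap (mfderiv (𝓡 m) (𝓡 m) e.symm y)

/-- A differential form is smooth if its expressions in the charts are smooth. -/
def DForm.IsSmooth {k : ℕ} (α : DForm m M k) : Prop :=
  ∀ e ∈ atlas (EuclideanSpace ℝ (Fin m)) M, ContDiffOn ℝ (⊤ : ℕ∞) (α.inChart e) e.target

/-- A differential form is closed if its expressions in the charts have zero exterior
derivative. -/
def DForm.IsClosed {k : ℕ} (α : DForm m M k) : Prop :=
  ∀ e ∈ atlas (EuclideanSpace ℝ (Fin m)) M, ∀ y ∈ e.target, extDeriv (α.inChart e) y = 0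

end Forms

/-! ### The top exterior product `η ∧ ω^n` -/

section LinearAlgebra

variable {V : Type*} [AddCommGroup V] [Module ℝ V] [TopologicalSpace V]

theorem one_form_add (η : V [⋀^Fin 1]→L[ℝ] ℝ) (x y : V) : η ![x + y] = η ![x] + η ![y] := by
  have h (z : V) : Function.update ![x] 0 z = ![z] := by
    ext i; fin_cases i; rfl
  have h1 := η.map_update_add ![x] 0 x y
  rwa [h, h, h] at h1

theorem one_form_smul (η : V [⋀^Fin 1]→L[ℝ] ℝ) (c : ℝ) (x : V) : η ![c • x] = c * η ![x] := by
  have h (z : V) : Function.update ![x] 0 z = ![z] := by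
    ext i; fin_cases i; rfl
  have h1 := η.map_update_smul ![x] 0 c x
  rwa [h, h] at h1

theorem two_form_add_left (ω : V [⋀^Fin 2]→L[ℝ] ℝ) (x y z : V) :
    ω ![x + y, z] = ω ![x, z] + ω ![y, z] := by
  have h (w : V) : Function.update ![x, z] 0 w = ![w, z] := by
    ext i; fin_cases i <;> rfl
  have h1 := ω.map_update_add ![x, z] 0 x y
  rwa [h, h, h] at h1

theorem two_form_smul_left (ω : V [⋀^Fin 2]→L[ℝ] ℝ) (c : ℝ) (x z : V) :
    ω ![c • x, z] = c * ω ![x, z] := by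
  have h (w : V) : Function.update ![x, z] 0 w = ![w, z] := by
    ext i; fin_cases i <;> rfl
  have h1 := ω.map_update_smul ![x, z] 0 c x
  rwa [h, h] at h1

theorem two_form_swap (ω : V [⋀^Fin 2]→L[ℝ] ℝ) (x y : V) : ω ![x, y] = - ω ![y, x] := by
  have h := ω.toAlternatingMap.map_swap ![y, x] (i := 0) (j := 1) (by decide)
  have e : (![y, x] ∘ ⇑(Equiv.swap (0 : Fin 2) 1)) = ![x, y] := by
    ext i; fin_cases i <;> simp
  rw [e] at h
  exact h

theorem two_form_add_right (ω : V [⋀^Fin 2]→L[ℝ] ℝ) (x y z : V) :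
    ω ![z, x + y] = ω ![z, x] + ω ![z, y] := by
  rw [two_form_swap, two_form_add_left, two_form_swap ω z x, two_form_swap ω z y]; ring

theorem two_form_smul_right (ω : V [⋀^Fin 2]→L[ℝ] ℝ) (c : ℝ) (x z : V) :
    ω ![z, c • x] = c * ω ![z, x] := by
  rw [two_form_swap, two_form_smul_left, two_form_swap ω z x]; ring

/-- The multilinear form
`(v₀, …, v₂ₙ) ↦ η(v₀) ω(v₁, v₂) ω(v₃, v₄) ⋯ ω(v₂ₙ₋₁, v₂ₙ)`, the tensor product
`η ⊗ ω ⊗ ⋯ ⊗ ω`. -/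
noncomputable def tensorTop (n : ℕ) (η : V [⋀^Fin 1]→L[ℝ] ℝ) (ω : V [⋀^Fin 2]→L[ℝ] ℝ) :
    MultilinearMap ℝ (fun _ : Fin (2 * n + 1) => V) ℝ where
  toFun v := η ![v 0] * ∏ i : Fin n,
    ω ![v ⟨2 * i + 1, by have := i.2; lia⟩, v ⟨2 * i + 2, by have := i.2; lia⟩]
  map_update_add' {hd} v j x y := by
    obtain rfl : hd = instDecidableEqFin _ := Subsingleton.elim _ _
    obtain ⟨_ | k, hk⟩ := j
    · have h0 : (⟨0, hk⟩ : Fin (2 * n + 1)) = 0 := rfl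
      simp [Fin.ext_iff, one_form_add, add_mul]
    · have h0 (z : V) : Function.update v ⟨k + 1, hk⟩ z 0 = v 0 := by
        simp [Fin.ext_iff]
      simp only [h0, ← mul_add]
      congr 1
      symm
      apply Finset.prod_add_prod_eq (i := (⟨k / 2, by lia⟩ : Fin n)) (Finset.mem_univ _)
      · rcases Nat.even_or_odd' k with ⟨l, rfl | rfl⟩
        · have h1 : 2 * l / 2 = l := by lia
          simp [h1, two_form_add_left]
        · have h1 : (2 * l + 1) / 2 = l := by lia
          simp [h1, two_form_add_right]
      all_goals
        intro i _ hi
        have hi' : (i : ℕ) ≠ k / 2 := fun h => hi (Fin.ext h)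
        have h1 : 2 * (i : ℕ) ≠ k := by lia
        have h2 : 2 * (i : ℕ) + 1 ≠ k := by lia
        simp [h1, h2]
  map_update_smul' {hd} v j c x := by
    obtain rfl : hd = instDecidableEqFin _ := Subsingleton.elim _ _
    obtain ⟨_ | k, hk⟩ := j
    · simp [Fin.ext_iff, one_form_smul, mul_assoc]
    · have h0 (z : V) : Function.update v ⟨k + 1, hk⟩ z 0 = v 0 := by
        simp [Fin.ext_iff]
      simp only [h0, smul_eq_mul, mul_left_comm c]
      congr 1
      let i₀ : Fin n := ⟨k / 2, by lia⟩
      rw [← Finset.mul_prod_erase _ _ (Finset.mem_univ i₀),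
        ← Finset.mul_prod_erase _ _ (Finset.mem_univ i₀), ← mul_assoc]
      congr 1
      · rcases Nat.even_or_odd' k with ⟨l, rfl | rfl⟩
        · have h1 : 2 * l / 2 = l := by lia
          simp [i₀, h1, two_form_smul_left]
        · have h1 : (2 * l + 1) / 2 = l := by lia
          simp [i₀, h1, two_form_smul_right]
      · apply Finset.prod_congr rfl
        intro i hi
        have hi' : (i : ℕ) ≠ k / 2 := fun h => (Finset.ne_of_mem_erase hi) (Fin.ext h)
        have h1 : 2 * (i : ℕ) ≠ k := by lia
        have h2 : 2 * (i : ℕ) + 1 ≠ k := by lia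
        simp [h1, h2]

/-- The exterior product `η ∧ ω^n` (up to a nonzero normalizing constant depending only on `n`):
the antisymmetrization `∑ σ, sign σ • (η ⊗ ω ⊗ ⋯ ⊗ ω) ∘ σ`. -/
noncomputable def wedgeTop (n : ℕ) (η : V [⋀^Fin 1]→L[ℝ] ℝ) (ω : V [⋀^Fin 2]→L[ℝ] ℝ) :
    V [⋀^Fin (2 * n + 1)]→ₗ[ℝ] ℝ :=
  MultilinearMap.alternatization (tensorTop n η ω)

/-- A vector in the kernel of both `η` and `ω` is in the kernel of `η ∧ ω^n`. -/
theorem wedgeTop_eq_zero {n : ℕ} {η : V [⋀^Fin 1]→L[ℝ] ℝ} {ω : V [⋀^Fin 2]→L[ℝ] ℝ} {w : V}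
    (hη : η ![w] = 0) (hω : ∀ u, ω ![w, u] = 0) (v : Fin (2 * n + 1) → V)
    (j : Fin (2 * n + 1)) (hj : v j = w) : wedgeTop n η ω v = 0 := by
  have hω' (u : V) : ω ![u, w] = 0 := by rw [two_form_swap, hω, neg_zero]
  rw [wedgeTop, MultilinearMap.alternatization_apply]
  refine Finset.sum_eq_zero fun σ _ => ?_
  suffices h : tensorTop n η ω (fun i => v (σ i)) = 0 by
    rw [MultilinearMap.domDomCongr_apply, h, smul_zero]
  obtain ⟨i, rfl⟩ := σ.surjective j
  obtain ⟨_ | k, hk⟩ := i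
  · change η ![v (σ 0)] * _ = 0
    have h0 : v (σ 0) = w := hj
    rw [h0, hη, zero_mul]
  · change η ![v (σ 0)] * ∏ i : Fin n, _ = 0
    rw [Finset.prod_eq_zero (Finset.mem_univ (⟨k / 2, by lia⟩ : Fin n)), mul_zero]
    rcases Nat.even_or_odd' k with ⟨l, rfl | rfl⟩
    · have h1 : 2 * l / 2 = l := by lia
      simp only [h1, hj, hω]
    · have h1 : (2 * l + 1) / 2 = l := by lia
      simp only [h1, hj, hω']

/-- If `V` has dimension `2n+1` and `η ∧ ω^n ≠ 0`, then no nonzero vector is in the kernel of both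
`η` and `ω`. -/
theorem eq_zero_of_wedgeTop_ne_zero {n : ℕ} (hV : Module.finrank ℝ V = 2 * n + 1)
    {η : V [⋀^Fin 1]→L[ℝ] ℝ} {ω : V [⋀^Fin 2]→L[ℝ] ℝ} (h : wedgeTop n η ω ≠ 0) {w : V}
    (hη : η ![w] = 0) (hω : ∀ u, ω ![w, u] = 0) : w = 0 := by
  by_contra hw
  apply h
  have : FiniteDimensional ℝ V := Module.finite_of_finrank_pos (by lia)
  have hli : LinearIndepOn ℝ id ({w} : Set V) := by
    simpa [linearIndepOn_singleton_iff] using hw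
  let b := Module.Basis.extend hli
  have : Fintype (hli.extend (Set.subset_univ _)) := FiniteDimensional.fintypeBasisIndex b
  have hcard : Fintype.card (hli.extend (Set.subset_univ _)) = Fintype.card (Fin (2 * n + 1)) := by
    rw [← Module.finrank_eq_card_basis b, hV, Fintype.card_fin]
  let e := Fintype.equivOfCardEq hcard
  have hmem : w ∈ hli.extend (Set.subset_univ _) := hli.subset_extend _ rfl
  refine Module.Basis.ext_alternating (b.reindex e) fun v hv => ?_
  have hvs : Function.Surjective v := Finite.surjective_of_injective hv
  obtain ⟨j, hj⟩ := hvs (e ⟨w, hmem⟩)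
  rw [wedgeTop_eq_zero hη hω _ j (by simp [hj, b]), AlternatingMap.zero_apply]

/-- A `2`-form on a space of odd dimension has a nonzero vector in its kernel. -/
theorem exists_ker_two_form {n : ℕ} (hV : Module.finrank ℝ V = 2 * n + 1)
    (ω : V [⋀^Fin 2]→L[ℝ] ℝ) : ∃ w : V, w ≠ 0 ∧ ∀ u, ω ![w, u] = 0 := by
  have : FiniteDimensional ℝ V := Module.finite_of_finrank_pos (by lia)
  let B : LinearMap.BilinForm ℝ V := LinearMap.mk₂ ℝ (fun x y => ω ![x, y])
    (fun x y z => two_form_add_left ω x y z) (fun c x y => two_form_smul_left ω c x y)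
    (fun x y z => two_form_add_right ω y z x) (fun c x y => two_form_smul_right ω c y x)
  let b := Module.finBasisOfFinrankEq ℝ V hV
  let A := LinearMap.BilinForm.toMatrix b B
  have hA : A.transpose = -A := by
    ext i j
    simp only [A, Matrix.transpose_apply, Matrix.neg_apply, LinearMap.BilinForm.toMatrix_apply]
    exact two_form_swap ω _ _
  have hdet : A.det = 0 := by
    have h1 := A.det_transpose
    rw [hA, Matrix.det_neg, Fintype.card_fin, pow_succ, pow_mul] at h1
    norm_num at h1
    linarith
  by_contra! hne
  have hB : B.SeparatingLeft := fun x hx => by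
    by_contra h0
    obtain ⟨u, hu⟩ := hne x h0
    exact hu (hx u)
  exact (LinearMap.BilinForm.nondegenerate_iff_det_ne_zero b).1 (.ofSeparatingLeft hB) hdet

/-- The Reeb vector exists and is unique. -/
theorem existsUnique_reeb {n : ℕ} (hV : Module.finrank ℝ V = 2 * n + 1)
    {η : V [⋀^Fin 1]→L[ℝ] ℝ} {ω : V [⋀^Fin 2]→L[ℝ] ℝ} (h : wedgeTop n η ω ≠ 0) :
    ∃! w : V, η ![w] = 1 ∧ ∀ u, ω ![w, u] = 0 := by
  obtain ⟨w, hw, hω⟩ := exists_ker_two_form hV ω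
  have hη : η ![w] ≠ 0 := fun h0 => hw (eq_zero_of_wedgeTop_ne_zero hV h h0 hω)
  refine ⟨(η ![w])⁻¹ • w, ⟨?_, fun u => ?_⟩, ?_⟩
  · rw [one_form_smul, inv_mul_cancel₀ hη]
  · rw [two_form_smul_left, hω, mul_zero]
  · rintro w' ⟨h1, h2⟩
    rw [← sub_eq_zero, sub_eq_add_neg, ← neg_one_smul ℝ]
    refine eq_zero_of_wedgeTop_ne_zero hV h ?_ fun u => ?_
    · rw [one_form_add, one_form_smul, one_form_smul, h1, inv_mul_cancel₀ hη]; ring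
    · rw [two_form_add_left, two_form_smul_left, two_form_smul_left, h2, hω]; ring

end LinearAlgebra

/-! ### Cosymplectic structures -/

section Manifold

/-- A cosymplectic structure on a manifold `M` of dimension `2n+1`: a pair `(η, ω)` of a smooth
closed `1`-form and a smooth closed `2`-form such that `η ∧ ω^n` vanishes nowhere. -/
structure CosymplecticStructure (n : ℕ) (M : Type*) [TopologicalSpace M]
    [ChartedSpace (EuclideanSpace ℝ (Fin (2 * n + 1))) M] where
  η : DForm (2 * n + 1) M 1
  ω : DForm (2 * n + 1) M 2
  smooth_η : η.IsSmooth
  smooth_ω : ω.IsSmooth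
  closed_η : η.IsClosed
  closed_ω : ω.IsClosed
  volume_ne_zero : ∀ x, wedgeTop n (η x) (ω x) ≠ 0

namespace CosymplecticStructure

variable {n : ℕ} {M : Type*} [TopologicalSpace M]
  [ChartedSpace (EuclideanSpace ℝ (Fin (2 * n + 1))) M] (S : CosymplecticStructure n M)

theorem existsUnique_reeb (x : M) :
    ∃! w : TangentSpace (𝓡 (2 * n + 1)) x, S.η x ![w] = 1 ∧ ∀ u, S.ω x ![w, u] = 0 :=
  Cosymplectic.existsUnique_reeb
    (finrank_euclideanSpace_fin : Module.finrank ℝ (EuclideanSpace ℝ (Fin (2 * n + 1))) = _)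
    (S.volume_ne_zero x)

/-- The Reeb vector field `ξ`, defined by `η(ξ) = 1` and `ι_ξ ω = 0`. -/
noncomputable def reeb (x : M) : TangentSpace (𝓡 (2 * n + 1)) x :=
  (S.existsUnique_reeb x).choose

theorem η_reeb (x : M) : S.η x ![S.reeb x] = 1 :=
  (S.existsUnique_reeb x).choose_spec.1.1

theorem ω_reeb (x : M) (u : TangentSpace (𝓡 (2 * n + 1)) x) : S.ω x ![S.reeb x, u] = 0 :=
  (S.existsUnique_reeb x).choose_spec.1.2 u

/-- The Reeb vector field is complete: through every point there is an integral curve defined on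
all of `ℝ`. -/
def ReebComplete : Prop :=
  ∀ x : M, ∃ γ : ℝ → M, γ 0 = x ∧ IsMIntegralCurve (I := 𝓡 (2 * n + 1)) γ S.reeb

open scoped Classical in
/-- The Reeb flow `ψ_t`: `t ↦ ψ_t(x)` is the integral curve of the Reeb vector field that starts
at `x`. This is meaningful when the Reeb vector field is complete. -/
noncomputable def reebFlow (t : ℝ) (x : M) : M :=
  if h : ∃ γ : ℝ → M, γ 0 = x ∧ IsMIntegralCurve (I := 𝓡 (2 * n + 1)) γ S.reeb then
    h.choose t
  else x

theorem reebFlow_zero (x : M) : S.reebFlow 0 x = x := by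
  unfold reebFlow
  split_ifs with h
  · exact h.choose_spec.1
  · rfl

theorem isMIntegralCurve_reebFlow (hS : S.ReebComplete) (x : M) :
    IsMIntegralCurve (I := 𝓡 (2 * n + 1)) (fun t => S.reebFlow t x) S.reeb := by
  have h := hS x
  have e : (fun t => S.reebFlow t x) = h.choose := by
    funext t
    simp only [reebFlow, dif_pos h]
  rw [e]
  exact h.choose_spec.2

/-- The Reeb flow is periodic: `ψ_T = id` for some `T > 0`. -/
def ReebPeriodic : Prop :=
  ∃ T : ℝ, 0 < T ∧ ∀ x : M, S.reebFlow T x = x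

/-- The cosymplectic manifold is regular: the Reeb vector field is complete, and the space `B` of
its orbits is a smooth (Hausdorff, second countable) manifold, of dimension `2n`, such that the
projection `π : M → B` is a smooth submersion. The fibres of `π` being the orbits of the Reeb flow,
`π` is then a principal bundle for the action of the Reeb flow, with group `S^1` or `ℝ` when `M` is
connected. -/
def IsRegular.{u} {n : ℕ} {M : Type u} [TopologicalSpace M]
    [ChartedSpace (EuclideanSpace ℝ (Fin (2 * n + 1))) M] (S : CosymplecticStructure n M) : Prop :=
  S.ReebComplete ∧
  ∃ (B : Type u) (_ : TopologicalSpace B) (_ : ChartedSpace (EuclideanSpace ℝ (Fin (2 * n))) B)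
    (π : M → B),
    T2Space B ∧ SecondCountableTopology B ∧ IsManifold (𝓡 (2 * n)) (⊤ : ℕ∞) B ∧
    Function.Surjective π ∧
    Manifold.IsSubmersion (𝓡 (2 * n + 1)) (𝓡 (2 * n)) (⊤ : ℕ∞) π ∧
    ∀ x y : M, π x = π y ↔ ∃ t : ℝ, S.reebFlow t x = y

variable [IsManifold (𝓡 (2 * n + 1)) (⊤ : ℕ∞) M]

/-- The group of cosymplectomorphisms of `M`: the smooth diffeomorphisms `φ : M → M` such that
`φ^* η = η` and `φ^* ω = ω`, under composition. -/
def cosymp : Subgroup (Equiv.Perm M) where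
  carrier := {φ | ContMDiff (𝓡 (2 * n + 1)) (𝓡 (2 * n + 1)) (⊤ : ℕ∞) φ ∧
    ContMDiff (𝓡 (2 * n + 1)) (𝓡 (2 * n + 1)) (⊤ : ℕ∞) φ.symm ∧
    S.η.pullback φ = S.η ∧ S.ω.pullback φ = S.ω}
  one_mem' :=
    ⟨contMDiff_id, contMDiff_id, DForm.pullback_id S.η, DForm.pullback_id S.ω⟩
  mul_mem' := by
    rintro φ χ ⟨h1, h2, h3, h4⟩ ⟨k1, k2, k3, k4⟩
    have d1 := h1.mdifferentiable (by simp)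
    have e1 := k1.mdifferentiable (by simp)
    refine ⟨h1.comp k1, k2.comp h2, ?_, ?_⟩
    · change S.η.pullback (φ ∘ χ) = S.η
      rw [DForm.pullback_comp d1 e1, h3, k3]
    · change S.ω.pullback (φ ∘ χ) = S.ω
      rw [DForm.pullback_comp d1 e1, h4, k4]
  inv_mem' := by
    rintro φ ⟨h1, h2, h3, h4⟩
    have d1 := h1.mdifferentiable (by simp)
    have d2 := h2.mdifferentiable (by simp)
    have e : ⇑φ ∘ ⇑φ.symm = id := funext φ.apply_symm_apply
    refine ⟨h2, h1, ?_, ?_⟩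
    · change S.η.pullback φ.symm = S.η
      conv_lhs => rw [← h3]
      rw [← DForm.pullback_comp d1 d2, e, DForm.pullback_id]
    · change S.ω.pullback φ.symm = S.ω
      conv_lhs => rw [← h4]
      rw [← DForm.pullback_comp d1 d2, e, DForm.pullback_id]

end CosymplecticStructure

end Manifold

end Cosymplectic

/-! The Reeb flow is periodic exactly when the group of cosymplectomorphisms contains a nontrivial
central element of finite order. That condition is purely group-theoretic, so an abstract
isomorphism carries it from one manifold to the other, whatever the dimensions.

If ψ_T = id, then ψ_{T/m} has finite order. It is central because cosymplectomorphisms preserve the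
Reeb field ξ, hence commute with its flow (`commute_flow`). For large m it is not the identity,
since in a flow box it is a small nonzero translation (`exists_central_of_periodic`).

Conversely, let φ be central, nontrivial and of finite order. First, φ preserves every orbit
(`proj_eq_of_central`). In positive base dimension, if φ moved an orbit, a cosymplectomorphism g
supported over a small neighbourhood of that orbit in the orbit space could not commute with it. In
base dimension zero there is only one orbit. Second, a map preserving η, ω and every orbit is
locally a constant shift along the orbits, because η = dz in a flow box. On a connected M it is
therefore the identity as soon as it fixes one point (`eq_id_of_fixed`). Choosing t with ψ_t(w) =
φ(w) and applying this to ψ_{-t} ∘ φ gives φ = ψ_t with t ≠ 0, and φ^m = 1 says that mt is a period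
(`periodic_of_central`).

The work lies in producing g (`exists_bump`). A flow box (`exists_flowBox`) presents ω as the
pullback of a symplectic form on an open set of ℝ^{2n}. The time-one map of a small compactly
supported hamiltonian field is a symplectic map θ there (`exists_compactly_supported_symplecto`),
and `exists_lift` sends ψ_t(y, 0) to ψ_t(θ y, 0). This lift is well defined without any bundle
structure, because a ψ_t with a fixed point is the identity. Smooth dependence of a flow on its
initial point is obtained by inverting a smooth map on the Banach space of paths
(`exists_smooth_flow`). -/

namespace Cosymplectic

/-! ### Calculus on the Banach space of continuous paths. -/

section PathSpace

open Set

universe u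

variable {K : Type*} [TopologicalSpace K] [CompactSpace K]
  {E F : Type u} [NormedAddCommGroup E] [NormedSpace ℝ E] [NormedAddCommGroup F] [NormedSpace ℝ F]

variable (K E F) in
/-- Pointwise application of a continuous family of operators to a continuous family of
vectors, as a continuous bilinear map. -/
noncomputable def pointwiseApply : C(K, E →L[ℝ] F) →L[ℝ] C(K, E) →L[ℝ] C(K, F) :=
  LinearMap.mkContinuous₂
    (LinearMap.mk₂ ℝ (fun (A : C(K, E →L[ℝ] F)) (δ : C(K, E)) =>
        (⟨fun t => A t (δ t), by fun_prop⟩ : C(K, F)))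
      (fun A B δ => by ext t; simp) (fun c A δ => by ext t; simp)
      (fun A δ δ' => by ext t; simp) (fun c A δ => by ext t; simp)) 1
    (fun A δ => by
      rw [one_mul]
      refine (ContinuousMap.norm_le _ (by positivity)).2 fun t => ?_
      refine ((A t).le_opNorm (δ t)).trans ?_
      gcongr
      · exact A.norm_coe_le_norm t
      · exact δ.norm_coe_le_norm t)

theorem norm_pointwiseApply_le (A : C(K, E →L[ℝ] F)) : ‖pointwiseApply K E F A‖ ≤ ‖A‖ := by
  refine ContinuousLinearMap.opNorm_le_bound _ (norm_nonneg A) fun δ => ?_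
  refine (ContinuousMap.norm_le _ (by positivity)).2 fun t => ?_
  refine ((A t).le_opNorm (δ t)).trans ?_
  gcongr
  · exact A.norm_coe_le_norm t
  · exact δ.norm_coe_le_norm t

variable (K) in
/-- Composition with a `C^1` map is differentiable on spaces of continuous maps. -/
theorem hasFDerivAt_postcomp {f : E → F} (hf : ContDiff ℝ 1 f) (γ : C(K, E)) :
    HasFDerivAt (fun γ : C(K, E) => (ContinuousMap.mk f hf.continuous).comp γ)
      (pointwiseApply K E F
        ((ContinuousMap.mk (fderiv ℝ f) (hf.continuous_fderiv one_ne_zero)).comp γ)) γ := by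
  rw [hasFDerivAt_iff_isLittleO_nhds_zero, Asymptotics.isLittleO_iff]
  intro c hc
  -- Continuity of γ ↦ Df ∘ γ in the sup norm gives one δ valid for all t, which makes the pointwise
  -- mean value estimate uniform.
  have hcont := (ContinuousMap.continuous_postcomp (X := K)
    (ContinuousMap.mk (fderiv ℝ f) (hf.continuous_fderiv one_ne_zero))).continuousAt (x := γ)
  obtain ⟨δ, hδ, h⟩ := (Metric.continuousAt_iff (α := C(K, E)) (β := C(K, E →L[ℝ] F))).1 hcont c hc
  filter_upwards [Metric.ball_mem_nhds (0 : C(K, E)) hδ] with ρ hρ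
  refine (ContinuousMap.norm_le _ (by positivity)).2 fun t => ?_
  have hρ' : ‖ρ‖ < δ := by simpa using hρ
  have key := (convex_ball (γ t) δ).norm_image_sub_le_of_norm_fderiv_le' (𝕜 := ℝ)
    (f := f) (C := c) (φ := fderiv ℝ f (γ t)) (x := γ t) (y := γ t + ρ t)
    (fun x _ => hf.differentiable one_ne_zero x) (fun x hx => ?_) (by simpa using hδ)
    (by simpa using (ρ.norm_coe_le_norm t).trans_lt hρ')
  · simp only [add_sub_cancel_left] at key
    refine key.trans ?_
    gcongr
    exact ρ.norm_coe_le_norm t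
  · have hx' : ‖x - γ t‖ < δ := by simpa [dist_eq_norm] using hx
    -- To compare Df at x and at γ t, translate the whole path by the constant x - γ t: the new path
    -- passes through x at t and stays δ-close to γ.
    have h1 := @h (γ + ContinuousMap.const K (x - γ t)) (by
      rw [dist_eq_norm, add_sub_cancel_left, ContinuousMap.norm_lt_iff _ hδ]
      intro s
      simpa using hx')
    have h2 := (ContinuousMap.dist_apply_le_dist t).trans h1.le
    simpa [dist_eq_norm] using h2

variable (K) in
/-- Composition with a smooth map is smooth on spaces of continuous maps. -/
theorem contDiff_postcomp_nat (n : ℕ) : ∀ {F : Type u} [NormedAddCommGroup F] [NormedSpace ℝ F]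
    {f : E → F} (hf : ContDiff ℝ (⊤ : ℕ∞) f),
    ContDiff ℝ n (fun γ : C(K, E) => (ContinuousMap.mk f hf.continuous).comp γ) := by
  induction n with
  | zero =>
    intro F _ _ f hf
    exact contDiff_zero.2 (ContinuousMap.continuous_postcomp _)
  -- The derivative is pointwise application of Df ∘ γ, again a postcomposition, now with target E
  -- →L F. The induction therefore needs a variable target, and a common universe for E and F.
  | succ n ih =>
    intro F _ _ f hf
    have h1 : ContDiff ℝ 1 f := hf.of_le (by exact_mod_cast le_top)
    have h2 : ContDiff ℝ (⊤ : ℕ∞) (fderiv ℝ f) := hf.fderiv_right (by simp)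
    have h3 : ContDiff ℝ n (pointwiseApply K E F) :=
      ContinuousLinearMap.contDiff (E := C(K, E →L[ℝ] F)) (F := C(K, E) →L[ℝ] C(K, F)) _
    exact contDiff_succ_iff_hasFDerivAt.2 ⟨fun γ => pointwiseApply K E F
      ((ContinuousMap.mk (fderiv ℝ f) h2.continuous).comp γ),
      h3.comp (ih h2),
      fun γ => hasFDerivAt_postcomp K h1 γ⟩

variable (K) in
theorem contDiff_postcomp {f : E → F} (hf : ContDiff ℝ (⊤ : ℕ∞) f) :
    ContDiff ℝ (⊤ : ℕ∞) (fun γ : C(K, E) => (ContinuousMap.mk f hf.continuous).comp γ) :=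
  contDiff_infty.2 fun n => contDiff_postcomp_nat K n hf

variable (E) in
/-- The operator sending a path on `[0, 1]` to its primitive vanishing at `0`. -/
noncomputable def pathPrimitive : C(Icc (0 : ℝ) 1, E) →L[ℝ] C(Icc (0 : ℝ) 1, E) :=
  LinearMap.mkContinuous
    { toFun := fun γ => ⟨fun t => ∫ s in (0 : ℝ)..t, IccExtend zero_le_one γ s, by
        have h : Continuous (IccExtend zero_le_one γ) := γ.continuous.Icc_extend'
        exact (intervalIntegral.continuous_primitive (fun a b => h.intervalIntegrable a b) 0).comp
          continuous_subtype_val⟩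
      map_add' := fun γ γ' => by
        ext t
        have h : Continuous (IccExtend zero_le_one γ) := γ.continuous.Icc_extend'
        have h' : Continuous (IccExtend zero_le_one γ') := γ'.continuous.Icc_extend'
        exact intervalIntegral.integral_add (h.intervalIntegrable _ _) (h'.intervalIntegrable _ _)
      map_smul' := fun c γ => by
        ext t
        exact intervalIntegral.integral_smul c _ } 1
    (fun γ => by
      rw [one_mul]
      refine (ContinuousMap.norm_le _ (by positivity)).2 fun t => ?_
      have h := intervalIntegral.norm_integral_le_of_norm_le_const
        (f := IccExtend zero_le_one γ) (a := 0) (b := t) (C := ‖γ‖)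
        (fun s _ => γ.norm_coe_le_norm _)
      refine h.trans ?_
      rw [sub_zero, abs_of_nonneg t.2.1]
      exact mul_le_of_le_one_right (norm_nonneg _) t.2.2)

theorem pathPrimitive_apply (γ : C(Icc (0 : ℝ) 1, E)) (t : Icc (0 : ℝ) 1) :
    pathPrimitive E γ t = ∫ s in (0 : ℝ)..t, IccExtend zero_le_one γ s := rfl

theorem norm_pathPrimitive_le : ‖pathPrimitive E‖ ≤ 1 :=
  LinearMap.mkContinuous_norm_le _ zero_le_one _

theorem hasDerivAt_primitive [CompleteSpace E] (γ : C(Icc (0 : ℝ) 1, E)) (t : ℝ) :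
    HasDerivAt (fun t : ℝ => ∫ s in (0 : ℝ)..t, IccExtend zero_le_one γ s)
      (IccExtend zero_le_one γ t) t := by
  have h : Continuous (IccExtend zero_le_one γ) := γ.continuous.Icc_extend'
  exact intervalIntegral.integral_hasDerivAt_right (h.intervalIntegrable _ _)
    h.aestronglyMeasurable.stronglyMeasurableAtFilter h.continuousAt

end PathSpace

/-! ### Smooth dependence of a flow on its initial point. -/

section TimeOne

open Set

universe u

variable {E : Type u} [NormedAddCommGroup E] [NormedSpace ℝ E]

/-- The map whose zeros relative to constants are the integral curves on `[0, 1]`. -/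
noncomputable def picardDefect {X : E → E} (hX : Continuous X) (γ : C(Icc (0 : ℝ) 1, E)) :
    C(Icc (0 : ℝ) 1, E) :=
  γ - pathPrimitive E ((ContinuousMap.mk X hX).comp γ)

/-- The deviation from the identity is an integral over [0, 1] of X ∘ γ, and integration has norm at
most 1, so the Lipschitz constant of X bounds it. For L < 1 the map is thus a global homeomorphism
of the path space. -/
theorem approximatesLinearOn_picardDefect {X : E → E} (hX : Continuous X) {L : NNReal}
    (hL : LipschitzWith L X) :
    ApproximatesLinearOn (picardDefect hX)
      ((ContinuousLinearEquiv.refl ℝ C(Icc (0 : ℝ) 1, E) :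
        C(Icc (0 : ℝ) 1, E) ≃L[ℝ] C(Icc (0 : ℝ) 1, E)) :
        C(Icc (0 : ℝ) 1, E) →L[ℝ] C(Icc (0 : ℝ) 1, E)) univ L := by
  intro γ _ γ' _
  have e : picardDefect hX γ - picardDefect hX γ' -
      ((ContinuousLinearEquiv.refl ℝ C(Icc (0 : ℝ) 1, E) :
        C(Icc (0 : ℝ) 1, E) ≃L[ℝ] C(Icc (0 : ℝ) 1, E)) :
        C(Icc (0 : ℝ) 1, E) →L[ℝ] C(Icc (0 : ℝ) 1, E)) (γ - γ') =
      - pathPrimitive E ((ContinuousMap.mk X hX).comp γ - (ContinuousMap.mk X hX).comp γ') := by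
    simp only [picardDefect, map_sub, ContinuousLinearEquiv.coe_coe,
      ContinuousLinearEquiv.refl_apply]
    abel
  rw [e, norm_neg]
  refine ((pathPrimitive E).le_of_opNorm_le norm_pathPrimitive_le _).trans ?_
  rw [one_mul]
  refine (ContinuousMap.norm_le _ (by positivity)).2 fun t => ?_
  refine (hL.norm_sub_le (γ t) (γ' t)).trans ?_
  gcongr
  exact (γ - γ').norm_coe_le_norm t

/-- The flow of a smooth vector field with small Lipschitz constant: for times in `[0, 1]` it
exists, its time-one map is smooth, and its derivatives solve the linearized equation. -/
theorem exists_smooth_flow [CompleteSpace E] {X : E → E} (hX : ContDiff ℝ (⊤ : ℕ∞) X) {L : NNReal}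
    (hL : LipschitzWith L X) (hL1 : L < 1) :
    ∃ Φ : E → ℝ → E, (∀ x, Φ x 0 = x) ∧
      (∀ x, ∀ t ∈ Icc (0 : ℝ) 1, HasDerivAt (Φ x) (X (Φ x t)) t) ∧
      ContDiff ℝ (⊤ : ℕ∞) (fun x => Φ x 1) ∧
      ∀ x v, ∃ δ : ℝ → E, δ 0 = v ∧ δ 1 = fderiv ℝ (fun x => Φ x 1) x v ∧
        ∀ t ∈ Icc (0 : ℝ) 1, HasDerivAt δ (fderiv ℝ X (Φ x t) (δ t)) t := by
  have hXc := hX.continuous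
  have hX1 : ContDiff ℝ 1 X := hX.of_le (by exact_mod_cast le_top)
  have happ := approximatesLinearOn_picardDefect hXc hL
  have hc : Subsingleton C(Icc (0 : ℝ) 1, E) ∨
      L < ‖((ContinuousLinearEquiv.refl ℝ C(Icc (0 : ℝ) 1, E)).symm :
        C(Icc (0 : ℝ) 1, E) →L[ℝ] C(Icc (0 : ℝ) 1, E))‖₊⁻¹ := by
    rcases subsingleton_or_nontrivial C(Icc (0 : ℝ) 1, E) with h | h
    · exact Or.inl h
    · right
      have : ‖((ContinuousLinearEquiv.refl ℝ C(Icc (0 : ℝ) 1, E)).symm :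
        C(Icc (0 : ℝ) 1, E) →L[ℝ] C(Icc (0 : ℝ) 1, E))‖₊ = 1 := by
        have := ContinuousLinearMap.norm_id (𝕜 := ℝ) (E := C(Icc (0 : ℝ) 1, E))
        exact NNReal.eq this
      rw [this]; simpa using hL1
  -- The integral curve starting at x is the preimage under N of the constant path x, so smoothness
  -- in x reduces to smoothness of N⁻¹.
  let N := happ.toHomeomorph (picardDefect hXc) hc
  have hN (γ) : N γ = γ - pathPrimitive E ((ContinuousMap.mk X hXc).comp γ) := rfl
  let A (γ : C(Icc (0 : ℝ) 1, E)) : C(Icc (0 : ℝ) 1, E) →L[ℝ] C(Icc (0 : ℝ) 1, E) :=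
    pathPrimitive E ∘L pointwiseApply _ E E
      ((ContinuousMap.mk (fderiv ℝ X) (hX1.continuous_fderiv one_ne_zero)).comp γ)
  -- Since ‖DX‖ ≤ L < 1, the derivative 1 - A γ of N is invertible by the Neumann series; this is
  -- what makes N⁻¹ smooth.
  have hA (γ) : ‖A γ‖ < 1 := by
    refine (ContinuousLinearMap.opNorm_comp_le _ _).trans_lt ?_
    refine (mul_le_of_le_one_left (norm_nonneg _) norm_pathPrimitive_le).trans_lt ?_
    refine (norm_pointwiseApply_le _).trans_lt (lt_of_le_of_lt ?_ (NNReal.coe_lt_one.2 hL1))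
    refine (ContinuousMap.norm_le _ L.2).2 fun t => ?_
    exact norm_fderiv_le_of_lipschitz ℝ hL
  have hNd (γ) : HasFDerivAt N (ContinuousLinearMap.id ℝ _ - A γ) γ :=
    (hasFDerivAt_id γ).sub ((pathPrimitive E).hasFDerivAt.comp γ (hasFDerivAt_postcomp _ hX1 γ))
  have hNs : ContDiff ℝ (⊤ : ℕ∞) N :=
    contDiff_id.sub ((pathPrimitive E).contDiff.comp (contDiff_postcomp _ hX))
  have hsymm : ContDiff ℝ (⊤ : ℕ∞) N.symm :=
    N.contDiff_symm (f₀' := fun γ =>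
      ContinuousLinearEquiv.unitsEquiv ℝ _ (Units.oneSub (A γ) (hA γ)))
      (fun γ => hNd γ) hNs
  let cst : E →L[ℝ] C(Icc (0 : ℝ) 1, E) := LinearMap.mkContinuous
    { toFun := fun x => ContinuousMap.const _ x
      map_add' := fun x y => rfl
      map_smul' := fun c x => rfl } 1 (fun x => by
        rw [one_mul]
        exact (ContinuousMap.norm_le _ (norm_nonneg _)).2 fun t => le_rfl)
  let Γ : E → C(Icc (0 : ℝ) 1, E) := fun x => N.symm (cst x)
  have hΓs : ContDiff ℝ (⊤ : ℕ∞) Γ := hsymm.comp cst.contDiff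
  have hΓ (x) : N (Γ x) = cst x := N.apply_symm_apply _
  -- The curve is redefined by its integral equation on all of ℝ, so that it has two-sided
  -- derivatives at the endpoints 0 and 1 as well.
  let Φ : E → ℝ → E := fun x t =>
    x + ∫ s in (0 : ℝ)..t, IccExtend zero_le_one ((ContinuousMap.mk X hXc).comp (Γ x)) s
  have hΦ (x) (t : Icc (0 : ℝ) 1) : Φ x t = Γ x t := by
    have := congrArg (fun γ : C(Icc (0 : ℝ) 1, E) => γ t) (hΓ x)
    simp only [hN, ContinuousMap.sub_apply, pathPrimitive_apply] at this
    have h2 : cst x t = x := rfl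
    rw [h2] at this
    rw [sub_eq_iff_eq_add.1 this]
  have hΦ1 : (fun x => Φ x 1) = fun x => ContinuousMap.evalCLM ℝ (⟨1,
      by simp⟩ : Icc (0 : ℝ) 1) (Γ x) :=
    funext fun x => hΦ x ⟨1, by simp⟩
  refine ⟨Φ, fun x => by simp [Φ], fun x t ht => ?_, ?_, fun x v => ?_⟩
  · rw [hΦ x ⟨t, ht⟩]
    have := (hasDerivAt_primitive ((ContinuousMap.mk X hXc).comp (Γ x)) t).const_add x
    rwa [IccExtend_of_mem _ _ ht] at this
  · rw [hΦ1]
    exact (ContinuousMap.evalCLM ℝ _).contDiff.comp hΓs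
  · let D : C(Icc (0 : ℝ) 1, E) := fderiv ℝ Γ x v
    have hΓd : HasFDerivAt Γ (fderiv ℝ Γ x) x := (hΓs.differentiable (by simp) x).hasFDerivAt
    -- Differentiating N (Γ x) = x in the direction v yields the integrated form of the linearized
    -- equation.
    have hD : D - A (Γ x) D = cst v := by
      have h1 : HasFDerivAt (fun x => N (Γ x)) _ x := (hNd (Γ x)).comp x hΓd
      have h2 : HasFDerivAt (fun x => N (Γ x)) cst x := by
        simp only [hΓ]; exact cst.hasFDerivAt
      exact congrArg (fun T : E →L[ℝ] C(Icc (0 : ℝ) 1, E) => T v) (h1.unique h2)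
    let B : C(Icc (0 : ℝ) 1, E) := pointwiseApply _ E E
      ((ContinuousMap.mk (fderiv ℝ X) (hX1.continuous_fderiv one_ne_zero)).comp (Γ x)) D
    let δ : ℝ → E := fun t => v + ∫ s in (0 : ℝ)..t, IccExtend zero_le_one B s
    have hδ (t : Icc (0 : ℝ) 1) : δ t = D t := by
      have := congrArg (fun γ : C(Icc (0 : ℝ) 1, E) => γ t) hD
      have h2 : cst v t = v := rfl
      simp only [ContinuousMap.sub_apply, h2] at this
      rw [sub_eq_iff_eq_add.1 this]
      rfl
    refine ⟨δ, by simp [δ], ?_, fun t ht => ?_⟩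
    · rw [hδ ⟨1, by simp⟩, hΦ1]
      have h3 := ((ContinuousMap.evalCLM ℝ (⟨1, by simp⟩ : Icc (0 : ℝ) 1)).hasFDerivAt
        (x := Γ x)).comp x hΓd
      exact (congrArg (fun T : E →L[ℝ] E => T v) h3.fderiv).symm
    · have := (hasDerivAt_primitive B t).const_add v
      rw [IccExtend_of_mem _ _ ht] at this
      rw [hδ ⟨t, ht⟩, hΦ x ⟨t, ht⟩]
      exact this

end TimeOne

/-! ### Alternating 2-forms as bilinear maps, and closedness. -/

section Flat

variable {E : Type*} [NormedAddCommGroup E] [NormedSpace ℝ E]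

/-- The bilinear map underlying an alternating `2`-form. -/
noncomputable def bilinOfTwoForm (w : E [⋀^Fin 2]→L[ℝ] ℝ) : E →ₗ[ℝ] E →ₗ[ℝ] ℝ :=
  LinearMap.mk₂ ℝ (fun x y => w ![x, y])
    (fun x y z => two_form_add_left w x y z) (fun c x y => two_form_smul_left w c x y)
    (fun x y z => two_form_add_right w y z x) (fun c x y => two_form_smul_right w c y x)

theorem norm_bilinOfTwoForm_le (w : E [⋀^Fin 2]→L[ℝ] ℝ) (x y : E) :
    ‖bilinOfTwoForm w x y‖ ≤ ‖w‖ * ‖x‖ * ‖y‖ := by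
  have h := w.le_opNorm ![x, y]
  rw [Fin.prod_univ_two, ← mul_assoc] at h
  exact h

/-- The continuous bilinear map underlying an alternating `2`-form. -/
noncomputable def clmOfTwoForm (w : E [⋀^Fin 2]→L[ℝ] ℝ) : E →L[ℝ] E →L[ℝ] ℝ :=
  LinearMap.mkContinuous₂ (bilinOfTwoForm w) ‖w‖ (norm_bilinOfTwoForm_le w)

theorem norm_clmOfTwoForm_le (w : E [⋀^Fin 2]→L[ℝ] ℝ) : ‖clmOfTwoForm w‖ ≤ ‖w‖ :=
  LinearMap.mkContinuous₂_norm_le _ (norm_nonneg w) _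

variable (E) in
/-- `clmOfTwoForm` as a linear map. -/
noncomputable def clmOfTwoFormLin : (E [⋀^Fin 2]→L[ℝ] ℝ) →ₗ[ℝ] (E →L[ℝ] E →L[ℝ] ℝ) where
  toFun := clmOfTwoForm
  map_add' _ _ := rfl
  map_smul' _ _ := rfl

variable (E) in
/-- The bilinear map underlying an alternating `2`-form, as a continuous linear operator. -/
noncomputable def flat : (E [⋀^Fin 2]→L[ℝ] ℝ) →L[ℝ] E →L[ℝ] E →L[ℝ] ℝ :=
  ⟨clmOfTwoFormLin E, AddMonoidHomClass.continuous_of_bound (clmOfTwoFormLin E) 1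
    (fun w => (norm_clmOfTwoForm_le w).trans (one_mul ‖w‖).ge)⟩

@[simp] theorem flat_apply (w : E [⋀^Fin 2]→L[ℝ] ℝ) (x y : E) : flat E w x y = w ![x, y] := rfl

theorem hasFDerivAt_flat (w : E [⋀^Fin 2]→L[ℝ] ℝ) : HasFDerivAt (fun w => flat E w) (flat E) w :=
  ContinuousLinearMap.hasFDerivAt (E := E [⋀^Fin 2]→L[ℝ] ℝ) (F := E →L[ℝ] E →L[ℝ] ℝ) (flat E)

theorem HasFDerivAt.flat_comp {F : Type*} [NormedAddCommGroup F] [NormedSpace ℝ F]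
    {Ω : F → E [⋀^Fin 2]→L[ℝ] ℝ} {D : F →L[ℝ] E [⋀^Fin 2]→L[ℝ] ℝ} {y : F}
    (h : HasFDerivAt Ω D y) : HasFDerivAt (fun y => flat E (Ω y)) ((flat E).comp D) y :=
  HasFDerivAt.comp (E := F) (F := E [⋀^Fin 2]→L[ℝ] ℝ) (G := E →L[ℝ] E →L[ℝ] ℝ) y
    (hasFDerivAt_flat (Ω y)) h

theorem contDiff_flat {n : WithTop ℕ∞} : ContDiff ℝ n (fun w => flat E w) :=
  ContinuousLinearMap.contDiff (E := E [⋀^Fin 2]→L[ℝ] ℝ) (F := E →L[ℝ] E →L[ℝ] ℝ) _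

theorem flat_swap (w : E [⋀^Fin 2]→L[ℝ] ℝ) (x y : E) : flat E w x y = - flat E w y x :=
  two_form_swap w x y

/-- The three-term formula expressing closedness of a `2`-form. -/
theorem cyclic_of_extDeriv_eq_zero {Ω : E → E [⋀^Fin 2]→L[ℝ] ℝ} {y : E}
    (hd : DifferentiableAt ℝ Ω y) (hc : extDeriv Ω y = 0) (u v w : E) :
    fderiv ℝ Ω y u ![v, w] - fderiv ℝ Ω y v ![u, w] + fderiv ℝ Ω y w ![u, v] = 0 := by
  have h := extDeriv_apply hd ![u, v, w]
  rw [hc] at h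
  have e0 : (0 : Fin 3).removeNth ![u, v, w] = ![v, w] := by
    ext i; fin_cases i <;> rfl
  have e1 : (1 : Fin 3).removeNth ![u, v, w] = ![u, w] := by
    ext i; fin_cases i <;> rfl
  have e2 : (2 : Fin 3).removeNth ![u, v, w] = ![u, v] := by
    ext i; fin_cases i <;> rfl
  rw [Fin.sum_univ_three, e0, e1, e2] at h
  simp only [fderiv_continuousAlternatingMap_apply_const_apply hd] at h
  simp at h
  linarith

end Flat

/-! ### Consequences of uniqueness for flow lines. -/

section FlowFacts

open Set

variable {E : Type*} [NormedAddCommGroup E] [NormedSpace ℝ E] {Y : E → E} {Φ Φ' : E → ℝ → E}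
  {L : NNReal}

/-- Run backwards, s ↦ Φ x (1 - s) solves the equation of -Y from Φ x 1, and uniqueness identifies
it with Φ'. This makes time-one maps bijective. -/
theorem flow_reverse (hL : LipschitzWith L Y) (h0 : ∀ x, Φ x 0 = x)
    (h : ∀ x, ∀ t ∈ Icc (0 : ℝ) 1, HasDerivAt (Φ x) (Y (Φ x t)) t) (h0' : ∀ x, Φ' x 0 = x)
    (h' : ∀ x, ∀ t ∈ Icc (0 : ℝ) 1, HasDerivAt (Φ' x) (-Y (Φ' x t)) t) (x : E) :
    Φ' (Φ x 1) 1 = x := by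
  have hg : ∀ t ∈ Icc (0 : ℝ) 1,
      HasDerivAt (fun s => Φ x (1 - s)) (-Y (Φ x (1 - t))) t := by
    intro t ht
    have h1 := h x (1 - t) ⟨by linarith [ht.2], by linarith [ht.1]⟩
    have h2 := h1.scomp t ((hasDerivAt_id t).const_sub 1)
    rw [neg_one_smul] at h2
    exact h2
  have key := ODE_solution_unique_of_mem_Icc_right (v := fun _ y => -Y y) (s := fun _ => univ)
    (K := L) (f := Φ' (Φ x 1)) (g := fun s => Φ x (1 - s)) (a := 0) (b := 1)
    (fun t _ => hL.neg.lipschitzOnWith)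
    (fun t ht => (h' _ t ht).continuousAt.continuousWithinAt)
    (fun t ht => (h' _ t (Ico_subset_Icc_self ht)).hasDerivWithinAt) (fun _ _ => mem_univ _)
    (fun t ht => (hg t ht).continuousAt.continuousWithinAt)
    (fun t ht => (hg t (Ico_subset_Icc_self ht)).hasDerivWithinAt) (fun _ _ => mem_univ _)
    (by simp [h0'])
  simpa [h0] using key (right_mem_Icc.2 zero_le_one)

theorem flow_eq_of_eq_zero (hL : LipschitzWith L Y) (h0 : ∀ x, Φ x 0 = x)
    (h : ∀ x, ∀ t ∈ Icc (0 : ℝ) 1, HasDerivAt (Φ x) (Y (Φ x t)) t) {x : E} (hx : Y x = 0)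
    {t : ℝ} (ht : t ∈ Icc (0 : ℝ) 1) : Φ x t = x := by
  have key := ODE_solution_unique_of_mem_Icc_right (v := fun _ y => Y y) (s := fun _ => univ)
    (K := L) (f := Φ x) (g := fun _ => x) (a := 0) (b := 1)
    (fun t _ => hL.lipschitzOnWith)
    (fun t ht => (h _ t ht).continuousAt.continuousWithinAt)
    (fun t ht => (h _ t (Ico_subset_Icc_self ht)).hasDerivWithinAt) (fun _ _ => mem_univ _)
    continuousOn_const
    (fun t ht => by simpa [hx] using hasDerivWithinAt_const t (Ici t) x) (fun _ _ => mem_univ _)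
    (h0 x)
  exact key ht

/-- A flow line reaching a zero of Y would, by uniqueness backwards in time, have been constant.
Together with `flow_eq_of_eq_zero`, this keeps flow lines inside an open set containing the support
of Y. -/
theorem flow_ne_zero (hL : LipschitzWith L Y) (h0 : ∀ x, Φ x 0 = x)
    (h : ∀ x, ∀ t ∈ Icc (0 : ℝ) 1, HasDerivAt (Φ x) (Y (Φ x t)) t) {x : E} (hx : Y x ≠ 0)
    {t : ℝ} (ht : t ∈ Icc (0 : ℝ) 1) : Y (Φ x t) ≠ 0 := by
  intro hy
  have hsub : ∀ s ∈ Icc 0 t, s ∈ Icc (0 : ℝ) 1 := fun s hs => ⟨hs.1, hs.2.trans ht.2⟩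
  have key := ODE_solution_unique_of_mem_Icc_left (v := fun _ y => Y y) (s := fun _ => univ)
    (K := L) (f := Φ x) (g := fun _ => Φ x t) (a := 0) (b := t)
    (fun t _ => hL.lipschitzOnWith)
    (fun s hs => (h _ s (hsub s hs)).continuousAt.continuousWithinAt)
    (fun s hs => (h _ s (hsub s (Ioc_subset_Icc_self hs))).hasDerivWithinAt)
    (fun _ _ => mem_univ _) continuousOn_const
    (fun s hs => by simpa [hy] using hasDerivWithinAt_const s (Iic s) (Φ x t))
    (fun _ _ => mem_univ _) rfl
  have e : x = Φ x t := by simpa [h0] using key (left_mem_Icc.2 ht.1)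
  rw [← e] at hy
  exact hx hy

/-- A flow line of a vector field with small Lipschitz constant cannot close up in unit time. -/
theorem flow_one_ne (hL : LipschitzWith L Y) (hL4 : L ≤ 1 / 4) (h0 : ∀ x, Φ x 0 = x)
    (h : ∀ x, ∀ t ∈ Icc (0 : ℝ) 1, HasDerivAt (Φ x) (Y (Φ x t)) t) {x : E} (hx : Y x ≠ 0) :
    Φ x 1 ≠ x := by
  intro hfix
  have hcont : ContinuousOn (fun t => ‖Φ x t - x‖) (Icc 0 1) := fun t ht =>
    ((h x t ht).continuousAt.sub continuousAt_const).norm.continuousWithinAt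
  obtain ⟨s, hs, hmax⟩ := isCompact_Icc.exists_isMaxOn ⟨0, by simp⟩ hcont
  set m := ‖Φ x s - x‖ with hm
  have hLr : (L : ℝ) ≤ 1 / 4 := by exact_mod_cast hL4
  have key : ∀ t ∈ Icc (0 : ℝ) 1, ‖(Φ x t - t • Y x) - (Φ x 0 - (0 : ℝ) • Y x)‖ ≤
      (L * m) * (t - 0) := by
    refine norm_image_sub_le_of_norm_deriv_le_segment' (f := fun t => Φ x t - t • Y x)
      (f' := fun t => Y (Φ x t) - Y x) (fun t ht => ?_) (fun t ht => ?_)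
    · have := (h x t ht).sub ((hasDerivAt_id t).smul_const (Y x))
      rw [one_smul] at this
      exact this.hasDerivWithinAt
    · refine (hL.norm_sub_le _ _).trans ?_
      gcongr
      exact hmax (Ico_subset_Icc_self ht)
  simp only [h0, zero_smul, sub_zero] at key
  have h1 : ‖Y x‖ ≤ L * m := by
    have := key 1 (by simp)
    rw [hfix] at this
    simpa using this
  have hm0 : 0 ≤ m := norm_nonneg _
  have h2 : m ≤ L * m + ‖Y x‖ := by
    have h3 := key s hs
    have h4 : Φ x s - x = (Φ x s - s • Y x - x) + s • Y x := by abel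
    rw [hm]; nth_rewrite 1 [h4]
    refine (norm_add_le _ _).trans ?_
    gcongr
    · exact h3.trans (mul_le_of_le_one_right (mul_nonneg L.2 hm0) hs.2)
    · rw [norm_smul, Real.norm_of_nonneg hs.1]
      exact mul_le_of_le_one_left (norm_nonneg _) hs.2
  -- With m the largest displacement, m ≤ L m + ‖Y x‖ ≤ 2 L m ≤ m / 2, so m = 0, and ‖Y x‖ ≤ L m
  -- vanishes.
  have h5 : ‖Y x‖ ≤ 0 := by nlinarith
  exact hx (norm_le_zero_iff.1 h5)

end FlowFacts

/-! ### Compactly supported symplectic maps from hamiltonian flows. -/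

section Hamiltonian

open Set

universe u

variable {E : Type u} [NormedAddCommGroup E] [NormedSpace ℝ E]

/-- The Lie derivative of a closed `2`-form along a hamiltonian vector field vanishes. -/
theorem lie_derivative_hamiltonian {Ω : E → E [⋀^Fin 2]→L[ℝ] ℝ} {V : Set E} (hV : IsOpen V)
    (hΩ : ContDiffOn ℝ (⊤ : ℕ∞) Ω V) (hc : ∀ y ∈ V, extDeriv Ω y = 0) {H : E → ℝ}
    (hH : ContDiff ℝ (⊤ : ℕ∞) H) {Y : E → E} (hY : ContDiff ℝ (⊤ : ℕ∞) Y)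
    (hYH : ∀ y ∈ V, flat E (Ω y) (Y y) = fderiv ℝ H y) {y : E} (hy : y ∈ V) (a b : E) :
    fderiv ℝ Ω y (Y y) ![a, b] + Ω y ![fderiv ℝ Y y a, b] + Ω y ![a, fderiv ℝ Y y b] = 0 := by
  have hd : DifferentiableAt ℝ Ω y :=
    (hΩ.contDiffAt (hV.mem_nhds hy)).differentiableAt (by simp)
  have hfl : HasFDerivAt (fun y => flat E (Ω y)) (flat E ∘L fderiv ℝ Ω y) y :=
    HasFDerivAt.flat_comp hd.hasFDerivAt
  have hYd : HasFDerivAt Y (fderiv ℝ Y y) y := (hY.differentiable (by simp) y).hasFDerivAt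
  have h1 := hfl.clm_apply hYd
  have h2 : HasFDerivAt (fun y => flat E (Ω y) (Y y)) (fderiv ℝ (fderiv ℝ H) y) y := by
    have h3 : HasFDerivAt (fderiv ℝ H) (fderiv ℝ (fderiv ℝ H) y) y :=
      ((hH.fderiv_right (m := 1) (by norm_cast)).differentiable (by simp) y).hasFDerivAt
    exact h3.congr_of_eventuallyEq (by
      filter_upwards [hV.mem_nhds hy] with z hz using hYH z hz)
  have h3 := h1.unique h2
  have hs : IsSymmSndFDerivAt ℝ H y :=
    hH.contDiffAt.isSymmSndFDerivAt (by
      rw [minSmoothness_of_isRCLikeNormedField]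
      exact WithTop.coe_le_coe.2 (le_top : (2 : ℕ∞) ≤ ⊤))
  -- Differentiating ω(Y, ·) = dH gives the Hessian of H. Its symmetry in a and b, combined with dω
  -- = 0, is Cartan's formula for the Lie derivative along Y.
  have h4 (a b : E) : Ω y ![fderiv ℝ Y y a, b] + fderiv ℝ Ω y a ![Y y, b] =
      fderiv ℝ (fderiv ℝ H) y a b := by
    rw [← h3]; simp
  have h5 := h4 a b
  have h6 := h4 b a
  rw [hs.eq b a, ← h5] at h6
  have h7 := cyclic_of_extDeriv_eq_zero hd (hc y hy) (Y y) a b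
  rw [two_form_swap (Ω y) a]
  linarith

/-- A time-one flow of a hamiltonian vector field preserves the symplectic form. -/
theorem flow_preserves {Ω : E → E [⋀^Fin 2]→L[ℝ] ℝ} {V : Set E} (hV : IsOpen V)
    (hΩ : ContDiffOn ℝ (⊤ : ℕ∞) Ω V) (hc : ∀ y ∈ V, extDeriv Ω y = 0) {H : E → ℝ}
    (hH : ContDiff ℝ (⊤ : ℕ∞) H) {Y : E → E} (hY : ContDiff ℝ (⊤ : ℕ∞) Y)
    (hYH : ∀ y ∈ V, flat E (Ω y) (Y y) = fderiv ℝ H y) {γ δ δ' : ℝ → E}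
    (hγV : ∀ t ∈ Icc (0 : ℝ) 1, γ t ∈ V)
    (hγ : ∀ t ∈ Icc (0 : ℝ) 1, HasDerivAt γ (Y (γ t)) t)
    (hδ : ∀ t ∈ Icc (0 : ℝ) 1, HasDerivAt δ (fderiv ℝ Y (γ t) (δ t)) t)
    (hδ' : ∀ t ∈ Icc (0 : ℝ) 1, HasDerivAt δ' (fderiv ℝ Y (γ t) (δ' t)) t) :
    Ω (γ 1) ![δ 1, δ' 1] = Ω (γ 0) ![δ 0, δ' 0] := by
  -- Along solutions of the linearized flow, the derivative of ω(δ, δ') is the Lie derivative of ω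
  -- evaluated on δ and δ'.
  have key : ∀ t ∈ Icc (0 : ℝ) 1, HasDerivAt (fun t => flat E (Ω (γ t)) (δ t) (δ' t)) 0 t := by
    intro t ht
    have hd : DifferentiableAt ℝ Ω (γ t) :=
      (hΩ.contDiffAt (hV.mem_nhds (hγV t ht))).differentiableAt (by simp)
    have hfl : HasFDerivAt (fun y => flat E (Ω y)) (flat E ∘L fderiv ℝ Ω (γ t)) (γ t) :=
      HasFDerivAt.flat_comp hd.hasFDerivAt
    have h0 : HasDerivAt (fun t => flat E (Ω (γ t))) (flat E (fderiv ℝ Ω (γ t) (Y (γ t)))) t :=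
      HasFDerivAt.comp_hasDerivAt (F := E) (E := E →L[ℝ] E →L[ℝ] ℝ) t hfl (hγ t ht)
    have h1 := (h0.clm_apply (hδ t ht)).clm_apply (hδ' t ht)
    refine h1.congr_deriv ?_
    have h2 := lie_derivative_hamiltonian hV hΩ hc hH hY hYH (hγV t ht) (δ t) (δ' t)
    simp only [_root_.add_apply, flat_apply]
    linarith
  exact constant_of_has_deriv_right_zero (f := fun t => flat E (Ω (γ t)) (δ t) (δ' t))
    (fun t ht => (key t ht).continuousAt.continuousWithinAt)
    (fun t ht => (key t (Ico_subset_Icc_self ht)).hasDerivWithinAt) 1 (by simp)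

variable [FiniteDimensional ℝ E]

/-- The map `v ↦ ω(v, ·)` of a nondegenerate form, as an equivalence. -/
theorem exists_equiv_flat {w : E [⋀^Fin 2]→L[ℝ] ℝ} (hw : ∀ a, (∀ b, w ![a, b] = 0) → a = 0) :
    ∃ e : E ≃L[ℝ] (E →L[ℝ] ℝ), (e : E →L[ℝ] E →L[ℝ] ℝ) = flat E w := by
  have hinj : Function.Injective (flat E w).toLinearMap := by
    rw [← LinearMap.ker_eq_bot, LinearMap.ker_eq_bot']
    intro a ha
    exact hw a fun b => congrArg (fun f : E →L[ℝ] ℝ => f b) ha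
  have hr : Module.finrank ℝ E = Module.finrank ℝ (E →L[ℝ] ℝ) := by
    rw [← (LinearMap.toContinuousLinearMap : (E →ₗ[ℝ] ℝ) ≃ₗ[ℝ] E →L[ℝ] ℝ).finrank_eq]
    exact (Subspace.dual_finrank_eq (K := ℝ) (V := E)).symm
  refine ⟨(LinearMap.linearEquivOfInjective _ hinj hr).toContinuousLinearEquiv, ?_⟩
  ext a b
  rfl

/-- A nonempty open set with a symplectic form carries a nontrivial compactly supported
symplectic diffeomorphism. -/
theorem exists_compactly_supported_symplecto [Nontrivial E] {Ω : E → E [⋀^Fin 2]→L[ℝ] ℝ}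
    {V : Set E} (hV : IsOpen V) (hVn : V.Nonempty) (hΩ : ContDiffOn ℝ (⊤ : ℕ∞) Ω V)
    (hc : ∀ y ∈ V, extDeriv Ω y = 0) (hnd : ∀ y ∈ V, ∀ a, (∀ b, Ω y ![a, b] = 0) → a = 0) :
    ∃ (θ : E ≃ E) (K : Set E), ContDiff ℝ (⊤ : ℕ∞) θ ∧ ContDiff ℝ (⊤ : ℕ∞) θ.symm ∧
      IsCompact K ∧ K ⊆ V ∧ (∀ y ∉ K, θ y = y) ∧ (∃ y, θ y ≠ y) ∧
      (∀ y ∈ V, ∀ a b, Ω (θ y) ![fderiv ℝ θ y a, fderiv ℝ θ y b] = Ω y ![a, b]) ∧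
      ∀ y ∈ V, ∀ a b, Ω (θ.symm y) ![fderiv ℝ θ.symm y a, fderiv ℝ θ.symm y b] = Ω y ![a, b] := by
  obtain ⟨y₀, hy₀⟩ := hVn
  obtain ⟨r, hr, hball⟩ := Metric.isOpen_iff.1 hV y₀ hy₀
  let f : ContDiffBump y₀ := ⟨r / 4, r / 2, by positivity, by linarith⟩
  let K := Metric.closedBall y₀ (r / 2)
  have hKV : K ⊆ V := (Metric.closedBall_subset_ball (by linarith)).trans hball
  have hf : ContDiff ℝ (⊤ : ℕ∞) f := f.contDiff
  have hdf : ContDiff ℝ (⊤ : ℕ∞) (fderiv ℝ f) := hf.fderiv_right (by simp)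
  have hfK : ∀ y ∉ K, fderiv ℝ f y = 0 := by
    intro y hy
    by_contra h
    have := support_fderiv_subset ℝ (f := f) h
    rw [f.tsupport_eq] at this
    exact hy this
  -- The hamiltonian field of the bump function. Off V the form is arbitrary, but there df = 0, and
  -- `inverse` is always linear, so X vanishes off K.
  let X : E → E := fun y => (flat E (Ω y)).inverse (fderiv ℝ f y)
  have hXK : ∀ y ∉ K, X y = 0 := fun y hy => by simp [X, hfK y hy]
  have hXf : ∀ y ∈ V, flat E (Ω y) (X y) = fderiv ℝ f y := by
    intro y hy
    obtain ⟨e, he⟩ := exists_equiv_flat (hnd y hy)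
    simp only [X, ← he, ContinuousLinearMap.inverse_equiv]
    exact e.apply_symm_apply _
  have hXs : ContDiff ℝ (⊤ : ℕ∞) X := by
    refine contDiff_iff_contDiffAt.2 fun y => ?_
    by_cases hy : y ∈ V
    · obtain ⟨e, he⟩ := exists_equiv_flat (hnd y hy)
      have h1 : ContDiffAt ℝ (⊤ : ℕ∞) (fun y => flat E (Ω y)) y :=
        contDiff_flat.contDiffAt.comp y (hΩ.contDiffAt (hV.mem_nhds hy))
      have h2 : ContDiffAt ℝ (⊤ : ℕ∞) ContinuousLinearMap.inverse (flat E (Ω y)) := by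
        rw [← he]; exact contDiffAt_map_inverse e
      exact (h2.comp y h1).clm_apply hdf.contDiffAt
    · have hyK : Kᶜ ∈ nhds y :=
        (Metric.isClosed_closedBall.isOpen_compl).mem_nhds fun h => hy (hKV h)
      refine (contDiffAt_const (c := (0 : E))).congr_of_eventuallyEq ?_
      filter_upwards [hyK] with z hz using hXK z hz
  have hXc : HasCompactSupport X :=
    HasCompactSupport.intro (isCompact_closedBall y₀ (r / 2)) hXK
  obtain ⟨L, hL⟩ := hXs.lipschitzWith_of_hasCompactSupport hXc (by simp)
  have hLpos : (0 : ℝ) < 4 * (L + 1) := by positivity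
  -- Scaling brings the Lipschitz constant down to 1/4: below 1 for the flow to exist, and small
  -- enough for `flow_one_ne` to show that it moves points.
  set s : ℝ := (4 * (L + 1))⁻¹ with hs
  have hs0 : 0 < s := by positivity
  let Y : E → E := fun y => s • X y
  have hYs : ContDiff ℝ (⊤ : ℕ∞) Y := contDiff_const.smul hXs
  have hYL : LipschitzWith (1 / 4) Y := by
    refine LipschitzWith.of_dist_le_mul fun a b => ?_
    rw [dist_smul₀, Real.norm_of_nonneg hs0.le]
    have h1 := hL.dist_le_mul a b
    have h2 : s * L ≤ 1 / 4 := by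
      rw [hs, inv_mul_le_iff₀ hLpos]
      have := L.2
      linarith
    calc s * dist (X a) (X b) ≤ s * (L * dist a b) := by gcongr
      _ = (s * L) * dist a b := by ring
      _ ≤ (1 / 4) * dist a b := by gcongr
      _ = _ := by norm_num
  have hYL' : LipschitzWith (1 / 4) (fun y => -Y y) := hYL.neg
  have hYK : ∀ y ∉ K, Y y = 0 := fun y hy => by simp [Y, hXK y hy]
  let H : E → ℝ := fun y => s * f y
  have hH : ContDiff ℝ (⊤ : ℕ∞) H := contDiff_const.mul hf
  have hfd (y : E) : DifferentiableAt ℝ f y := hf.differentiable (by simp) y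
  have hYH : ∀ y ∈ V, flat E (Ω y) (Y y) = fderiv ℝ H y := by
    intro y hy
    simp only [Y, H, map_smul, hXf y hy]
    rw [fderiv_const_mul (hfd y)]
  have hYH' : ∀ y ∈ V, flat E (Ω y) (-Y y) = fderiv ℝ (fun y => -H y) y := by
    intro y hy
    rw [map_neg, hYH y hy, fderiv_fun_neg]
  have h14 : (1 / 4 : NNReal) < 1 := by
    rw [div_lt_one (by norm_num)]; norm_num
  obtain ⟨Φ, h0, hΦ, hΦs, hΦd⟩ := exists_smooth_flow hYs hYL h14
  obtain ⟨Φ', h0', hΦ', hΦs', hΦd'⟩ := exists_smooth_flow hYs.neg hYL' h14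
  have hinv : ∀ x, Φ' (Φ x 1) 1 = x := flow_reverse hYL h0 hΦ h0' hΦ'
  have hinv' : ∀ x, Φ (Φ' x 1) 1 = x :=
    flow_reverse hYL' h0' hΦ' h0 (fun x t ht => by simpa using hΦ x t ht)
  have hstay : ∀ y ∈ V, ∀ t ∈ Icc (0 : ℝ) 1, Φ y t ∈ V := by
    intro y hy t ht
    by_cases hY0 : Y y = 0
    · rwa [flow_eq_of_eq_zero hYL h0 hΦ hY0 ht]
    · have := flow_ne_zero hYL h0 hΦ hY0 ht
      by_contra hn
      exact this (hYK _ fun h => hn (hKV h))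
  have hstay' : ∀ y ∈ V, ∀ t ∈ Icc (0 : ℝ) 1, Φ' y t ∈ V := by
    intro y hy t ht
    by_cases hY0 : -Y y = 0
    · rwa [flow_eq_of_eq_zero hYL' h0' hΦ' hY0 ht]
    · have := flow_ne_zero hYL' h0' hΦ' hY0 ht
      by_contra hn
      exact this (by rw [hYK _ fun h => hn (hKV h), neg_zero])
  let θ : E ≃ E := ⟨fun x => Φ x 1, fun x => Φ' x 1, hinv, hinv'⟩
  refine ⟨θ, K, hΦs, hΦs', isCompact_closedBall _ _, hKV, fun y hy => ?_, ?_, ?_, ?_⟩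
  · exact flow_eq_of_eq_zero hYL h0 hΦ (hYK y hy) (by simp)
  -- The bump is 1 at its centre and 0 at distance at least r / 2, so it has a noncritical point;
  -- the time-one map moves that point.
  · have : ∃ y, fderiv ℝ f y ≠ 0 := by
      by_contra! hz
      obtain ⟨v, hv⟩ := NormedSpace.exists_lt_norm ℝ E (r / 2)
      have h1 := is_const_of_fderiv_eq_zero (𝕜 := ℝ) (fun y => hfd y) hz y₀ (y₀ + v)
      rw [f.zero_of_le_dist (x := y₀ + v) (by simpa [f] using hv.le)] at h1
      have h2 : f y₀ = 1 := f.one_of_mem_closedBall (by simp [f]; positivity)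
      rw [h2] at h1
      exact one_ne_zero h1
    obtain ⟨y, hy⟩ := this
    have hyK : y ∈ K := by
      by_contra h
      exact hy (hfK y h)
    refine ⟨y, flow_one_ne hYL le_rfl h0 hΦ fun h => hy ?_⟩
    have h1 : X y = 0 := by simpa [Y, hs0.ne'] using h
    rw [← hXf y (hKV hyK), h1, map_zero]
  · intro y hy a b
    obtain ⟨δ, hδ0, hδ1, hδ⟩ := hΦd y a
    obtain ⟨δ', hδ0', hδ1', hδ'⟩ := hΦd y b
    have := flow_preserves hV hΩ hc hH hYs hYH (hstay y hy) (hΦ y) hδ hδ'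
    rwa [hδ0, hδ0', hδ1, hδ1', h0] at this
  · intro y hy a b
    obtain ⟨δ, hδ0, hδ1, hδ⟩ := hΦd' y a
    obtain ⟨δ', hδ0', hδ1', hδ'⟩ := hΦd' y b
    have := flow_preserves hV hΩ hc hH.neg hYs.neg hYH' (hstay' y hy) (hΦ' y) hδ hδ'
    rwa [hδ0, hδ0', hδ1, hδ1', h0'] at this

end Hamiltonian

/-! ### Smoothness, primitives and invariance of forms on vector spaces. -/

section FormsOnVectorSpaces

open Set

variable {E : Type*} [NormedAddCommGroup E] [NormedSpace ℝ E] {F : Type*} [NormedAddCommGroup F]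
  [NormedSpace ℝ F]

variable (E) in
/-- Antisymmetrization of a bilinear form. -/
noncomputable def alternateBilin : (E →L[ℝ] E →L[ℝ] ℝ) →L[ℝ] E [⋀^Fin 2]→L[ℝ] ℝ :=
  (ContinuousAlternatingMap.alternatizeUncurryFinCLM ℝ E ℝ (n := 1)).comp
    (ContinuousLinearMap.compL ℝ E (E →L[ℝ] ℝ) (E [⋀^Fin 1]→L[ℝ] ℝ)
      ((ContinuousAlternatingMap.ofSubsingletonLIE (𝕜 := ℝ) (E := E) (F := ℝ) (0 : Fin
          1)).toContinuousLinearEquiv :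
        (E →L[ℝ] ℝ) →L[ℝ] E [⋀^Fin 1]→L[ℝ] ℝ))

theorem alternateBilin_flat (w : E [⋀^Fin 2]→L[ℝ] ℝ) :
    alternateBilin E (flat E w) = (2 : ℝ) • w := by
  ext v
  obtain ⟨a, b, rfl⟩ : ∃ a b, v = ![a, b] := ⟨v 0, v 1, by ext i; fin_cases i <;> rfl⟩
  have h : alternateBilin E (flat E w) ![a, b] = flat E w a b - flat E w b a := by
    simp [alternateBilin, ContinuousAlternatingMap.alternatizeUncurryFin_apply,
      Fin.sum_univ_two, Fin.removeNth]
    rfl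
  rw [h, flat_swap w b a]
  simp
  ring

/-- Half of the antisymmetrization is a continuous linear left inverse of `flat`. Smoothness can
thus be tested on bilinear maps, and in finite dimension on fixed pairs of vectors. -/
theorem contDiffOn_two_form [FiniteDimensional ℝ E] {n : WithTop ℕ∞}
    {Ω : F → E [⋀^Fin 2]→L[ℝ] ℝ} {s : Set F}
    (h : ∀ a b, ContDiffOn ℝ n (fun y => Ω y ![a, b]) s) : ContDiffOn ℝ n Ω s := by
  have h1 : ContDiffOn ℝ n (fun y => flat E (Ω y)) s :=
    contDiffOn_clm_apply.2 fun a => contDiffOn_clm_apply.2 fun b => h a b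
  have h2 : ContDiff ℝ n (fun B => alternateBilin E B) :=
    ContinuousLinearMap.contDiff (E := E →L[ℝ] E →L[ℝ] ℝ) (F := E [⋀^Fin 2]→L[ℝ] ℝ) _
  have h3 : Ω = fun y => (1 / 2 : ℝ) • alternateBilin E (flat E (Ω y)) := by
    funext y
    rw [alternateBilin_flat, smul_smul (1 / 2 : ℝ) (2 : ℝ) (Ω y)]
    norm_num
  rw [h3]
  exact (h2.comp_contDiffOn h1).const_smul (1 / 2 : ℝ)

theorem ContDiffOn.two_form_apply {n : WithTop ℕ∞} {Ω : F → E [⋀^Fin 2]→L[ℝ] ℝ} {s : Set F}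
    (h : ContDiffOn ℝ n Ω s) {a b : F → E} (ha : ContDiffOn ℝ n a s) (hb : ContDiffOn ℝ n b s) :
    ContDiffOn ℝ n (fun y => Ω y ![a y, b y]) s :=
  ((contDiff_flat.comp_contDiffOn h).clm_apply ha).clm_apply hb

/-- The pullback of a smooth `2`-form is smooth. -/
theorem ContDiffOn.two_form_pullback [FiniteDimensional ℝ F] {Ω : E → E [⋀^Fin 2]→L[ℝ] ℝ}
    {t : Set E} (h : ContDiffOn ℝ (⊤ : ℕ∞) Ω t) {j : F → E} {s : Set F} (hs : IsOpen s)
    (hj : ContDiffOn ℝ (⊤ : ℕ∞) j s) (hst : MapsTo j s t) :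
    ContDiffOn ℝ (⊤ : ℕ∞) (fun y => (Ω (j y)).compContinuousLinearMap (fderiv ℝ j y)) s := by
  have hj' : ContDiffOn ℝ (⊤ : ℕ∞) (fderiv ℝ j) s := hj.fderiv_of_isOpen hs (by simp)
  refine contDiffOn_two_form fun a b => ?_
  have h1 := ContDiffOn.two_form_apply (h.comp hj hst) (hj'.clm_apply contDiffOn_const)
    (hj'.clm_apply contDiffOn_const) (a := fun y => fderiv ℝ j y a) (b := fun y => fderiv ℝ j y b)
  refine h1.congr fun y _ => ?_
  change Ω (j y) (fderiv ℝ j y ∘ ![a, b]) = Ω (j y) ![_, _]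
  congr 1
  ext i; fin_cases i <;> rfl

/-- A smooth closed `1`-form on a ball has a smooth primitive. -/
theorem exists_primitive_of_closed {α : E → E [⋀^Fin 1]→L[ℝ] ℝ} {x : E} {r : ℝ}
    (hα : ContDiffOn ℝ (⊤ : ℕ∞) α (Metric.ball x r))
    (hc : ∀ y ∈ Metric.ball x r, extDeriv α y = 0) :
    ∃ f : E → ℝ, ContDiffOn ℝ (⊤ : ℕ∞) f (Metric.ball x r) ∧
      ∀ y ∈ Metric.ball x r, ∀ v, fderiv ℝ f y v = α y ![v] := by
  let T := (ContinuousAlternatingMap.ofSubsingletonLIE (𝕜 := ℝ) (E := E) (F := ℝ) (0 : Fin 1)).symm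
  let β : E → E →L[ℝ] ℝ := fun y => T (α y)
  have hv (v : E) : (fun _ : Fin 1 => v) = ![v] := by ext i; fin_cases i; rfl
  have hβv (y v) : β y v = α y ![v] := by
    rw [← hv]
    have h1 : α y = (ContinuousAlternatingMap.ofSubsingletonLIE (𝕜 := ℝ) (E := E) (F := ℝ) (0 : Fin
        1)) (β y) :=
      (LinearIsometryEquiv.apply_symm_apply _ _).symm
    rw [h1]
    rfl
  have hTs : ContDiff ℝ (⊤ : ℕ∞) (fun w => T w) :=
    T.toContinuousLinearEquiv.contDiff
  have hβ : ContDiffOn ℝ (⊤ : ℕ∞) β (Metric.ball x r) := hTs.comp_contDiffOn hα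
  have hopen : IsOpen (Metric.ball x r) := Metric.isOpen_ball
  have hαd : ∀ y ∈ Metric.ball x r, DifferentiableAt ℝ α y := fun y hy =>
    (hα.contDiffAt (hopen.mem_nhds hy)).differentiableAt (by simp)
  have hβd : ∀ y ∈ Metric.ball x r, DifferentiableAt ℝ β y := fun y hy =>
    (hβ.contDiffAt (hopen.mem_nhds hy)).differentiableAt (by simp)
  have hβ' : ∀ y ∈ Metric.ball x r, ∀ u v, fderiv ℝ β y u v = fderiv ℝ (α · ![v]) y u := by
    intro y hy u v
    have h1 : (fun y => α y ![v]) = fun y => β y v := funext fun y => (hβv y v).symm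
    rw [h1, fderiv_clm_apply (hβd y hy) (differentiableAt_const v)]
    simp
  -- Closedness of a 1-form is symmetry of its derivative, and the Poincaré lemma holds on the
  -- convex ball.
  obtain ⟨f, hf⟩ := (convex_ball x r).exists_forall_hasFDerivAt_of_fderiv_symmetric hopen
    (fun y hy => (hβd y hy).differentiableWithinAt) (fun y hy u v => by
      have h1 := extDeriv_apply (hαd y hy) ![u, v]
      have e0 : (0 : Fin 2).removeNth ![u, v] = ![v] := by ext i; fin_cases i; rfl
      have e1 : (1 : Fin 2).removeNth ![u, v] = ![u] := by ext i; fin_cases i; rfl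
      rw [hc y hy, Fin.sum_univ_two, e0, e1] at h1
      rw [hβ' y hy, hβ' y hy]
      simp at h1
      linarith)
  refine ⟨f, (contDiffOn_infty_iff_fderiv_of_isOpen hopen).2
    ⟨fun y hy => (hf y hy).differentiableAt.differentiableWithinAt,
      hβ.congr fun y hy => (hf y hy).fderiv⟩, fun y hy v => ?_⟩
  rw [(hf y hy).fderiv, hβv]

/-- A closed `2`-form on a product with an interval which is annihilated by the interval
direction does not depend on the interval coordinate. -/
theorem two_form_invariant {W : E × ℝ → (E × ℝ) [⋀^Fin 2]→L[ℝ] ℝ} {V : Set E} (hV : IsOpen V)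
    {ε : ℝ} (hW : ContDiffOn ℝ (⊤ : ℕ∞) W (V ×ˢ Ioo (-ε) ε))
    (hc : ∀ b ∈ V ×ˢ Ioo (-ε) ε, extDeriv W b = 0)
    (hker : ∀ b ∈ V ×ˢ Ioo (-ε) ε, ∀ u, W b ![((0 : E), (1 : ℝ)), u] = 0) {y : E} (hy : y ∈ V)
    {z : ℝ} (hz : z ∈ Ioo (-ε) ε) (u v : E × ℝ) : W (y, z) ![u, v] = W (y, 0) ![u, v] := by
  have hopen : IsOpen (V ×ˢ Ioo (-ε) ε) := hV.prod isOpen_Ioo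
  have h0 : (0 : ℝ) ∈ Ioo (-ε) ε := by constructor <;> linarith [hz.1, hz.2]
  have hWd : ∀ b ∈ V ×ˢ Ioo (-ε) ε, DifferentiableAt ℝ W b := fun b hb =>
    (hW.contDiffAt (hopen.mem_nhds hb)).differentiableAt (by simp)
  have hker' : ∀ b ∈ V ×ˢ Ioo (-ε) ε, ∀ u v, fderiv ℝ W b u ![((0 : E), (1 : ℝ)), v] = 0 := by
    intro b hb u v
    rw [← fderiv_continuousAlternatingMap_apply_const_apply (hWd b hb)]
    have h1 : (fun b => W b ![((0 : E), (1 : ℝ)), v]) =ᶠ[nhds b] fun _ => 0 := by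
      filter_upwards [hopen.mem_nhds hb] with b' hb' using hker b' hb' v
    rw [h1.fderiv_eq]
    simp
  -- In the three-term formula for dW = 0 with first argument ∂_z, the two terms in which ∂_z is
  -- inserted into a derivative of W vanish, leaving ∂_z W(u, v) = 0.
  have hD : ∀ b ∈ V ×ˢ Ioo (-ε) ε, fderiv ℝ W b ((0 : E), (1 : ℝ)) ![u, v] = 0 := by
    intro b hb
    have h1 := cyclic_of_extDeriv_eq_zero (hWd b hb) (hc b hb) ((0 : E), (1 : ℝ)) u v
    rw [hker' b hb, hker' b hb] at h1
    linarith
  have hder : ∀ s ∈ Ioo (-ε) ε, HasDerivAt (fun s => W (y, s) ![u, v]) 0 s := by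
    intro s hs
    have hb : (y, s) ∈ V ×ˢ Ioo (-ε) ε := ⟨hy, hs⟩
    have h1 : HasFDerivAt (fun b => W b ![u, v]) (fderiv ℝ (fun b => W b ![u, v]) (y, s)) (y,
        s) := by
      refine DifferentiableAt.hasFDerivAt ?_
      have := ((ContDiffOn.two_form_apply hW (contDiffOn_const (c := u))
        (contDiffOn_const (c := v))).contDiffAt (hopen.mem_nhds hb)).differentiableAt (by simp)
      exact this
    have h2 : HasDerivAt (fun s : ℝ => (y, s)) ((0 : E), (1 : ℝ)) s :=
      (hasDerivAt_const s y).prodMk (hasDerivAt_id s)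
    have h3 := h1.comp_hasDerivAt s h2
    rwa [fderiv_continuousAlternatingMap_apply_const_apply (hWd _ hb), hD _ hb] at h3
  exact (convex_Ioo (-ε) ε).is_const_of_fderivWithin_eq_zero (𝕜 := ℝ)
    (fun s hs => (hder s hs).differentiableAt.differentiableWithinAt) (fun s hs => by
      rw [(hder s hs).hasFDerivAt.hasFDerivWithinAt.fderivWithin
        (isOpen_Ioo.uniqueDiffWithinAt hs)]
      simp) hz h0

end FormsOnVectorSpaces

/-! ### Forms recovered from their chart expressions. -/

section InChart

variable {m : ℕ} {M : Type*} [TopologicalSpace M] [ChartedSpace (EuclideanSpace ℝ (Fin m)) M]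
  [IsManifold (𝓡 m) (⊤ : ℕ∞) M]

theorem isManifold_one : IsManifold (𝓡 m) 1 M :=
  IsManifold.of_le (n := (⊤ : ℕ∞)) (by exact_mod_cast le_top)

/-- A differential form is the pullback of its expression in a chart. -/
theorem DForm.apply_eq_inChart {k : ℕ} (α : DForm m M k)
    {e : OpenPartialHomeomorph M (EuclideanSpace ℝ (Fin m))}
    (he : e ∈ atlas (EuclideanSpace ℝ (Fin m)) M) {q : M} (hq : q ∈ e.source)
    (v : Fin k → TangentSpace (𝓡 m) q) :
    α q v = α.inChart e (e q) (fun i => mfderiv (𝓡 m) (𝓡 m) e q (v i)) := by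
  have := isManifold_one (m := m) (M := M)
  obtain ⟨y, hy, rfl⟩ : ∃ y ∈ e.target, e.symm y = q := ⟨e q, e.map_source hq, e.left_inv hq⟩
  have hmd := mdifferentiable_of_mem_atlas (I := 𝓡 m) he
  let w : Fin k → EuclideanSpace ℝ (Fin m) := fun i => mfderiv (𝓡 m) (𝓡 m) e (e.symm y) (v i)
  have h1 : α.inChart e (e (e.symm y)) w = α.inChart e y w := by rw [e.right_inv hy]
  refine Eq.trans ?_ h1.symm
  change α (e.symm y) v = α (e.symm y) (fun i => mfderiv (𝓡 m) (𝓡 m) e.symm y (w i))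
  congr 1
  funext i
  have h2 := hmd.symm.comp_symm_deriv hq
  have h3 : mfderiv (𝓡 m) (𝓡 m) e.symm (e (e.symm y)) (w i) =
      mfderiv (𝓡 m) (𝓡 m) e.symm y (w i) := by rw [e.right_inv hy]
  refine Eq.trans ?_ h3
  exact (congrArg (fun T : EuclideanSpace ℝ (Fin m) →L[ℝ] EuclideanSpace ℝ (Fin m) => T (v i))
    h2).symm

end InChart

/-! ### The orbit projection and the kernel of its derivative. -/

section Projection

variable {n : ℕ} {M : Type*} [TopologicalSpace M]
  [ChartedSpace (EuclideanSpace ℝ (Fin (2 * n + 1))) M]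
  {B : Type*} [TopologicalSpace B] [ChartedSpace (EuclideanSpace ℝ (Fin (2 * n))) B]

/-- The data of regularity: the Reeb field is complete and `π` is a submersion whose fibres are
the orbits. -/
structure IsOrbitProjection (S : CosymplecticStructure n M) (π : M → B) : Prop where
  complete : S.ReebComplete
  submersion : Manifold.IsSubmersion (𝓡 (2 * n + 1)) (𝓡 (2 * n)) (⊤ : ℕ∞) π
  fiber : ∀ x y : M, π x = π y ↔ ∃ t : ℝ, S.reebFlow t x = y

variable {S : CosymplecticStructure n M} {π : M → B}

theorem IsOrbitProjection.apply_flow (h : IsOrbitProjection S π) (t : ℝ) (x : M) :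
    π (S.reebFlow t x) = π x :=
  ((h.fiber _ _).2 ⟨t, rfl⟩).symm

theorem reeb_ne_zero (x : M) : S.reeb x ≠ 0 := by
  intro h
  have h1 := S.η_reeb x
  have h2 := one_form_smul (S.η x) 0 (S.reeb x)
  rw [zero_smul, zero_mul, ← h, h1] at h2
  exact one_ne_zero h2

theorem IsOrbitProjection.contMDiff (h : IsOrbitProjection S π) :
    ContMDiff (𝓡 (2 * n + 1)) (𝓡 (2 * n)) (⊤ : ℕ∞) π :=
  h.submersion.contMDiff

theorem IsOrbitProjection.mdifferentiableAt (h : IsOrbitProjection S π) (x : M) :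
    MDifferentiableAt (𝓡 (2 * n + 1)) (𝓡 (2 * n)) π x :=
  h.contMDiff.mdifferentiable (by simp) x

/-- π is constant along Reeb orbits; differentiate at time 0. -/
theorem IsOrbitProjection.mfderiv_reeb (h : IsOrbitProjection S π) (x : M) :
    mfderiv (𝓡 (2 * n + 1)) (𝓡 (2 * n)) π x (S.reeb x) = 0 := by
  have h1 := S.isMIntegralCurve_reebFlow h.complete x 0
  have h2 : HasMFDerivAt 𝓘(ℝ, ℝ) (𝓡 (2 * n)) (π ∘ fun t => S.reebFlow t x) 0 _ :=
    (h.mdifferentiableAt (S.reebFlow 0 x)).hasMFDerivAt.comp 0 h1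
  have h3 : (π ∘ fun t => S.reebFlow t x) = fun _ => π x := funext fun t => h.apply_flow t x
  rw [h3] at h2
  have h4 := hasMFDerivAt_unique h2 (hasMFDerivAt_const (π x) (0 : ℝ))
  have h5 := congrArg (fun T : ℝ →L[ℝ] EuclideanSpace ℝ (Fin (2 * n)) => T 1) h4
  have h6 : mfderiv (𝓡 (2 * n + 1)) (𝓡 (2 * n)) π (S.reebFlow 0 x)
      ((1 : ℝ) • S.reeb (S.reebFlow 0 x)) = 0 := h5
  rw [one_smul, S.reebFlow_zero] at h6
  exact h6

/-- In submersion charts π is the projection ℝ^{2n} × F → ℝ^{2n}, and counting dimensions gives dim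
F = 1. The kernel is a line, and the nonzero Reeb vector lies in it. -/
theorem IsOrbitProjection.exists_smul_reeb [IsManifold (𝓡 (2 * n + 1)) (⊤ : ℕ∞) M]
    (h : IsOrbitProjection S π) (x : M)
    (w : TangentSpace (𝓡 (2 * n + 1)) x)
    (hw : mfderiv (𝓡 (2 * n + 1)) (𝓡 (2 * n)) π x w = 0) : ∃ c : ℝ, w = c • S.reeb x := by
  obtain ⟨F, _, _, hF⟩ := h.submersion.isSubmersionAt x
  have : IsManifold (𝓡 (2 * n + 1)) 1 M := isManifold_one
  let φ := hF.domChart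
  let ψ := hF.codChart
  let L := hF.equiv
  have hφ : φ.MDifferentiable (𝓡 (2 * n + 1)) (𝓡 (2 * n + 1)) :=
    ⟨(contMDiffOn_of_mem_maximalAtlas hF.domChart_mem_maximalAtlas).mdifferentiableOn (by simp),
      (contMDiffOn_symm_of_mem_maximalAtlas hF.domChart_mem_maximalAtlas).mdifferentiableOn
        (by simp)⟩
  have hψ : MDifferentiableAt (𝓡 (2 * n)) (𝓡 (2 * n)) ψ (π x) :=
    (contMDiffAt_of_mem_maximalAtlas hF.codChart_mem_maximalAtlas
      hF.mem_codChart_source).mdifferentiableAt (by simp)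
  have hx : x ∈ φ.source := hF.mem_domChart_source
  have hfin : FiniteDimensional ℝ F := by
    have : FiniteDimensional ℝ (EuclideanSpace ℝ (Fin (2 * n)) × F) :=
      L.toLinearEquiv.finiteDimensional
    exact Module.Finite.of_surjective (LinearMap.snd ℝ (EuclideanSpace ℝ (Fin (2 * n))) F)
      Prod.snd_surjective
  have hrank : Module.finrank ℝ F = 1 := by
    have h1 := L.toLinearEquiv.finrank_eq
    rw [Module.finrank_prod, finrank_euclideanSpace_fin, finrank_euclideanSpace_fin] at h1
    lia
  have hloc : ∀ y ∈ φ.source, (ψ (π y) : EuclideanSpace ℝ (Fin (2 * n))) = (L (φ y)).1 := by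
    intro y hy
    have h1 := hF.writtenInCharts ((hF.domChart.extend (𝓡 (2 * n + 1))).map_source
      (x := y) (by rw [OpenPartialHomeomorph.extend_source]; exact hy))
    simp only [Function.comp_apply] at h1
    rw [OpenPartialHomeomorph.extend_left_inv _ hy] at h1
    exact h1
  have key : ∀ v : TangentSpace (𝓡 (2 * n + 1)) x,
      mfderiv (𝓡 (2 * n + 1)) (𝓡 (2 * n)) π x v = 0 →
      (L (mfderiv (𝓡 (2 * n + 1)) (𝓡 (2 * n + 1)) φ x v)).1 = 0 := by
    intro v hv
    have h1 : HasMFDerivAt (𝓡 (2 * n + 1)) (𝓡 (2 * n)) (ψ ∘ π) x _ :=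
      hψ.hasMFDerivAt.comp x (h.mdifferentiableAt x).hasMFDerivAt
    let A : EuclideanSpace ℝ (Fin (2 * n + 1)) →L[ℝ] EuclideanSpace ℝ (Fin (2 * n)) :=
      (ContinuousLinearMap.fst ℝ _ F).comp
        (L : EuclideanSpace ℝ (Fin (2 * n + 1)) →L[ℝ] EuclideanSpace ℝ (Fin (2 * n)) × F)
    have h2 : HasMFDerivAt (𝓡 (2 * n + 1)) (𝓡 (2 * n)) (A ∘ φ) x _ :=
      A.hasMFDerivAt.comp x (hφ.mdifferentiableAt hx).hasMFDerivAt
    have h3 : (ψ ∘ π) =ᶠ[nhds x] (A ∘ φ) := by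
      filter_upwards [φ.open_source.mem_nhds hx] with y hy using hloc y hy
    have h4 := hasMFDerivAt_unique (h2.congr_of_eventuallyEq h3) h1
    have h5 := congrArg (fun T : EuclideanSpace ℝ (Fin (2 * n + 1)) →L[ℝ]
      EuclideanSpace ℝ (Fin (2 * n)) => T v) h4
    refine Eq.trans h5 ?_
    change mfderiv (𝓡 (2 * n)) (𝓡 (2 * n)) ψ (π x)
      (mfderiv (𝓡 (2 * n + 1)) (𝓡 (2 * n)) π x v) = 0
    rw [hv, map_zero]
  let T : EuclideanSpace ℝ (Fin (2 * n + 1)) →L[ℝ] EuclideanSpace ℝ (Fin (2 * n + 1)) :=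
    mfderiv (𝓡 (2 * n + 1)) (𝓡 (2 * n + 1)) φ x
  have hTinj : Function.Injective T := hφ.mfderiv_injective hx
  let r : EuclideanSpace ℝ (Fin (2 * n + 1)) := S.reeb x
  let w' : EuclideanSpace ℝ (Fin (2 * n + 1)) := w
  have hr1 : (L (T r)).1 = 0 := key _ (h.mfderiv_reeb x)
  have hw1 : (L (T w')).1 = 0 := key _ hw
  have hr2 : (L (T r)).2 ≠ 0 := by
    intro h0
    have h1 : L (T r) = 0 := Prod.ext hr1 h0
    have h2 : T r = T 0 := by
      rw [map_zero]
      exact L.injective (h1.trans (map_zero L).symm)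
    exact reeb_ne_zero x (hTinj h2)
  obtain ⟨c, hc⟩ := exists_smul_eq_of_finrank_eq_one hrank hr2 (L (T w')).2
  refine ⟨c, ?_⟩
  have h1 : L (T w') = L (T (c • r)) := by
    rw [map_smul, map_smul]
    refine Prod.ext ?_ ?_
    · rw [hw1, Prod.smul_fst, hr1, smul_zero]
    · rw [Prod.smul_snd, hc]
  exact hTinj (L.injective h1)

end Projection

/-! ### Coordinates adapted to the orbit projection and to η. -/

section Straightening

open Set

/-- Balls of the sup norm on E × ℝ are products, so shrinking to a ball in the target gives a box
without changing the maps. The interval factor is what allows `two_form_invariant` to be applied. -/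
theorem OpenPartialHomeomorph.exists_box {E F : Type*} [NormedAddCommGroup E] [NormedSpace ℝ E]
    [TopologicalSpace F] (l : OpenPartialHomeomorph F (E × ℝ)) {x : F} (hx : x ∈ l.source)
    (h0 : (l x).2 = 0) :
    ∃ (l' : OpenPartialHomeomorph F (E × ℝ)) (ε : ℝ), 0 < ε ∧ x ∈ l'.source ∧
      l'.source ⊆ l.source ∧ (⇑l' = l) ∧ (⇑l'.symm = l.symm) ∧
      l'.target = Metric.ball (l x).1 ε ×ˢ Ioo (-ε) ε := by
  obtain ⟨ε, hε, hball⟩ := Metric.isOpen_iff.1 l.open_target (l x) (l.map_source hx)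
  have hbox : Metric.ball (l x).1 ε ×ˢ Ioo (-ε) ε ⊆ l.target := by
    refine Subset.trans ?_ hball
    rw [← Prod.mk.eta (p := l x), ← ball_prod_same, h0, Real.ball_eq_Ioo, zero_sub, zero_add]
  refine ⟨(l.symm.restrOpen _ (Metric.isOpen_ball.prod isOpen_Ioo :
    IsOpen (Metric.ball (l x).1 ε ×ˢ Ioo (-ε) ε))).symm, ε, hε, ?_, ?_, rfl, rfl, ?_⟩
  · have : x ∈ l.symm.target ∩ l ⁻¹' (Metric.ball (l x).1 ε ×ˢ Ioo (-ε) ε) :=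
      ⟨hx, by simp [hε], by simp [h0, hε]⟩
    simpa using this
  · intro y hy
    simp only [OpenPartialHomeomorph.restrOpen_toPartialEquiv, mfld_simps] at hy
    exact hy.1
  · simpa using hbox

variable {n : ℕ} {M : Type*} [TopologicalSpace M] [ChartedSpace (EuclideanSpace ℝ (Fin (2 * n +
    1))) M]
  [IsManifold (𝓡 (2 * n + 1)) (⊤ : ℕ∞) M]
  {B : Type*} [TopologicalSpace B] [ChartedSpace (EuclideanSpace ℝ (Fin (2 * n))) B] [IsManifold (𝓡
      (2 * n)) (⊤ : ℕ∞) B]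
  {S : CosymplecticStructure n M} {π : M → B}

/-- Around every point there are coordinates `(y, z)` on a chart, where `y` are coordinates of the
orbit space and `dz = η`. -/
theorem IsOrbitProjection.exists_straightening (h : IsOrbitProjection S π) (p : M) :
    ∃ l : OpenPartialHomeomorph (EuclideanSpace ℝ (Fin (2 * n + 1))) (EuclideanSpace ℝ (Fin (2 *
        n)) × ℝ),
      chartAt (EuclideanSpace ℝ (Fin (2 * n + 1))) p p ∈ l.source ∧ l.source ⊆ (chartAt
          (EuclideanSpace ℝ (Fin (2 * n + 1))) p).target ∧
      (∀ y ∈ l.source, π ((chartAt (EuclideanSpace ℝ (Fin (2 * n + 1))) p).symm y) ∈ (chartAt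
          (EuclideanSpace ℝ (Fin (2 * n))) (π p)).source) ∧
      (∀ y ∈ l.source, (l y).1 = chartAt (EuclideanSpace ℝ (Fin (2 * n))) (π p) (π ((chartAt
          (EuclideanSpace ℝ (Fin (2 * n + 1))) p).symm y))) ∧
      ContDiffOn ℝ (⊤ : ℕ∞) l l.source ∧ ContDiffOn ℝ (⊤ : ℕ∞) l.symm l.target ∧
      (∀ y ∈ l.source, ∀ v, S.η.inChart (chartAt (EuclideanSpace ℝ (Fin (2 * n + 1))) p) y ![v] =
          (fderiv ℝ l y v).2) ∧
      (l (chartAt (EuclideanSpace ℝ (Fin (2 * n + 1))) p p)).2 = 0 := by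
  have : IsManifold (𝓡 (2 * n + 1)) 1 M := isManifold_one
  have : IsManifold (𝓡 (2 * n)) 1 B := isManifold_one
  set e := chartAt (EuclideanSpace ℝ (Fin (2 * n + 1))) p with he
  set c := chartAt (EuclideanSpace ℝ (Fin (2 * n))) (π p) with hc
  have hea : e ∈ atlas (EuclideanSpace ℝ (Fin (2 * n + 1))) M := chart_mem_atlas _ p
  have hmd : e.MDifferentiable (𝓡 (2 * n + 1)) (𝓡 (2 * n + 1)) := mdifferentiable_of_mem_atlas hea
  have hcd : c.MDifferentiable (𝓡 (2 * n)) (𝓡 (2 * n)) := mdifferentiable_of_mem_atlas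
      (chart_mem_atlas _ _)
  have hpe : p ∈ e.source := mem_chart_source _ p
  set x := e p with hx
  have hxt : x ∈ e.target := e.map_source hpe
  obtain ⟨r, hr, hball⟩ := Metric.isOpen_iff.1 e.open_target x hxt
  obtain ⟨f, hfs, hfη⟩ := exists_primitive_of_closed ((S.smooth_η e hea).mono hball)
    (fun y hy => S.closed_η e hea y (hball hy))
  let U : Set (EuclideanSpace ℝ (Fin (2 * n + 1))) := Metric.ball x r ∩ e.symm ⁻¹' (π ⁻¹' c.source)
  have hcont : ContinuousOn e.symm (Metric.ball x r) := e.continuousOn_symm.mono hball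
  have hU : IsOpen U := hcont.isOpen_inter_preimage Metric.isOpen_ball
    (c.open_source.preimage h.contMDiff.continuous)
  have hxU : x ∈ U := by
    refine ⟨Metric.mem_ball_self hr, ?_⟩
    change π (e.symm (e p)) ∈ c.source
    rw [e.left_inv hpe]
    exact mem_chart_source _ _
  let G₁ : EuclideanSpace ℝ (Fin (2 * n + 1)) → EuclideanSpace ℝ (Fin (2 * n)) := fun y => c (π
      (e.symm y))
  -- The last coordinate is a local primitive of η, normalized to vanish at the base point.
  let G : EuclideanSpace ℝ (Fin (2 * n + 1)) → EuclideanSpace ℝ (Fin (2 * n)) × ℝ := fun y => (G₁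
      y, f y - f x)
  have hG₁ : ContDiffOn ℝ (⊤ : ℕ∞) G₁ U := by
    rw [← contMDiffOn_iff_contDiffOn]
    have h1 : ContMDiffOn (𝓡 (2 * n + 1)) (𝓡 (2 * n + 1)) (⊤ : ℕ∞) e.symm U :=
      (contMDiffOn_chart_symm (x := p)).mono fun y hy => hball hy.1
    have h2 : ContMDiffOn (𝓡 (2 * n + 1)) (𝓡 (2 * n)) (⊤ : ℕ∞) (fun y => π (e.symm y)) U :=
      h.contMDiff.comp_contMDiffOn h1
    exact (contMDiffOn_chart (x := π p)).comp h2 fun y hy => hy.2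
  have hG : ContDiffOn ℝ (⊤ : ℕ∞) G U :=
    hG₁.prodMk ((hfs.mono inter_subset_left).sub contDiffOn_const)
  have hGd : ∀ y ∈ U, HasFDerivAt G ((fderiv ℝ G₁ y).prod (fderiv ℝ f y)) y := by
    intro y hy
    have h1 : DifferentiableAt ℝ G₁ y :=
      (hG₁.contDiffAt (hU.mem_nhds hy)).differentiableAt (by simp)
    have h2 : DifferentiableAt ℝ f y :=
      (hfs.contDiffAt (Metric.isOpen_ball.mem_nhds hy.1)).differentiableAt (by simp)
    exact h1.hasFDerivAt.prodMk (h2.hasFDerivAt.sub_const _)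
  -- A vector killed by dπ is a multiple aξ, and η(aξ) = a. This holds on all of U, so the local
  -- inverse is smooth on its whole domain and not just at one point.
  have hinj : ∀ y ∈ U, ∀ v, fderiv ℝ G₁ y v = 0 → fderiv ℝ f y v = 0 → v = 0 := by
    intro y hy v hv1 hv2
    have hyt : y ∈ e.target := hball hy.1
    let w : TangentSpace (𝓡 (2 * n + 1)) (e.symm y) := mfderiv (𝓡 (2 * n + 1)) (𝓡 (2 * n + 1))
        e.symm y v
    have h1 : HasMFDerivAt (𝓡 (2 * n + 1)) (𝓡 (2 * n)) G₁ y _ :=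
      (hcd.mdifferentiableAt hy.2).hasMFDerivAt.comp y
        ((h.mdifferentiableAt (e.symm y)).hasMFDerivAt.comp y
          (hmd.mdifferentiableAt_symm hyt).hasMFDerivAt)
    have h2 := h1.mfderiv
    rw [mfderiv_eq_fderiv] at h2
    have h3 : mfderiv (𝓡 (2 * n)) (𝓡 (2 * n)) c (π (e.symm y)) (mfderiv (𝓡 (2 * n + 1)) (𝓡 (2 * n))
        π (e.symm y) w) = 0 := by
      have h4 := congrArg (fun T : EuclideanSpace ℝ (Fin (2 * n + 1)) →L[ℝ] EuclideanSpace ℝ (Fin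
          (2 * n)) => T v) h2
      exact h4.symm.trans hv1
    have h4 : mfderiv (𝓡 (2 * n + 1)) (𝓡 (2 * n)) π (e.symm y) w = 0 :=
      hcd.mfderiv_injective hy.2 (h3.trans (map_zero _).symm)
    obtain ⟨a, ha⟩ := h.exists_smul_reeb _ w h4
    have h5 : S.η (e.symm y) ![w] = 0 := by
      rw [← hv2, hfη y hy.1]
      change _ = S.η (e.symm y) (mfderiv (𝓡 (2 * n + 1)) (𝓡 (2 * n + 1)) e.symm y ∘ ![v])
      congr 1
      ext i; fin_cases i; rfl
    rw [ha, one_form_smul, S.η_reeb, mul_one] at h5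
    rw [h5, zero_smul] at ha
    exact hmd.symm.mfderiv_injective hyt (ha.trans (map_zero _).symm)
  have hequiv : ∀ y ∈ U, ∃ T : EuclideanSpace ℝ (Fin (2 * n + 1)) ≃L[ℝ] EuclideanSpace ℝ (Fin (2 *
      n)) × ℝ,
      HasFDerivAt G (T : EuclideanSpace ℝ (Fin (2 * n + 1)) →L[ℝ] EuclideanSpace ℝ (Fin (2 * n)) ×
          ℝ) y := by
    intro y hy
    let D := (fderiv ℝ G₁ y).prod (fderiv ℝ f y)
    have hD : Function.Injective D.toLinearMap := by
      rw [← LinearMap.ker_eq_bot, LinearMap.ker_eq_bot']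
      intro v hv
      exact hinj y hy v (congrArg Prod.fst hv) (congrArg Prod.snd hv)
    refine ⟨(LinearMap.linearEquivOfInjective _ hD (by simp)).toContinuousLinearEquiv, ?_⟩
    convert hGd y hy using 1
    exact ContinuousLinearMap.ext fun v => rfl
  obtain ⟨T, hT⟩ := hequiv x hxU
  have hGx : ContDiffAt ℝ (⊤ : ℕ∞) G x := hG.contDiffAt (hU.mem_nhds hxU)
  let l₀ := hGx.toOpenPartialHomeomorph G hT (by simp)
  have hl₀ : ⇑l₀ = G := rfl
  let l := l₀.restrOpen U hU
  have hls : l.source = l₀.source ∩ U := rfl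
  have hl : ⇑l = G := rfl
  have hlU : ∀ y ∈ l.source, y ∈ U := fun y hy => hy.2
  refine ⟨l, ⟨hGx.mem_toOpenPartialHomeomorph_source hT (by simp), hxU⟩, fun y hy => hball hy.2.1,
    fun y hy => hy.2.2, fun y hy => rfl, hG.mono hlU, ?_, ?_, ?_⟩
  · intro b hb
    obtain ⟨T, hT⟩ := hequiv _ (hlU _ (l.map_target hb))
    exact (l.contDiffAt_symm hb hT
      (hG.contDiffAt (hU.mem_nhds (hlU _ (l.map_target hb))))).contDiffWithinAt
  · intro y hy v
    rw [hl, (hGd y (hlU y hy)).fderiv]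
    exact (hfη y (hlU y hy).1 v).symm
  · exact sub_self _

end Straightening

open Set

/-! ### Flow boxes. -/

section Box

section Slice

variable {E : Type*} [NormedAddCommGroup E] [NormedSpace ℝ E]

theorem contDiffOn_slice [FiniteDimensional ℝ E] {W : E × ℝ → (E × ℝ) [⋀^Fin 2]→L[ℝ] ℝ}
    {V : Set E} {J : Set ℝ} (hV : IsOpen V) (hW : ContDiffOn ℝ (⊤ : ℕ∞) W (V ×ˢ J)) (h0 : (0 : ℝ) ∈
        J) :
    ContDiffOn ℝ (⊤ : ℕ∞) (fun y : E =>
      (W (y, 0)).compContinuousLinearMap (ContinuousLinearMap.inl ℝ E ℝ)) V := by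
  have h1 := ContDiffOn.two_form_pullback hW hV (j := ContinuousLinearMap.inl ℝ E ℝ)
    (ContinuousLinearMap.inl ℝ E ℝ).contDiff.contDiffOn fun y hy => ⟨hy, h0⟩
  simp only [ContinuousLinearMap.fderiv] at h1
  exact h1

/-- The exterior derivative commutes with pullback along y ↦ (y, 0). -/
theorem extDeriv_slice {W : E × ℝ → (E × ℝ) [⋀^Fin 2]→L[ℝ] ℝ} {y : E}
    (hW : ContDiffAt ℝ (⊤ : ℕ∞) W (y, 0)) (h : extDeriv W (y, 0) = 0) :
    extDeriv (fun y : E =>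
      (W (y, 0)).compContinuousLinearMap (ContinuousLinearMap.inl ℝ E ℝ)) y = 0 := by
  have h1 : DifferentiableAt ℝ W (ContinuousLinearMap.inl ℝ E ℝ y) :=
    hW.differentiableAt (by simp)
  have h2 := extDeriv_pullback (r := (⊤ : ℕ∞)) h1
    ((ContinuousLinearMap.inl ℝ E ℝ).contDiff.contDiffAt) (by
      rw [minSmoothness_of_isRCLikeNormedField]
      exact WithTop.coe_le_coe.2 (le_top : (2 : ℕ∞) ≤ ⊤))
  simp only [ContinuousLinearMap.fderiv] at h2
  have h3 : extDeriv W (ContinuousLinearMap.inl ℝ E ℝ y) = 0 := h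
  rw [h3] at h2
  refine h2.trans ?_
  ext v
  rfl

end Slice

variable {n : ℕ} {M : Type*} [TopologicalSpace M] [ChartedSpace (EuclideanSpace ℝ (Fin (2 * n +
    1))) M]
  {B : Type*} [TopologicalSpace B] [ChartedSpace (EuclideanSpace ℝ (Fin (2 * n))) B]

/-- A flow box: coordinates `(y, z)` on an open set of `M`, where `y` is the pullback of a
coordinate system of the orbit space, `η = dz`, and `ω` is the pullback of a symplectic form in
the variables `y`. -/
structure FlowBox (S : CosymplecticStructure n M) (π : M → B) where
  κ : OpenPartialHomeomorph M (EuclideanSpace ℝ (Fin (2 * n)) × ℝ)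
  c : OpenPartialHomeomorph B (EuclideanSpace ℝ (Fin (2 * n)))
  V : Set (EuclideanSpace ℝ (Fin (2 * n)))
  ε : ℝ
  Ω : EuclideanSpace ℝ (Fin (2 * n)) → (EuclideanSpace ℝ (Fin (2 * n))) [⋀^Fin 2]→L[ℝ] ℝ
  isOpen_V : IsOpen V
  ε_pos : 0 < ε
  target_eq : κ.target = V ×ˢ Ioo (-ε) ε
  smooth : ContMDiffOn (𝓡 (2 * n + 1)) 𝓘(ℝ, EuclideanSpace ℝ (Fin (2 * n)) × ℝ) (⊤ : ℕ∞) κ κ.source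
  smooth_symm : ContMDiffOn 𝓘(ℝ, EuclideanSpace ℝ (Fin (2 * n)) × ℝ) (𝓡 (2 * n + 1)) (⊤ : ℕ∞)
      κ.symm κ.target
  maps : ∀ q ∈ κ.source, π q ∈ c.source
  fst_eq : ∀ q ∈ κ.source, (κ q).1 = c (π q)
  η_eq : ∀ q ∈ κ.source, ∀ v : TangentSpace (𝓡 (2 * n + 1)) q,
    S.η q ![v] = (mfderiv (𝓡 (2 * n + 1)) 𝓘(ℝ, EuclideanSpace ℝ (Fin (2 * n)) × ℝ) κ q v :
        EuclideanSpace ℝ (Fin (2 * n)) × ℝ).2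
  ω_eq : ∀ q ∈ κ.source, ∀ u v : TangentSpace (𝓡 (2 * n + 1)) q,
    S.ω q ![u, v] = Ω (κ q).1 ![(mfderiv (𝓡 (2 * n + 1)) 𝓘(ℝ,
        EuclideanSpace ℝ (Fin (2 * n)) × ℝ) κ q u : EuclideanSpace ℝ (Fin (2 * n)) × ℝ).1,
      (mfderiv (𝓡 (2 * n + 1)) 𝓘(ℝ, EuclideanSpace ℝ (Fin (2 * n)) × ℝ) κ q v : EuclideanSpace ℝ
          (Fin (2 * n)) × ℝ).1]
  reeb_eq : ∀ q ∈ κ.source, (mfderiv (𝓡 (2 * n + 1)) 𝓘(ℝ, EuclideanSpace ℝ (Fin (2 * n)) × ℝ) κ q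
      (S.reeb q) : EuclideanSpace ℝ (Fin (2 * n)) × ℝ) = (0, 1)
  Ω_smooth : ContDiffOn ℝ (⊤ : ℕ∞) Ω V
  Ω_closed : ∀ y ∈ V, extDeriv Ω y = 0
  Ω_nondeg : ∀ y ∈ V, ∀ a, (∀ b, Ω y ![a, b] = 0) → a = 0

variable {S : CosymplecticStructure n M} {π : M → B}

theorem tangent_eq_zero {q : M} {w : TangentSpace (𝓡 (2 * n + 1)) q} (hη : S.η q ![w] = 0)
    (hω : ∀ u : TangentSpace (𝓡 (2 * n + 1)) q, S.ω q ![w, u] = 0) : w = 0 :=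
  eq_zero_of_wedgeTop_ne_zero (finrank_euclideanSpace_fin : Module.finrank ℝ (EuclideanSpace ℝ (Fin
      (2 * n + 1))) = _)
    (S.volume_ne_zero q) hη hω

theorem mdifferentiable_of_contMDiffOn {κ : OpenPartialHomeomorph M (EuclideanSpace ℝ (Fin (2 * n))
    × ℝ)}
    (h : ContMDiffOn (𝓡 (2 * n + 1)) 𝓘(ℝ, EuclideanSpace ℝ (Fin (2 * n)) × ℝ) (⊤ : ℕ∞) κ κ.source)
    (h' : ContMDiffOn 𝓘(ℝ, EuclideanSpace ℝ (Fin (2 * n)) × ℝ) (𝓡 (2 * n + 1)) (⊤ : ℕ∞) κ.symm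
        κ.target) :
    κ.MDifferentiable (𝓡 (2 * n + 1)) 𝓘(ℝ, EuclideanSpace ℝ (Fin (2 * n)) × ℝ) :=
  ⟨h.mdifferentiableOn (by simp), h'.mdifferentiableOn (by simp)⟩

/-- In coordinates as in a flow box the Reeb field is the last coordinate vector field. -/
theorem IsOrbitProjection.mfderiv_box_reeb (h : IsOrbitProjection S π)
    {κ : OpenPartialHomeomorph M (EuclideanSpace ℝ (Fin (2 * n)) × ℝ)} {c : OpenPartialHomeomorph B
        (EuclideanSpace ℝ (Fin (2 * n)))}
    (hκ : κ.MDifferentiable (𝓡 (2 * n + 1)) 𝓘(ℝ, EuclideanSpace ℝ (Fin (2 * n)) × ℝ))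
    (hc : c.MDifferentiable (𝓡 (2 * n)) (𝓡 (2 * n))) (hm : ∀ q ∈ κ.source, π q ∈ c.source)
    (hf : ∀ q ∈ κ.source, (κ q).1 = c (π q))
    (hη : ∀ q ∈ κ.source, ∀ v : TangentSpace (𝓡 (2 * n + 1)) q,
      S.η q ![v] = (mfderiv (𝓡 (2 * n + 1)) 𝓘(ℝ, EuclideanSpace ℝ (Fin (2 * n)) × ℝ) κ q v :
          EuclideanSpace ℝ (Fin (2 * n)) × ℝ).2)
    {q : M} (hq : q ∈ κ.source) :
    (mfderiv (𝓡 (2 * n + 1)) 𝓘(ℝ, EuclideanSpace ℝ (Fin (2 * n)) × ℝ) κ q (S.reeb q) :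
        EuclideanSpace ℝ (Fin (2 * n)) × ℝ) = (0, 1) := by
  refine Prod.ext ?_ ?_
  · have h1 : HasMFDerivAt (𝓡 (2 * n + 1)) (𝓡 (2 * n)) (c ∘ π) q _ :=
      (hc.mdifferentiableAt (hm q hq)).hasMFDerivAt.comp q (h.mdifferentiableAt q).hasMFDerivAt
    have h2 : HasMFDerivAt (𝓡 (2 * n + 1)) (𝓡 (2 * n)) (ContinuousLinearMap.fst ℝ (EuclideanSpace ℝ
        (Fin (2 * n))) ℝ ∘ κ) q _ :=
      (ContinuousLinearMap.fst ℝ (EuclideanSpace ℝ (Fin (2 * n))) ℝ).hasMFDerivAt.comp q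
        (hκ.mdifferentiableAt hq).hasMFDerivAt
    have h3 : (c ∘ π) =ᶠ[nhds q] (ContinuousLinearMap.fst ℝ (EuclideanSpace ℝ (Fin (2 * n))) ℝ ∘ κ)
        := by
      filter_upwards [κ.open_source.mem_nhds hq] with y hy using (hf y hy).symm
    have h4 := hasMFDerivAt_unique (h2.congr_of_eventuallyEq h3) h1
    have h5 := congrArg (fun T : EuclideanSpace ℝ (Fin (2 * n + 1)) →L[ℝ] EuclideanSpace ℝ (Fin (2
        * n)) => T (S.reeb q)) h4
    refine Eq.trans h5 ?_
    change mfderiv (𝓡 (2 * n)) (𝓡 (2 * n)) c (π q) (mfderiv (𝓡 (2 * n + 1)) (𝓡 (2 * n)) π q (S.reeb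
        q)) = 0
    rw [h.mfderiv_reeb, map_zero]
  · rw [← hη q hq, S.η_reeb]

/-- In straightened coordinates ξ = ∂_z annihilates the closed form ω, so ω does not involve dz and
does not depend on z: it is pulled back from the slice z = 0. No Darboux normal form is required. -/
theorem IsOrbitProjection.exists_flowBox [IsManifold (𝓡 (2 * n + 1)) (⊤ : ℕ∞) M] [IsManifold (𝓡 (2
    * n)) (⊤ : ℕ∞) B]
    (h : IsOrbitProjection S π) (p : M) :
    ∃ b : FlowBox S π, p ∈ b.κ.source ∧ (b.κ p).2 = 0 ∧ b.c = chartAt (EuclideanSpace ℝ (Fin (2 *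
        n))) (π p) := by
  have : IsManifold (𝓡 (2 * n + 1)) 1 M := isManifold_one
  have : IsManifold (𝓡 (2 * n)) 1 B := isManifold_one
  obtain ⟨l₀, hxl₀, hl₀e, hl₀c, hl₀fst, hl₀s, hl₀s', hl₀η, hl₀0⟩ := h.exists_straightening p
  obtain ⟨l, ε, hε, hxl, hll₀, hcoe, hcoes, hlt⟩ :=
    OpenPartialHomeomorph.exists_box l₀ hxl₀ hl₀0
  set e := chartAt (EuclideanSpace ℝ (Fin (2 * n + 1))) p with he
  set c := chartAt (EuclideanSpace ℝ (Fin (2 * n))) (π p) with hc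
  set V := Metric.ball (l₀ (e p)).1 ε with hV
  have hVo : IsOpen V := Metric.isOpen_ball
  have hea : e ∈ atlas (EuclideanSpace ℝ (Fin (2 * n + 1))) M := chart_mem_atlas _ p
  have hmd : e.MDifferentiable (𝓡 (2 * n + 1)) (𝓡 (2 * n + 1)) := mdifferentiable_of_mem_atlas hea
  have hcd : c.MDifferentiable (𝓡 (2 * n)) (𝓡 (2 * n)) := mdifferentiable_of_mem_atlas
      (chart_mem_atlas _ _)
  have hle : l.source ⊆ e.target := hll₀.trans hl₀e
  have hls : ContDiffOn ℝ (⊤ : ℕ∞) l l.source := by rw [hcoe]; exact hl₀s.mono hll₀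
  have hltt : l.target ⊆ l₀.target := by
    intro b hb
    have h1 := l₀.map_source (hll₀ (l.map_target hb))
    have h2 : l (l.symm b) = b := l.right_inv hb
    rw [hcoe] at h2
    rwa [h2] at h1
  have hls' : ContDiffOn ℝ (⊤ : ℕ∞) l.symm l.target := by rw [hcoes]; exact hl₀s'.mono hltt
  let κ := e.trans l
  have hκs : ∀ q ∈ κ.source, q ∈ e.source ∧ e q ∈ l.source := fun q hq => by
    simpa [κ] using hq
  have hκt : κ.target = V ×ˢ Ioo (-ε) ε := by
    rw [← hlt]
    refine Subset.antisymm (fun b hb => ?_) fun b hb => ?_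
    · have : b ∈ l.target ∧ l.symm b ∈ e.target := by simpa [κ] using hb
      exact this.1
    · have : b ∈ l.target ∧ l.symm b ∈ e.target := ⟨hb, hle (l.map_target hb)⟩
      simpa [κ] using this
  have hκ1 : ContMDiffOn (𝓡 (2 * n + 1)) 𝓘(ℝ, EuclideanSpace ℝ (Fin (2 * n)) × ℝ) (⊤ : ℕ∞) κ
      κ.source := by
    have h1 : ContMDiffOn (𝓡 (2 * n + 1)) (𝓡 (2 * n + 1)) (⊤ : ℕ∞) e κ.source :=
      (contMDiffOn_chart (x := p)).mono fun q hq => (hκs q hq).1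
    exact (contMDiffOn_iff_contDiffOn.2 hls).comp h1 fun q hq => (hκs q hq).2
  have hκ2 : ContMDiffOn 𝓘(ℝ, EuclideanSpace ℝ (Fin (2 * n)) × ℝ) (𝓡 (2 * n + 1)) (⊤ : ℕ∞) κ.symm
      κ.target := by
    have h1 : ContMDiffOn (𝓡 (2 * n + 1)) (𝓡 (2 * n + 1)) (⊤ : ℕ∞) e.symm e.target :=
        contMDiffOn_chart_symm (x := p)
    rw [hκt, ← hlt]
    exact h1.comp (contMDiffOn_iff_contDiffOn.2 hls') fun b hb => hle (l.map_target hb)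
  have hκd := mdifferentiable_of_contMDiffOn hκ1 hκ2
  have hld : ∀ y ∈ l.source, DifferentiableAt ℝ l y := fun y hy =>
    (hls.contDiffAt (l.open_source.mem_nhds hy)).differentiableAt (by simp)
  have hdκ : ∀ q ∈ κ.source, ∀ v : TangentSpace (𝓡 (2 * n + 1)) q,
      (mfderiv (𝓡 (2 * n + 1)) 𝓘(ℝ, EuclideanSpace ℝ (Fin (2 * n)) × ℝ) κ q v : EuclideanSpace ℝ
          (Fin (2 * n)) × ℝ) =
        fderiv ℝ l (e q) (mfderiv (𝓡 (2 * n + 1)) (𝓡 (2 * n + 1)) e q v) := by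
    intro q hq v
    obtain ⟨hq1, hq2⟩ := hκs q hq
    have h1 : HasMFDerivAt (𝓡 (2 * n + 1)) 𝓘(ℝ, EuclideanSpace ℝ (Fin (2 * n)) × ℝ) (l ∘ e) q _ :=
      (hld _ hq2).hasFDerivAt.hasMFDerivAt.comp q (hmd.mdifferentiableAt hq1).hasMFDerivAt
    exact congrArg (fun T : EuclideanSpace ℝ (Fin (2 * n + 1)) →L[ℝ] EuclideanSpace ℝ (Fin (2 * n))
        × ℝ => T v) h1.mfderiv
  have hm : ∀ q ∈ κ.source, π q ∈ c.source := by
    intro q hq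
    obtain ⟨hq1, hq2⟩ := hκs q hq
    have := hl₀c _ (hll₀ hq2)
    rwa [e.left_inv hq1] at this
  have hfst : ∀ q ∈ κ.source, (κ q).1 = c (π q) := by
    intro q hq
    obtain ⟨hq1, hq2⟩ := hκs q hq
    have := hl₀fst _ (hll₀ hq2)
    rw [e.left_inv hq1, ← hcoe] at this
    exact this
  have hη : ∀ q ∈ κ.source, ∀ v : TangentSpace (𝓡 (2 * n + 1)) q,
      S.η q ![v] = (mfderiv (𝓡 (2 * n + 1)) 𝓘(ℝ, EuclideanSpace ℝ (Fin (2 * n)) × ℝ) κ q v :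
          EuclideanSpace ℝ (Fin (2 * n)) × ℝ).2 := by
    intro q hq v
    obtain ⟨hq1, hq2⟩ := hκs q hq
    rw [hdκ q hq, hcoe]
    refine Eq.trans ?_ (hl₀η _ (hll₀ hq2) (mfderiv (𝓡 (2 * n + 1)) (𝓡 (2 * n + 1)) e q v))
    rw [S.η.apply_eq_inChart hea hq1]
    congr 1
    ext i; fin_cases i; rfl
  have hreeb : ∀ q ∈ κ.source,
      (mfderiv (𝓡 (2 * n + 1)) 𝓘(ℝ, EuclideanSpace ℝ (Fin (2 * n)) × ℝ) κ q (S.reeb q) :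
          EuclideanSpace ℝ (Fin (2 * n)) × ℝ) = (0, 1) := fun q hq =>
    h.mfderiv_box_reeb hκd hcd hm hfst hη hq
  let W : EuclideanSpace ℝ (Fin (2 * n)) × ℝ → (EuclideanSpace ℝ (Fin (2 * n)) × ℝ) [⋀^Fin 2]→L[ℝ]
      ℝ := fun b =>
    (S.ω.inChart e (l.symm b)).compContinuousLinearMap (fderiv ℝ l.symm b)
  have hWs : ContDiffOn ℝ (⊤ : ℕ∞) W (V ×ˢ Ioo (-ε) ε) := by
    rw [← hlt]
    exact ContDiffOn.two_form_pullback (S.smooth_ω e hea) l.open_target hls'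
      fun b hb => hle (l.map_target hb)
  have hWc : ∀ b ∈ V ×ˢ Ioo (-ε) ε, extDeriv W b = 0 := by
    intro b hb
    rw [← hlt] at hb
    have hbe := hle (l.map_target hb)
    have h1 : DifferentiableAt ℝ (S.ω.inChart e) (l.symm b) :=
      ((S.smooth_ω e hea).contDiffAt (e.open_target.mem_nhds hbe)).differentiableAt (by simp)
    have h2 := extDeriv_pullback h1 (hls'.contDiffAt (l.open_target.mem_nhds hb)) (by
      rw [minSmoothness_of_isRCLikeNormedField]
      exact WithTop.coe_le_coe.2 (le_top : (2 : ℕ∞) ≤ ⊤))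
    rw [S.closed_ω e hea _ hbe] at h2
    refine h2.trans ?_
    ext v
    rfl
  have hWω : ∀ q ∈ κ.source, ∀ u v : TangentSpace (𝓡 (2 * n + 1)) q,
      S.ω q ![u, v] = W (κ q) ![(mfderiv (𝓡 (2 * n + 1)) 𝓘(ℝ,
          EuclideanSpace ℝ (Fin (2 * n)) × ℝ) κ q u : EuclideanSpace ℝ (Fin (2 * n)) × ℝ),
        (mfderiv (𝓡 (2 * n + 1)) 𝓘(ℝ, EuclideanSpace ℝ (Fin (2 * n)) × ℝ) κ q v : EuclideanSpace ℝ
            (Fin (2 * n)) × ℝ)] := by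
    intro q hq u v
    obtain ⟨hq1, hq2⟩ := hκs q hq
    have hinv : l.symm (κ q) = e q := l.left_inv hq2
    have hdinv : ∀ w, fderiv ℝ l.symm (κ q) (fderiv ℝ l (e q) w) = w := by
      intro w
      have h0 : l (e q) ∈ l.target := l.map_source hq2
      have h1 : HasFDerivAt (l.symm ∘ l) _ (e q) :=
        (((hls'.contDiffAt (l.open_target.mem_nhds h0)).differentiableAt
          (by simp)).hasFDerivAt).comp (e q) (hld _ hq2).hasFDerivAt
      have h2 : HasFDerivAt (l.symm ∘ l) (ContinuousLinearMap.id ℝ _) (e q) :=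
        (hasFDerivAt_id (e q)).congr_of_eventuallyEq (by
          filter_upwards [l.open_source.mem_nhds hq2] with y hy using l.left_inv hy)
      exact congrArg (fun T : EuclideanSpace ℝ (Fin (2 * n + 1)) →L[ℝ] EuclideanSpace ℝ (Fin (2 * n
          + 1)) => T w) (h1.unique h2)
    rw [S.ω.apply_eq_inChart hea hq1, hdκ q hq, hdκ q hq]
    change _ = S.ω.inChart e (l.symm (κ q)) (fderiv ℝ l.symm (κ q) ∘ ![_, _])
    rw [hinv]
    congr 1
    funext i
    fin_cases i
    · exact (hdinv _).symm
    · exact (hdinv _).symm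
  have hsrc : ∀ b ∈ V ×ˢ Ioo (-ε) ε, κ.symm b ∈ κ.source ∧ κ (κ.symm b) = b := by
    intro b hb
    rw [← hκt] at hb
    exact ⟨κ.map_target hb, κ.right_inv hb⟩
  have hker : ∀ b ∈ V ×ˢ Ioo (-ε) ε, ∀ u, W b ![((0 : EuclideanSpace ℝ (Fin (2 * n))), (1 : ℝ)),
      u] = 0 := by
    intro b hb u
    obtain ⟨hq, hqb⟩ := hsrc b hb
    obtain ⟨u', hu'⟩ := hκd.mfderiv_surjective hq u
    have h1 := hWω _ hq (S.reeb _) u'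
    rw [hreeb _ hq, S.ω_reeb, hu', hqb] at h1
    exact h1.symm
  let Ω : EuclideanSpace ℝ (Fin (2 * n)) → (EuclideanSpace ℝ (Fin (2 * n))) [⋀^Fin 2]→L[ℝ] ℝ := fun
      y =>
    (W (y, 0)).compContinuousLinearMap (ContinuousLinearMap.inl ℝ (EuclideanSpace ℝ (Fin (2 * n)))
        ℝ)
  have hΩ_apply : ∀ y a b, Ω y ![a, b] = W (y, 0) ![(a, 0), (b, 0)] := by
    intro y a b
    change W (y, 0) (ContinuousLinearMap.inl ℝ (EuclideanSpace ℝ (Fin (2 * n))) ℝ ∘ ![a, b]) = _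
    congr 1
    ext i <;> fin_cases i <;> rfl
  have h0ε : (0 : ℝ) ∈ Ioo (-ε) ε := ⟨by linarith, hε⟩
  have hΩω : ∀ q ∈ κ.source, ∀ u v : TangentSpace (𝓡 (2 * n + 1)) q,
      S.ω q ![u, v] = Ω (κ q).1 ![(mfderiv (𝓡 (2 * n + 1)) 𝓘(ℝ,
          EuclideanSpace ℝ (Fin (2 * n)) × ℝ) κ q u : EuclideanSpace ℝ (Fin (2 * n)) × ℝ).1,
        (mfderiv (𝓡 (2 * n + 1)) 𝓘(ℝ, EuclideanSpace ℝ (Fin (2 * n)) × ℝ) κ q v : EuclideanSpace ℝ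
            (Fin (2 * n)) × ℝ).1] := by
    intro q hq u v
    have hqt : κ q ∈ V ×ˢ Ioo (-ε) ε := by rw [← hκt]; exact κ.map_source hq
    rw [hWω q hq, hΩ_apply, ← two_form_invariant hVo hWs hWc hker hqt.1 hqt.2]
    have hsplit (w : EuclideanSpace ℝ (Fin (2 * n)) × ℝ) : w = (w.1,
        0) + w.2 • ((0 : EuclideanSpace ℝ (Fin (2 * n))), (1 : ℝ)) := by
      ext <;> simp
    have hk1 (w : EuclideanSpace ℝ (Fin (2 * n)) × ℝ) : W (κ q) ![((0 : EuclideanSpace ℝ (Fin (2 *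
        n))), (1 : ℝ)), w] = 0 := hker _ hqt w
    have hk2 (w : EuclideanSpace ℝ (Fin (2 * n)) × ℝ) : W (κ q) ![w,
        ((0 : EuclideanSpace ℝ (Fin (2 * n))), (1 : ℝ))] = 0 := by
      rw [two_form_swap, hk1, neg_zero]
    -- The ∂_z components of both arguments drop out because ∂_z spans a kernel direction.
    have hW2 (a b : EuclideanSpace ℝ (Fin (2 * n)) × ℝ) : W (κ q) ![a, b] = W (κ q) ![(a.1, 0),
        (b.1, 0)] := by
      conv_lhs => rw [hsplit a, hsplit b]
      rw [two_form_add_left, two_form_smul_left, hk1, two_form_add_right, two_form_smul_right,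
        hk2]
      ring
    exact hW2 _ _
  refine ⟨⟨κ, c, V, ε, Ω, hVo, hε, hκt, hκ1, hκ2, hm, hfst, hη, hΩω, hreeb, ?_, ?_, ?_⟩, ?_, ?_,
      rfl⟩
  · exact contDiffOn_slice hVo hWs h0ε
  · exact fun y hy => extDeriv_slice (hWs.contDiffAt ((hVo.prod isOpen_Ioo).mem_nhds ⟨hy, h0ε⟩))
      (hWc _ ⟨hy, h0ε⟩)
  -- A kernel vector a of the slice form lifts to a tangent vector with coordinates (a, 0), killed
  -- by both η and ω, hence zero as η ∧ ω^n ≠ 0.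
  · intro y hy a ha
    obtain ⟨hq, hqb⟩ := hsrc (y, 0) ⟨hy, h0ε⟩
    obtain ⟨w, hw⟩ := hκd.mfderiv_surjective hq ((a, 0) : EuclideanSpace ℝ (Fin (2 * n)) × ℝ)
    have h1 : w = 0 := by
      refine tangent_eq_zero (S := S) ?_ fun u => ?_
      · rw [hη _ hq, hw]
      · rw [hΩω _ hq, hw, hqb]
        exact ha _
    rw [h1, map_zero] at hw
    exact (congrArg Prod.fst hw).symm
  · change p ∈ (e.trans l).source
    simp only [OpenPartialHomeomorph.trans_source]
    exact ⟨mem_chart_source _ p, hxl⟩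
  · change (l (e p)).2 = 0
    rw [hcoe]
    exact hl₀0

end Box

open Set Filter Topology

/-! ### The Reeb flow in flow boxes and its group law. -/

section Flow

variable {n : ℕ} {M : Type*} [TopologicalSpace M] [ChartedSpace (EuclideanSpace ℝ (Fin (2 * n +
    1))) M]
  {B : Type*} [TopologicalSpace B]
  {S : CosymplecticStructure n M} {π : M → B}

namespace FlowBox

variable (b : FlowBox S π)

theorem mdifferentiable : b.κ.MDifferentiable (𝓡 (2 * n + 1)) 𝓘(ℝ,
    EuclideanSpace ℝ (Fin (2 * n)) × ℝ) :=
  mdifferentiable_of_contMDiffOn b.smooth b.smooth_symm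

theorem mem_target {a : EuclideanSpace ℝ (Fin (2 * n)) × ℝ} : a ∈ b.κ.target ↔ a.1 ∈ b.V ∧ a.2 ∈
    Ioo (-b.ε) b.ε := by
  rw [b.target_eq]; rfl

theorem map_mem {q : M} (hq : q ∈ b.κ.source) :
    (b.κ q).1 ∈ b.V ∧ (b.κ q).2 ∈ Ioo (-b.ε) b.ε :=
  b.mem_target.1 (b.κ.map_source hq)

/-- An integral curve of the Reeb field is a vertical line in a flow box. -/
theorem hasDerivAt_curve {γ : ℝ → M} {t : ℝ} (ht : γ t ∈ b.κ.source)
    (hγ : HasMFDerivAt 𝓘(ℝ, ℝ) (𝓡 (2 * n + 1)) γ t ((1 : ℝ →L[ℝ] ℝ).smulRight (S.reeb (γ t)))) :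
    HasDerivAt (fun s => b.κ (γ s)) ((0 : EuclideanSpace ℝ (Fin (2 * n))), (1 : ℝ)) t := by
  have h1 : HasMFDerivAt 𝓘(ℝ, ℝ) 𝓘(ℝ, EuclideanSpace ℝ (Fin (2 * n)) × ℝ) (b.κ ∘ γ) t _ :=
    (b.mdifferentiable.mdifferentiableAt ht).hasMFDerivAt.comp t hγ
  have h2 : HasFDerivAt (fun s => b.κ (γ s)) (_ : ℝ →L[ℝ] EuclideanSpace ℝ (Fin (2 * n)) × ℝ) t :=
      h1.hasFDerivAt
  refine h2.hasDerivAt.congr_deriv ?_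
  change mfderiv (𝓡 (2 * n + 1)) 𝓘(ℝ, EuclideanSpace ℝ (Fin (2 * n)) × ℝ) b.κ (γ t) ((1 : ℝ) •
      S.reeb (γ t)) = _
  rw [one_smul]
  exact b.reeb_eq _ ht

/-- A vertical line in a flow box is an integral curve of the Reeb field. -/
theorem hasMFDerivAt_line {y : EuclideanSpace ℝ (Fin (2 * n))} {t z : ℝ} (hy : y ∈ b.V) (ht : z + t
    ∈ Ioo (-b.ε) b.ε) :
    HasMFDerivAt 𝓘(ℝ, ℝ) (𝓡 (2 * n + 1)) (fun s => b.κ.symm (y, z + s)) t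
      ((1 : ℝ →L[ℝ] ℝ).smulRight (S.reeb (b.κ.symm (y, z + t)))) := by
  have hbt : (y, z + t) ∈ b.κ.target := b.mem_target.2 ⟨hy, ht⟩
  have h1 : HasDerivAt (fun s : ℝ => (y, z + s)) ((0 : EuclideanSpace ℝ (Fin (2 * n))),
      (1 : ℝ)) t :=
    (hasDerivAt_const t y).prodMk ((hasDerivAt_id t).const_add z)
  have h2 : HasMFDerivAt 𝓘(ℝ, ℝ) (𝓡 (2 * n + 1)) (b.κ.symm ∘ fun s : ℝ => (y, z + s)) t _ :=
    (b.mdifferentiable.mdifferentiableAt_symm hbt).hasMFDerivAt.comp t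
      h1.hasFDerivAt.hasMFDerivAt
  refine h2.congr_mfderiv ?_
  refine ContinuousLinearMap.ext_ring ?_
  have hs : b.κ.symm (y, z + t) ∈ b.κ.source := b.κ.map_target hbt
  have h3 := b.mdifferentiable.symm_comp_deriv hs
  have h4 := congrArg (fun T : EuclideanSpace ℝ (Fin (2 * n + 1)) →L[ℝ] EuclideanSpace ℝ (Fin (2 *
      n + 1)) => T (S.reeb (b.κ.symm (y, z + t)))) h3
  have h5 : mfderiv 𝓘(ℝ, EuclideanSpace ℝ (Fin (2 * n)) × ℝ) (𝓡 (2 * n + 1)) b.κ.symm (b.κ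
      (b.κ.symm (y, z + t)))
      (mfderiv (𝓡 (2 * n + 1)) 𝓘(ℝ, EuclideanSpace ℝ (Fin (2 * n)) × ℝ) b.κ (b.κ.symm (y,
          z + t)) (S.reeb (b.κ.symm (y, z + t)))) =
      S.reeb (b.κ.symm (y, z + t)) := h4
  have h6 := b.reeb_eq _ hs
  have h7 : mfderiv 𝓘(ℝ, EuclideanSpace ℝ (Fin (2 * n)) × ℝ) (𝓡 (2 * n + 1)) b.κ.symm (y,
      z + t) ((0 : EuclideanSpace ℝ (Fin (2 * n))), (1 : ℝ)) =
      S.reeb (b.κ.symm (y, z + t)) := by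
    refine Eq.trans ?_ h5
    rw [b.κ.right_inv hbt]
    exact congrArg _ h6.symm
  change mfderiv 𝓘(ℝ, EuclideanSpace ℝ (Fin (2 * n)) × ℝ) (𝓡 (2 * n + 1)) b.κ.symm (y,
      z + t) ((1 : ℝ) • ((0 : EuclideanSpace ℝ (Fin (2 * n))), (1 : ℝ))) =
    (1 : ℝ) • S.reeb (b.κ.symm (y, z + t))
  rw [one_smul, one_smul]
  exact h7

end FlowBox

variable [ChartedSpace (EuclideanSpace ℝ (Fin (2 * n))) B] [IsManifold (𝓡 (2 * n + 1)) (⊤ : ℕ∞) M]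
    [IsManifold (𝓡 (2 * n)) (⊤ : ℕ∞) B] [T2Space M]

namespace IsOrbitProjection

/-- Two integral curves of the Reeb field that agree at one time agree. -/
theorem eqOn_curves (h : IsOrbitProjection S π) {γ₁ γ₂ : ℝ → M} {J : Set ℝ} (hJ : IsOpen J)
    (hJc : IsPreconnected J)
    (h1 : ∀ t ∈ J, HasMFDerivAt 𝓘(ℝ, ℝ) (𝓡 (2 * n + 1)) γ₁ t ((1 : ℝ →L[ℝ] ℝ).smulRight (S.reeb (γ₁
        t))))
    (h2 : ∀ t ∈ J, HasMFDerivAt 𝓘(ℝ, ℝ) (𝓡 (2 * n + 1)) γ₂ t ((1 : ℝ →L[ℝ] ℝ).smulRight (S.reeb (γ₂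
        t))))
    {t₀ : ℝ} (ht₀ : t₀ ∈ J) (h0 : γ₁ t₀ = γ₂ t₀) : EqOn γ₁ γ₂ J := by
  -- In a flow box both curves have velocity (0, 1), so their difference is locally constant.
  -- Closedness in J comes from M being Hausdorff.
  have hopen : IsOpen {t | t ∈ J ∧ γ₁ t = γ₂ t} := by
    rw [Metric.isOpen_iff]
    rintro t ⟨htJ, ht⟩
    obtain ⟨b, hb, -, -⟩ := h.exists_flowBox (γ₁ t)
    have e1 : ∀ᶠ s in 𝓝 t, s ∈ J ∧ γ₁ s ∈ b.κ.source ∧ γ₂ s ∈ b.κ.source := by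
      filter_upwards [hJ.mem_nhds htJ,
        (h1 t htJ).continuousAt.preimage_mem_nhds (b.κ.open_source.mem_nhds hb),
        (h2 t htJ).continuousAt.preimage_mem_nhds
          (b.κ.open_source.mem_nhds (ht ▸ hb))] with s a1 a2 a3 using ⟨a1, a2, a3⟩
    obtain ⟨δ, hδ, hball⟩ := Metric.eventually_nhds_iff_ball.1 e1
    refine ⟨δ, hδ, fun s hs => ⟨(hball s hs).1, ?_⟩⟩
    have hd : ∀ r ∈ Metric.ball t δ,
        HasDerivAt (fun r => b.κ (γ₁ r) - b.κ (γ₂ r)) 0 r := by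
      intro r hr
      obtain ⟨a1, a2, a3⟩ := hball r hr
      have hr' := (b.hasDerivAt_curve a2 (h1 r a1)).sub (b.hasDerivAt_curve a3 (h2 r a1))
      rw [sub_self] at hr'
      exact hr'
    have hc := Metric.isOpen_ball.is_const_of_deriv_eq_zero
      (convex_ball t δ).isPreconnected
      (fun r hr => (hd r hr).differentiableAt.differentiableWithinAt)
      (fun r hr => (hd r hr).deriv) hs (Metric.mem_ball_self hδ)
    simp only [ht, sub_self] at hc
    exact b.κ.injOn (hball s hs).2.1 (hball s hs).2.2 (sub_eq_zero.1 hc)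
  have hsub := hJc.subset_of_closure_inter_subset hopen ⟨t₀, ht₀, ht₀, h0⟩ (by
    rintro t ⟨ht, htJ⟩
    refine ⟨htJ, ?_⟩
    exact tendsto_nhds_unique_of_frequently_eq (h1 t htJ).continuousAt (h2 t htJ).continuousAt
      ((mem_closure_iff_frequently.1 ht).mono fun s hs => hs.2))
  exact fun t ht => (hsub ht).2

/-- `reebFlow` chooses an integral curve separately for each starting point; uniqueness makes these
choices coherent, and the group law follows. -/
theorem flow_eq_curve (h : IsOrbitProjection S π) {γ : ℝ → M} 
    (h1 : IsMIntegralCurve (I := (𝓡 (2 * n + 1))) γ S.reeb) (t : ℝ) : γ t = S.reebFlow t (γ 0) :=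
  h.eqOn_curves isOpen_univ isPreconnected_univ (t₀ := 0) (fun t _ => h1 t)
    (fun t _ => S.isMIntegralCurve_reebFlow h.complete (γ 0) t) (mem_univ _)
    (S.reebFlow_zero _).symm (mem_univ t)

theorem flow_add (h : IsOrbitProjection S π) (s t : ℝ) (x : M) :
    S.reebFlow (s + t) x = S.reebFlow s (S.reebFlow t x) := by
  have h1 := h.flow_eq_curve ((S.isMIntegralCurve_reebFlow h.complete x).comp_add t) s
  simpa using h1

theorem flow_neg_flow (h : IsOrbitProjection S π) (t : ℝ) (x : M) :
    S.reebFlow (-t) (S.reebFlow t x) = x := by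
  rw [← h.flow_add, neg_add_cancel, S.reebFlow_zero]

theorem flow_flow_neg (h : IsOrbitProjection S π) (t : ℝ) (x : M) :
    S.reebFlow t (S.reebFlow (-t) x) = x := by
  rw [← h.flow_add, add_neg_cancel, S.reebFlow_zero]

/-- The Reeb flow in a flow box. -/
theorem flow_box (h : IsOrbitProjection S π) (b : FlowBox S π) {y : EuclideanSpace ℝ (Fin (2 * n))}
    {z t : ℝ}
    (hy : y ∈ b.V) (hz : z ∈ Ioo (-b.ε) b.ε) (ht : z + t ∈ Ioo (-b.ε) b.ε) :
    S.reebFlow t (b.κ.symm (y, z)) = b.κ.symm (y, z + t) := by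
  have hmem (s : ℝ) : s ∈ Ioo (-b.ε - z) (b.ε - z) ↔ z + s ∈ Ioo (-b.ε) b.ε := by
    simp only [mem_Ioo]
    constructor <;> rintro ⟨h1, h2⟩ <;> constructor <;> linarith
  exact h.eqOn_curves (γ₁ := fun t => S.reebFlow t (b.κ.symm (y, z)))
    (γ₂ := fun t => b.κ.symm (y, z + t)) isOpen_Ioo isPreconnected_Ioo (t₀ := 0)
    (fun t _ => S.isMIntegralCurve_reebFlow h.complete _ t)
    (fun s hs => b.hasMFDerivAt_line hy ((hmem s).1 hs)) ((hmem 0).2 (by simpa using hz))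
    (by simp [S.reebFlow_zero]) ((hmem t).2 ht)

end IsOrbitProjection

end Flow

open Set Filter Topology

/-! ### Cosymplectic maps at a point. -/

section Local

variable {n : ℕ} {M : Type*} [TopologicalSpace M] [ChartedSpace (EuclideanSpace ℝ (Fin (2 * n +
    1))) M]
  {B : Type*} [TopologicalSpace B]
  {S : CosymplecticStructure n M} {π : M → B}

/-- The map `F` is smooth at `q` and preserves `η` and `ω` there. -/
structure CosympAt (S : CosymplecticStructure n M) (F : M → M) (q : M) : Prop where
  smooth : ContMDiffAt (𝓡 (2 * n + 1)) (𝓡 (2 * n + 1)) (⊤ : ℕ∞) F q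
  η_eq : ∀ v : TangentSpace (𝓡 (2 * n + 1)) q,
    S.η (F q) ![(mfderiv (𝓡 (2 * n + 1)) (𝓡 (2 * n + 1)) F q v : TangentSpace (𝓡 (2 * n + 1)) (F
        q))] = S.η q ![v]
  ω_eq : ∀ u v : TangentSpace (𝓡 (2 * n + 1)) q,
    S.ω (F q) ![(mfderiv (𝓡 (2 * n + 1)) (𝓡 (2 * n + 1)) F q u : TangentSpace (𝓡 (2 * n + 1)) (F
        q)),
      (mfderiv (𝓡 (2 * n + 1)) (𝓡 (2 * n + 1)) F q v : TangentSpace (𝓡 (2 * n + 1)) (F q))] = S.ω q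
          ![u, v]

theorem CosympAt.mdifferentiableAt {F : M → M} {q : M} (hF : CosympAt S F q) :
    MDifferentiableAt (𝓡 (2 * n + 1)) (𝓡 (2 * n + 1)) F q :=
  hF.smooth.mdifferentiableAt (by simp)

theorem CosympAt.comp {F G : M → M} {q : M} (hF : CosympAt S F (G q)) (hG : CosympAt S G q) :
    CosympAt S (F ∘ G) q := by
  refine ⟨hF.smooth.comp q hG.smooth, fun v => ?_, fun u v => ?_⟩
  · rw [mfderiv_comp q hF.mdifferentiableAt hG.mdifferentiableAt]
    exact (hF.η_eq _).trans (hG.η_eq v)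
  · rw [mfderiv_comp q hF.mdifferentiableAt hG.mdifferentiableAt]
    exact (hF.ω_eq _ _).trans (hG.ω_eq u v)

theorem CosympAt.congr {F G : M → M} {q : M} (hF : CosympAt S F q) (h : G =ᶠ[𝓝 q] F) :
    CosympAt S G q := by
  refine ⟨hF.smooth.congr_of_eventuallyEq h, fun v => ?_, fun u v => ?_⟩
  · rw [h.mfderiv_eq, h.eq_of_nhds]
    exact hF.η_eq v
  · rw [h.mfderiv_eq, h.eq_of_nhds]
    exact hF.ω_eq u v

theorem cosympAt_id (q : M) : CosympAt S id q := by
  refine ⟨contMDiffAt_id, fun v => ?_, fun u v => ?_⟩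
  · rw [mfderiv_id]; rfl
  · rw [mfderiv_id]; rfl

/-- Membership becomes a pointwise condition that depends only on germs, so it can be checked for
maps assembled from local pieces. -/
theorem mem_cosymp_iff [IsManifold (𝓡 (2 * n + 1)) (⊤ : ℕ∞) M] {φ : Equiv.Perm M} :
    φ ∈ S.cosymp ↔ (∀ q, CosympAt S φ q) ∧ ∀ q, CosympAt S φ.symm q := by
  have key : ∀ φ : Equiv.Perm M, φ ∈ S.cosymp → ∀ q, CosympAt S φ q := by
    rintro φ ⟨h1, -, h3, h4⟩ q
    refine ⟨h1 q, fun v => ?_, fun u v => ?_⟩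
    · refine Eq.trans ?_ (congrArg (fun T => T ![v]) (congrFun h3 q))
      change _ = S.η (φ q) (mfderiv (𝓡 (2 * n + 1)) (𝓡 (2 * n + 1)) φ q ∘ ![v])
      congr 1
      funext i; fin_cases i; rfl
    · refine Eq.trans ?_ (congrArg (fun T => T ![u, v]) (congrFun h4 q))
      change _ = S.ω (φ q) (mfderiv (𝓡 (2 * n + 1)) (𝓡 (2 * n + 1)) φ q ∘ ![u, v])
      congr 1
      funext i; fin_cases i <;> rfl
  refine ⟨fun h => ⟨key φ h, key φ.symm (S.cosymp.inv_mem h)⟩, fun ⟨h1, h2⟩ =>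
    ⟨fun q => (h1 q).smooth, fun q => (h2 q).smooth, ?_, ?_⟩⟩
  · funext q
    ext v
    obtain ⟨a, rfl⟩ : ∃ a, v = ![a] := ⟨v 0, by funext i; fin_cases i; rfl⟩
    refine Eq.trans ?_ ((h1 q).η_eq a)
    change S.η (φ q) (mfderiv (𝓡 (2 * n + 1)) (𝓡 (2 * n + 1)) φ q ∘ ![a]) = _
    congr 1
    funext i; fin_cases i; rfl
  · funext q
    ext v
    obtain ⟨a, b, rfl⟩ : ∃ a b, v = ![a, b] :=
      ⟨v 0, v 1, by funext i; fin_cases i <;> rfl⟩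
    refine Eq.trans ?_ ((h1 q).ω_eq a b)
    change S.ω (φ q) (mfderiv (𝓡 (2 * n + 1)) (𝓡 (2 * n + 1)) φ q ∘ ![a, b]) = _
    congr 1
    funext i; fin_cases i <;> rfl

/-- In a flow box, the product of a symplectic map and a translation is cosymplectic. -/
theorem FlowBox.cosympAt (b : FlowBox S π) {q : M} (hq : q ∈ b.κ.source) {θ : EuclideanSpace ℝ (Fin
    (2 * n)) → EuclideanSpace ℝ (Fin (2 * n))}
    {s : ℝ} (hθ : ContDiffAt ℝ (⊤ : ℕ∞) θ (b.κ q).1)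
    (hθΩ : ∀ u v, b.Ω (θ (b.κ q).1) ![fderiv ℝ θ (b.κ q).1 u, fderiv ℝ θ (b.κ q).1 v] =
      b.Ω (b.κ q).1 ![u, v])
    (ht : (θ (b.κ q).1, (b.κ q).2 + s) ∈ b.κ.target) :
    CosympAt S (fun q => b.κ.symm (θ (b.κ q).1, (b.κ q).2 + s)) q := by
  set F : M → M := fun q => b.κ.symm (θ (b.κ q).1, (b.κ q).2 + s) with hF
  let Θ : EuclideanSpace ℝ (Fin (2 * n)) × ℝ → EuclideanSpace ℝ (Fin (2 * n)) × ℝ := fun a => (θ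
      a.1, a.2 + s)
  have hκ : ContMDiffAt (𝓡 (2 * n + 1)) 𝓘(ℝ, EuclideanSpace ℝ (Fin (2 * n)) × ℝ) (⊤ : ℕ∞) b.κ q :=
    b.smooth.contMDiffAt (b.κ.open_source.mem_nhds hq)
  have hΘ : ContDiffAt ℝ (⊤ : ℕ∞) Θ (b.κ q) :=
    (hθ.comp (b.κ q) contDiffAt_fst).prodMk (contDiffAt_snd.add contDiffAt_const)
  have hΘd : HasFDerivAt Θ (((fderiv ℝ θ (b.κ q).1).comp (ContinuousLinearMap.fst ℝ (EuclideanSpace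
      ℝ (Fin (2 * n))) ℝ)).prod
      (ContinuousLinearMap.snd ℝ (EuclideanSpace ℝ (Fin (2 * n))) ℝ)) (b.κ q) :=
    ((hθ.differentiableAt (by simp)).hasFDerivAt.comp (b.κ q) hasFDerivAt_fst).prodMk
      (hasFDerivAt_snd.add_const s)
  have hs : ContMDiffAt 𝓘(ℝ, EuclideanSpace ℝ (Fin (2 * n)) × ℝ) (𝓡 (2 * n + 1)) (⊤ : ℕ∞) b.κ.symm
      (Θ (b.κ q)) :=
    b.smooth_symm.contMDiffAt (b.κ.open_target.mem_nhds ht)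
  have hFs : ContMDiffAt (𝓡 (2 * n + 1)) (𝓡 (2 * n + 1)) (⊤ : ℕ∞) F q :=
    ContMDiffAt.comp q (g := b.κ.symm) hs (hΘ.contMDiffAt.comp q hκ)
  have hFq : F q ∈ b.κ.source := b.κ.map_target ht
  have hκF : b.κ (F q) = Θ (b.κ q) := b.κ.right_inv ht
  have hd : ∀ v : TangentSpace (𝓡 (2 * n + 1)) q,
      (mfderiv (𝓡 (2 * n + 1)) 𝓘(ℝ, EuclideanSpace ℝ (Fin (2 * n)) × ℝ) b.κ (F q) (mfderiv (𝓡 (2 *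
          n + 1)) (𝓡 (2 * n + 1)) F q v) : EuclideanSpace ℝ (Fin (2 * n)) × ℝ) =
      (fderiv ℝ θ (b.κ q).1 (mfderiv (𝓡 (2 * n + 1)) 𝓘(ℝ, EuclideanSpace ℝ (Fin (2 * n)) × ℝ) b.κ q
          v : EuclideanSpace ℝ (Fin (2 * n)) × ℝ).1,
        (mfderiv (𝓡 (2 * n + 1)) 𝓘(ℝ, EuclideanSpace ℝ (Fin (2 * n)) × ℝ) b.κ q v : EuclideanSpace
            ℝ (Fin (2 * n)) × ℝ).2) := by
    intro v
    have h1 : HasMFDerivAt (𝓡 (2 * n + 1)) 𝓘(ℝ, EuclideanSpace ℝ (Fin (2 * n)) × ℝ) (b.κ ∘ F) q _ :=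
      (b.mdifferentiable.mdifferentiableAt hFq).hasMFDerivAt.comp q
        (hFs.mdifferentiableAt (by simp)).hasMFDerivAt
    have h2 : HasMFDerivAt (𝓡 (2 * n + 1)) 𝓘(ℝ, EuclideanSpace ℝ (Fin (2 * n)) × ℝ) (Θ ∘ b.κ) q _ :=
      hΘd.hasMFDerivAt.comp q (b.mdifferentiable.mdifferentiableAt hq).hasMFDerivAt
    have h3 : (b.κ ∘ F) =ᶠ[𝓝 q] (Θ ∘ b.κ) := by
      have h4 : ContinuousAt (Θ ∘ b.κ) q := h2.continuousAt
      filter_upwards [h4.preimage_mem_nhds (b.κ.open_target.mem_nhds ht)] with r hr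
      exact b.κ.right_inv hr
    exact congrArg (fun T : EuclideanSpace ℝ (Fin (2 * n + 1)) →L[ℝ] EuclideanSpace ℝ (Fin (2 * n))
        × ℝ => T v)
      (hasMFDerivAt_unique h1 (h2.congr_of_eventuallyEq h3))
  refine ⟨hFs, fun v => ?_, fun u v => ?_⟩
  · rw [b.η_eq _ hFq, b.η_eq _ hq, hd]
  · rw [b.ω_eq _ hFq, b.ω_eq _ hq, hd, hd, hκF]
    exact hθΩ _ _

/-- A cosymplectic diffeomorphism preserves the Reeb field. -/
theorem mfderiv_reeb_of_mem_cosymp [IsManifold (𝓡 (2 * n + 1)) (⊤ : ℕ∞) M] {φ : Equiv.Perm M} (hφ :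
    φ ∈ S.cosymp) (x : M) :
    mfderiv (𝓡 (2 * n + 1)) (𝓡 (2 * n + 1)) φ x (S.reeb x) = S.reeb (φ x) := by
  obtain ⟨h1, h2⟩ := mem_cosymp_iff.1 hφ
  -- The condition ω(dφ ξ, u) = 0 must be tested on every u, and invariance of ω only covers vectors
  -- u in the image of dφ.
  have hsurj : ∀ u : TangentSpace (𝓡 (2 * n + 1)) (φ x), ∃ v : TangentSpace (𝓡 (2 * n + 1)) x,
      mfderiv (𝓡 (2 * n + 1)) (𝓡 (2 * n + 1)) φ x v = u := by
    intro u
    have h3 : HasMFDerivAt (𝓡 (2 * n + 1)) (𝓡 (2 * n + 1)) (φ ∘ φ.symm) (φ x) _ :=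
      (h1 (φ.symm (φ x))).mdifferentiableAt.hasMFDerivAt.comp (φ x)
        (h2 (φ x)).mdifferentiableAt.hasMFDerivAt
    rw [φ.self_comp_symm] at h3
    have h4 := congrArg (fun T : EuclideanSpace ℝ (Fin (2 * n + 1)) →L[ℝ] EuclideanSpace ℝ (Fin (2
        * n + 1)) => T u)
      (hasMFDerivAt_unique (hasMFDerivAt_id (φ x)) h3)
    have h5 : mfderiv (𝓡 (2 * n + 1)) (𝓡 (2 * n + 1)) φ (φ.symm (φ x)) (mfderiv (𝓡 (2 * n + 1)) (𝓡
        (2 * n + 1)) φ.symm (φ x) u) = u := h4.symm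
    rw [φ.symm_apply_apply] at h5
    exact ⟨_, h5⟩
  refine (S.existsUnique_reeb (φ x)).unique ⟨?_, fun u => ?_⟩ ⟨S.η_reeb _, S.ω_reeb _⟩
  · exact ((h1 x).η_eq _).trans (S.η_reeb x)
  · obtain ⟨v, rfl⟩ := hsurj u
    exact ((h1 x).ω_eq _ _).trans (S.ω_reeb x v)

end Local

/-! ### The flow is central, and rigidity of orbit-preserving maps. -/

section Global

variable {n : ℕ} {M : Type*} [TopologicalSpace M] [ChartedSpace (EuclideanSpace ℝ (Fin (2 * n +
    1))) M]
  [IsManifold (𝓡 (2 * n + 1)) (⊤ : ℕ∞) M] [T2Space M]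
  {B : Type*} [TopologicalSpace B] [ChartedSpace (EuclideanSpace ℝ (Fin (2 * n))) B] [IsManifold (𝓡
      (2 * n)) (⊤ : ℕ∞) B]
  {S : CosymplecticStructure n M} {π : M → B}

namespace IsOrbitProjection

/-- While the orbit stays in the box, ψ_t is the translation z ↦ z + t, the case θ = id of
`FlowBox.cosympAt`. -/
theorem cosympAt_flow_box (h : IsOrbitProjection S π) (b : FlowBox S π) {q : M} {t : ℝ}
    (hq : q ∈ b.κ.source) (ht : (b.κ q).2 + t ∈ Ioo (-b.ε) b.ε) :
    CosympAt S (S.reebFlow t) q := by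
  have h1 := b.cosympAt hq (θ := id) (s := t) contDiffAt_id (by simp)
    (b.mem_target.2 ⟨(b.map_mem hq).1, ht⟩)
  refine h1.congr ?_
  have hc : ContinuousAt (fun r => (b.κ r).2 + t) q :=
    ((b.κ.continuousAt hq).snd).add_const t
  filter_upwards [b.κ.open_source.mem_nhds hq,
    hc.preimage_mem_nhds (isOpen_Ioo.mem_nhds ht)] with r hr hrt
  have h2 := h.flow_box b (b.map_mem hr).1 (b.map_mem hr).2 hrt
  rw [Prod.mk.eta, b.κ.left_inv hr] at h2
  exact h2

/-- For t near t₀, ψ_t and ψ_{t₀} differ by a short flow inside one box around ψ_{t₀}(x). The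
property is thus locally constant in t, and it holds at t = 0. -/
theorem cosympAt_flow (h : IsOrbitProjection S π) (t : ℝ) (x : M) :
    CosympAt S (S.reebFlow t) x := by
  have hloc : IsLocallyConstant fun t : ℝ => CosympAt S (S.reebFlow t) x := by
    rw [IsLocallyConstant.iff_eventually_eq]
    intro t₀
    obtain ⟨b, hb, hb0, -⟩ := h.exists_flowBox (S.reebFlow t₀ x)
    have hγ : Continuous fun t => S.reebFlow t x := continuous_iff_continuousAt.2 fun t =>
      (S.isMIntegralCurve_reebFlow h.complete x t).continuousAt
    have hz : ContinuousAt (fun t => (b.κ (S.reebFlow t x)).2) t₀ :=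
      ((b.κ.continuousAt hb).comp (f := fun t => S.reebFlow t x) hγ.continuousAt).snd
    have e1 : ∀ᶠ t in 𝓝 t₀, S.reebFlow t x ∈ b.κ.source ∧
        (b.κ (S.reebFlow t x)).2 + (t₀ - t) ∈ Ioo (-b.ε) b.ε ∧
        t - t₀ ∈ Ioo (-b.ε) b.ε := by
      have c1 : ContinuousAt (fun t => (b.κ (S.reebFlow t x)).2 + (t₀ - t)) t₀ :=
        hz.add (continuousAt_const.sub continuousAt_id)
      have c2 : ContinuousAt (fun t => t - t₀) t₀ := continuousAt_id.sub continuousAt_const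
      have h0 : (0 : ℝ) ∈ Ioo (-b.ε) b.ε := ⟨by linarith [b.ε_pos], b.ε_pos⟩
      filter_upwards [hγ.continuousAt.preimage_mem_nhds (b.κ.open_source.mem_nhds hb),
        c1.preimage_mem_nhds (isOpen_Ioo.mem_nhds (by rwa [hb0, sub_self,
            add_zero]) : Ioo (-b.ε) b.ε ∈ _),
        c2.preimage_mem_nhds (isOpen_Ioo.mem_nhds (by rwa [sub_self]) : Ioo (-b.ε) b.ε ∈ _)] with t
            a1 a2 a3
      exact ⟨a1, a2, a3⟩
    filter_upwards [e1] with t ⟨a1, a2, a3⟩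
    have hs (s t : ℝ) : S.reebFlow s = S.reebFlow (s - t) ∘ S.reebFlow t := by
      funext y
      rw [Function.comp_apply, ← h.flow_add, sub_add_cancel]
    refine propext ⟨fun hA => ?_, fun hA => ?_⟩
    · rw [hs t₀ t]
      exact (h.cosympAt_flow_box b a1 a2).comp hA
    · rw [hs t t₀]
      exact (h.cosympAt_flow_box b hb (by simpa [hb0] using a3)).comp hA
  have h0 : CosympAt S (S.reebFlow 0) x := by
    rw [show S.reebFlow 0 = id from funext fun y => S.reebFlow_zero y]
    exact cosympAt_id x
  rw [← hloc.apply_eq_of_preconnectedSpace 0 t]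
  exact h0

/-- The Reeb flow as a permutation. -/
noncomputable def flowPerm (h : IsOrbitProjection S π) (t : ℝ) : Equiv.Perm M where
  toFun := S.reebFlow t
  invFun := S.reebFlow (-t)
  left_inv := h.flow_neg_flow t
  right_inv := h.flow_flow_neg t

theorem flowPerm_mem (h : IsOrbitProjection S π) (t : ℝ) : h.flowPerm t ∈ S.cosymp :=
  mem_cosymp_iff.2 ⟨h.cosympAt_flow t, h.cosympAt_flow (-t)⟩

/-- A map with dφ(ξ) = ξ carries integral curves to integral curves, and these are unique. -/
theorem commute_flow (h : IsOrbitProjection S π) {φ : Equiv.Perm M} (hφ : φ ∈ S.cosymp) (t : ℝ)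
    (x : M) : φ (S.reebFlow t x) = S.reebFlow t (φ x) := by
  have h1 := (mem_cosymp_iff.1 hφ).1
  have h2 : IsMIntegralCurve (I := (𝓡 (2 * n + 1))) (fun t => φ (S.reebFlow t x)) S.reeb := by
    intro t
    have h3 : HasMFDerivAt 𝓘(ℝ, ℝ) (𝓡 (2 * n + 1)) (φ ∘ fun t => S.reebFlow t x) t _ :=
      (h1 _).mdifferentiableAt.hasMFDerivAt.comp t (S.isMIntegralCurve_reebFlow h.complete x t)
    refine h3.congr_mfderiv ?_
    refine ContinuousLinearMap.ext_ring ?_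
    change mfderiv (𝓡 (2 * n + 1)) (𝓡 (2 * n + 1)) φ (S.reebFlow t x) ((1 : ℝ) • S.reeb (S.reebFlow
        t x)) =
      (1 : ℝ) • S.reeb (φ (S.reebFlow t x))
    rw [one_smul, one_smul, mfderiv_reeb_of_mem_cosymp hφ]
  have h3 := h.flow_eq_curve h2 t
  rwa [S.reebFlow_zero] at h3

/-- A cosymplectic map that preserves every orbit and has a fixed point is the identity. -/
theorem eq_id_of_fixed [ConnectedSpace M] (h : IsOrbitProjection S π) {φ : M → M}
    (hφ : ∀ q, CosympAt S φ q) (hπ : ∀ q, π (φ q) = π q) {w : M} (hw : φ w = w) (q : M) :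
    φ q = q := by
  have hcont : Continuous φ := continuous_iff_continuousAt.2 fun q => (hφ q).smooth.continuousAt
  have hopen : IsOpen {q | φ q = q} := by
    rw [isOpen_iff_mem_nhds]
    intro p hp
    have hp : φ p = p := hp
    obtain ⟨b, hb, -, -⟩ := h.exists_flowBox p
    have hbt := b.κ.map_source hb
    have e1 : ∀ᶠ a in 𝓝 (b.κ p), a ∈ b.κ.target ∧ φ (b.κ.symm a) ∈ b.κ.source := by
      have c1 : ContinuousAt (fun a => φ (b.κ.symm a)) (b.κ p) :=
        hcont.continuousAt.comp (b.κ.symm.continuousAt hbt)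
      filter_upwards [b.κ.open_target.mem_nhds hbt, c1.preimage_mem_nhds
        (b.κ.open_source.mem_nhds (by rwa [b.κ.left_inv hb, hp]))] with a a1 a2 using ⟨a1, a2⟩
    obtain ⟨δ, hδ, hball⟩ := Metric.eventually_nhds_iff_ball.1 e1
    -- The displacement along the orbit. Its differential is φ^*η - η = 0 as η = dz, and it vanishes
    -- at the fixed point p; the base coordinates are unchanged as φ preserves orbits.
    let f : EuclideanSpace ℝ (Fin (2 * n)) × ℝ → ℝ := fun a => (b.κ (φ (b.κ.symm a))).2 - a.2
    have hf : ∀ a ∈ Metric.ball (b.κ p) δ, HasFDerivAt f (0 : EuclideanSpace ℝ (Fin (2 * n)) × ℝ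
        →L[ℝ] ℝ) a := by
      intro a ha
      obtain ⟨a1, a2⟩ := hball a ha
      have hq : b.κ.symm a ∈ b.κ.source := b.κ.map_target a1
      have m1 : HasMFDerivAt 𝓘(ℝ, EuclideanSpace ℝ (Fin (2 * n)) × ℝ) 𝓘(ℝ,
          EuclideanSpace ℝ (Fin (2 * n)) × ℝ) (b.κ ∘ (φ ∘ b.κ.symm)) a _ :=
        (b.mdifferentiable.mdifferentiableAt a2).hasMFDerivAt.comp a
          ((hφ _).mdifferentiableAt.hasMFDerivAt.comp a
            (b.mdifferentiable.mdifferentiableAt_symm a1).hasMFDerivAt)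
      have m2 : HasMFDerivAt 𝓘(ℝ, EuclideanSpace ℝ (Fin (2 * n)) × ℝ) 𝓘(ℝ,
          EuclideanSpace ℝ (Fin (2 * n)) × ℝ) (b.κ ∘ b.κ.symm) a _ :=
        (b.mdifferentiable.mdifferentiableAt hq).hasMFDerivAt.comp a
          (b.mdifferentiable.mdifferentiableAt_symm a1).hasMFDerivAt
      have m3 : (b.κ ∘ b.κ.symm) =ᶠ[𝓝 a] id := by
        filter_upwards [b.κ.open_target.mem_nhds a1] with a' ha' using b.κ.right_inv ha'
      have m4 := hasMFDerivAt_unique m2 ((hasMFDerivAt_id a).congr_of_eventuallyEq m3)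
      let D : EuclideanSpace ℝ (Fin (2 * n)) × ℝ →L[ℝ] EuclideanSpace ℝ (Fin (2 * n)) × ℝ :=
          (mfderiv (𝓡 (2 * n + 1)) 𝓘(ℝ, EuclideanSpace ℝ (Fin (2 * n)) × ℝ) b.κ (φ (b.κ.symm
          a))).comp
        ((mfderiv (𝓡 (2 * n + 1)) (𝓡 (2 * n + 1)) φ (b.κ.symm a)).comp (mfderiv 𝓘(ℝ,
            EuclideanSpace ℝ (Fin (2 * n)) × ℝ) (𝓡 (2 * n + 1)) b.κ.symm a))
      have m5 : HasFDerivAt (fun a => b.κ (φ (b.κ.symm a))) D a := m1.hasFDerivAt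
      refine (m5.snd.sub hasFDerivAt_snd).congr_fderiv ?_
      refine ContinuousLinearMap.ext fun v => ?_
      change (D v).2 - v.2 = 0
      rw [sub_eq_zero]
      refine (b.η_eq _ a2 _).symm.trans (((hφ _).η_eq _).trans ((b.η_eq _ hq _).trans ?_))
      have m6 := congrArg (fun T : EuclideanSpace ℝ (Fin (2 * n)) × ℝ →L[ℝ] EuclideanSpace ℝ (Fin
          (2 * n)) × ℝ => (T v).2) m4
      exact m6
    have hconst : ∀ a ∈ Metric.ball (b.κ p) δ, f a = f (b.κ p) := fun a ha =>
      Metric.isOpen_ball.is_const_of_fderiv_eq_zero (𝕜 := ℝ)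
        (convex_ball (b.κ p) δ).isPreconnected
        (fun r hr => (hf r hr).differentiableAt.differentiableWithinAt)
        (fun r hr => (hf r hr).fderiv) ha (Metric.mem_ball_self hδ)
    filter_upwards [b.κ.open_source.mem_nhds hb,
      (b.κ.continuousAt hb).preimage_mem_nhds (Metric.ball_mem_nhds _ hδ)] with q hq hqb
    have h1 := hconst _ hqb
    have h2 := (hball _ hqb).2
    simp only [f, b.κ.left_inv hq, b.κ.left_inv hb, hp, sub_self, sub_eq_zero] at h1
    rw [b.κ.left_inv hq] at h2
    refine b.κ.injOn h2 hq (Prod.ext ?_ h1)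
    rw [b.fst_eq _ h2, b.fst_eq _ hq, hπ]
  have hclopen : IsClopen {q | φ q = q} := ⟨isClosed_eq hcont continuous_id, hopen⟩
  exact hclopen.eq_univ ⟨w, hw⟩ |>.symm.subset (mem_univ q)

/-- All orbits have the same periods. This replaces the principal bundle structure in what follows.
-/
theorem flow_eq_id_of_fixed [ConnectedSpace M] (h : IsOrbitProjection S π) {t : ℝ} {w : M}
    (hw : S.reebFlow t w = w) (q : M) : S.reebFlow t q = q :=
  h.eq_id_of_fixed (h.cosympAt_flow t) (h.apply_flow t) hw q

end IsOrbitProjection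

end Global

open Set Filter Topology

/-! ### The slice z = 0 as a local section of the orbit projection. -/

section Slice

variable {n : ℕ} {M : Type*} [TopologicalSpace M] [ChartedSpace (EuclideanSpace ℝ (Fin (2 * n +
    1))) M]
  {B : Type*} [TopologicalSpace B] {S : CosymplecticStructure n M} {π : M → B}

theorem FlowBox.slice (b : FlowBox S π) {y : EuclideanSpace ℝ (Fin (2 * n))} (hy : y ∈ b.V) :
    b.κ.symm (y, 0) ∈ b.κ.source ∧ b.κ (b.κ.symm (y, 0)) = (y, 0) ∧ y ∈ b.c.target ∧
      π (b.κ.symm (y, 0)) = b.c.symm y := by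
  have ht : (y, (0 : ℝ)) ∈ b.κ.target :=
    b.mem_target.2 ⟨hy, by linarith [b.ε_pos], b.ε_pos⟩
  have hs := b.κ.map_target ht
  have h1 := b.fst_eq _ hs
  rw [b.κ.right_inv ht] at h1
  have h1 : y = b.c (π (b.κ.symm (y, 0))) := h1
  have h2 := b.maps _ hs
  refine ⟨hs, b.κ.right_inv ht, ?_, ?_⟩
  · rw [h1]; exact b.c.map_source h2
  · conv_rhs => rw [h1]
    exact (b.c.left_inv h2).symm

theorem IsOrbitProjection.exists_flow_slice [ChartedSpace (EuclideanSpace ℝ (Fin (2 * n))) B] (h :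
    IsOrbitProjection S π) (b : FlowBox S π) {q : M}
    (hq : π q ∈ b.c.source) (hqV : b.c (π q) ∈ b.V) :
    ∃ t, S.reebFlow t (b.κ.symm (b.c (π q), 0)) = q := by
  rw [← h.fiber, (b.slice hqV).2.2.2, b.c.left_inv hq]

end Slice

/-! ### Lifting symplectic maps of the base. -/

section Lift

variable {n : ℕ} {M : Type*} [TopologicalSpace M] [ChartedSpace (EuclideanSpace ℝ (Fin (2 * n +
    1))) M]
  [IsManifold (𝓡 (2 * n + 1)) (⊤ : ℕ∞) M] [T2Space M]
  {B : Type*} [TopologicalSpace B] [ChartedSpace (EuclideanSpace ℝ (Fin (2 * n))) B] [IsManifold (𝓡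
      (2 * n)) (⊤ : ℕ∞) B]
  {S : CosymplecticStructure n M} {π : M → B}

namespace IsOrbitProjection

/-- A compactly supported symplectic map of the base of a flow box lifts to a cosymplectic map
commuting with the Reeb flow. -/
theorem exists_lift [T2Space B] [ConnectedSpace M] (h : IsOrbitProjection S π) (b : FlowBox S π)
    {V : Set (EuclideanSpace ℝ (Fin (2 * n)))} (hV : IsOpen V) (hVb : V ⊆ b.V) {K : Set
        (EuclideanSpace ℝ (Fin (2 * n)))} (hK : IsCompact K)
    (hKV : K ⊆ V) {θ : EuclideanSpace ℝ (Fin (2 * n)) → EuclideanSpace ℝ (Fin (2 * n))} (hθ :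
        ContDiff ℝ (⊤ : ℕ∞) θ) (hθK : ∀ y ∉ K, θ y = y)
    (hθV : MapsTo θ V V)
    (hθΩ : ∀ y ∈ V, ∀ u v, b.Ω (θ y) ![fderiv ℝ θ y u, fderiv ℝ θ y v] = b.Ω y ![u, v]) :
    ∃ g : M → M, (∀ q, CosympAt S g q) ∧
      (∀ q, ¬ (π q ∈ b.c.source ∧ b.c (π q) ∈ V) → g q = q) ∧
      ∀ y ∈ V, ∀ t, g (S.reebFlow t (b.κ.symm (y, 0))) = S.reebFlow t (b.κ.symm (θ y, 0)) := by
  classical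
  have hex : ∀ q, ∃ t, π q ∈ b.c.source ∧ b.c (π q) ∈ V →
      S.reebFlow t (b.κ.symm (b.c (π q), 0)) = q := by
    intro q
    by_cases hq : π q ∈ b.c.source ∧ b.c (π q) ∈ V
    · obtain ⟨t, ht⟩ := h.exists_flow_slice b hq.1 (hVb hq.2)
      exact ⟨t, fun _ => ht⟩
    · exact ⟨0, fun hq' => absurd hq' hq⟩
  choose τ hτ using hex
  let g : M → M := fun q => if π q ∈ b.c.source ∧ b.c (π q) ∈ V then
    S.reebFlow (τ q) (b.κ.symm (θ (b.c (π q)), 0)) else q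
  have hout : ∀ q, ¬ (π q ∈ b.c.source ∧ b.c (π q) ∈ V) → g q = q := fun q hq => if_neg hq
  have hproj : ∀ y ∈ V, ∀ t, π (S.reebFlow t (b.κ.symm (y, 0))) ∈ b.c.source ∧
      b.c (π (S.reebFlow t (b.κ.symm (y, 0)))) = y := by
    intro y hy t
    obtain ⟨-, -, h3, h4⟩ := b.slice (hVb hy)
    rw [h.apply_flow, h4]
    exact ⟨b.c.map_target h3, b.c.right_inv h3⟩
  have hin : ∀ y ∈ V, ∀ t,
      g (S.reebFlow t (b.κ.symm (y, 0))) = S.reebFlow t (b.κ.symm (θ y, 0)) := by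
    intro y hy t
    obtain ⟨h1, h2⟩ := hproj y hy t
    have hq : π (S.reebFlow t (b.κ.symm (y, 0))) ∈ b.c.source ∧
      b.c (π (S.reebFlow t (b.κ.symm (y, 0)))) ∈ V := ⟨h1, by rwa [h2]⟩
    have h3 := hτ _ hq
    set s := τ (S.reebFlow t (b.κ.symm (y, 0)))
    have hg : g (S.reebFlow t (b.κ.symm (y, 0))) = S.reebFlow s (b.κ.symm (θ y, 0)) := by
      simp only [g, if_pos hq]
      rw [h2]
    rw [h2] at h3
    -- The chosen time s may differ from t, but ψ_{s-t} fixes the slice point over y. It is then the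
    -- identity and also fixes the one over θ y, so the value of g does not depend on the choice.
    have h4 : S.reebFlow (-t + s) (b.κ.symm (y, 0)) = b.κ.symm (y, 0) := by
      rw [h.flow_add, h3, h.flow_neg_flow]
    have h5 := h.flow_eq_id_of_fixed h4 (b.κ.symm (θ y, 0))
    rw [hg]
    conv_rhs => rw [← h5]
    rw [← h.flow_add, add_neg_cancel_left]
  refine ⟨g, fun q₀ => ?_, hout, hin⟩
  by_cases hq₀ : π q₀ ∈ b.c.source ∧ b.c (π q₀) ∈ V
  · set t₀ := τ q₀
    set y₀ := b.c (π q₀) with hy₀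
    have h1 : S.reebFlow t₀ (b.κ.symm (y₀, 0)) = q₀ := hτ q₀ hq₀
    obtain ⟨hs, hκs, -, -⟩ := b.slice (hVb hq₀.2)
    have h2 : S.reebFlow (-t₀) q₀ = b.κ.symm (y₀, 0) := by
      rw [← h1, h.flow_neg_flow]
    -- Near q₀ the lift equals ψ_{t₀} ∘ G ∘ ψ_{-t₀}, with G = θ × id in the box, although τ itself
    -- need not be continuous.
    let G : M → M := fun q => b.κ.symm (θ (b.κ q).1, (b.κ q).2 + 0)
    have hG : CosympAt S G (S.reebFlow (-t₀) q₀) := by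
      rw [h2]
      refine b.cosympAt hs hθ.contDiffAt ?_ ?_
      · rw [hκs]
        exact hθΩ y₀ hq₀.2
      · rw [hκs]
        exact b.mem_target.2 ⟨hVb (hθV hq₀.2), by
          simp only [add_zero]; exact ⟨by linarith [b.ε_pos], b.ε_pos⟩⟩
    have hcomp : CosympAt S (S.reebFlow t₀ ∘ (G ∘ S.reebFlow (-t₀))) q₀ :=
      (h.cosympAt_flow t₀ _).comp (hG.comp (h.cosympAt_flow (-t₀) q₀))
    refine hcomp.congr ?_
    have hcont : ContinuousAt (S.reebFlow (-t₀)) q₀ := (h.cosympAt_flow (-t₀)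
        q₀).smooth.continuousAt
    have hU : IsOpen (b.κ.source ∩ b.κ ⁻¹' (Prod.fst ⁻¹' V)) :=
      b.κ.isOpen_inter_preimage (hV.preimage continuous_fst)
    have hmem : S.reebFlow (-t₀) q₀ ∈ b.κ.source ∩ b.κ ⁻¹' (Prod.fst ⁻¹' V) := by
      rw [h2]
      refine ⟨hs, ?_⟩
      change (b.κ (b.κ.symm (y₀, 0))).1 ∈ V
      rw [hκs]
      exact hq₀.2
    filter_upwards [hcont.preimage_mem_nhds (hU.mem_nhds hmem)] with q ⟨hq1, hq2⟩
    have hq2 : (b.κ (S.reebFlow (-t₀) q)).1 ∈ V := hq2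
    set r := S.reebFlow (-t₀) q
    obtain ⟨hr1, hr2⟩ := b.map_mem hq1
    have h0 : (0 : ℝ) ∈ Ioo (-b.ε) b.ε := ⟨by linarith [b.ε_pos], b.ε_pos⟩
    have hr : S.reebFlow (b.κ r).2 (b.κ.symm ((b.κ r).1, 0)) = r := by
      rw [h.flow_box b hr1 h0 (by simpa using hr2), zero_add, Prod.mk.eta, b.κ.left_inv hq1]
    have hr' : S.reebFlow (b.κ r).2 (b.κ.symm (θ (b.κ r).1, 0)) = G r := by
      rw [h.flow_box b (hVb (hθV hq2)) h0 (by simpa using hr2), zero_add]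
      simp only [G, add_zero]
    have hq : q = S.reebFlow (t₀ + (b.κ r).2) (b.κ.symm ((b.κ r).1, 0)) := by
      rw [h.flow_add, hr, h.flow_flow_neg]
    change g q = S.reebFlow t₀ (G r)
    rw [← hr', ← h.flow_add, ← hin _ hq2, ← hq]
  · refine (cosympAt_id q₀).congr ?_
    -- The image of K in B is compact, hence closed since B is Hausdorff. Over its open complement g
    -- is the identity.
    have hKt : K ⊆ b.c.target := fun y hy => (b.slice (hVb (hKV hy))).2.2.1
    have hC : IsClosed (b.c.symm '' K) :=
      (hK.image_of_continuousOn (b.c.continuousOn_symm.mono hKt)).isClosed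
    have hCo : IsOpen (π ⁻¹' (b.c.symm '' K)ᶜ) := hC.isOpen_compl.preimage h.contMDiff.continuous
    have hq₀C : q₀ ∈ π ⁻¹' (b.c.symm '' K)ᶜ := by
      rintro ⟨y, hy, hyq⟩
      apply hq₀
      rw [← hyq, b.c.right_inv (hKt hy)]
      exact ⟨b.c.map_target (hKt hy), hKV hy⟩
    filter_upwards [hCo.mem_nhds hq₀C] with q hq
    by_cases hqV : π q ∈ b.c.source ∧ b.c (π q) ∈ V
    · have h1 := hin _ hqV.2 (τ q)
      rw [hτ q hqV, hθK, hτ q hqV] at h1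
      · exact h1
      · exact fun hk => hq ⟨_, hk, b.c.left_inv hqV.1⟩
    · exact hout q hqV

/-- There are nontrivial cosymplectic diffeomorphisms supported over any nonempty open set of the
orbit space. -/
theorem exists_bump [T2Space B] [ConnectedSpace M] (hn : n ≠ 0) (h : IsOrbitProjection S π)
    {U : Set B} (hU : IsOpen U) {x : M} (hx : π x ∈ U) :
    ∃ g ∈ S.cosymp, (∀ q, π q ∉ U → g q = q) ∧ ∃ q, g q ≠ q := by
  have : Nonempty (Fin (2 * n)) := ⟨⟨0, by lia⟩⟩
  have : Nontrivial (EuclideanSpace ℝ (Fin (2 * n))) := inferInstance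
  obtain ⟨b, hb, hb0, -⟩ := h.exists_flowBox x
  let V : Set (EuclideanSpace ℝ (Fin (2 * n))) := b.V ∩ (b.c.target ∩ b.c.symm ⁻¹' U)
  have hV : IsOpen V := b.isOpen_V.inter (b.c.isOpen_inter_preimage_symm hU)
  have hVb : V ⊆ b.V := inter_subset_left
  have hVn : V.Nonempty := by
    refine ⟨(b.κ x).1, (b.map_mem hb).1, (b.slice (b.map_mem hb).1).2.2.1, ?_⟩
    change b.c.symm (b.κ x).1 ∈ U
    rw [b.fst_eq x hb, b.c.left_inv (b.maps x hb)]
    exact hx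
  obtain ⟨θ, K, hθ, hθ', hK, hKV, hθK, ⟨y, hy⟩, hθΩ, hθΩ'⟩ :=
    exists_compactly_supported_symplecto hV hVn (b.Ω_smooth.mono hVb)
      (fun y hy => b.Ω_closed y (hVb hy)) (fun y hy => b.Ω_nondeg y (hVb hy))
  -- If σ y ∉ K then σ fixes σ y, and injectivity gives σ y = y.
  have hmaps : ∀ σ : EuclideanSpace ℝ (Fin (2 * n)) ≃ EuclideanSpace ℝ (Fin (2 * n)), (∀ y ∉ K,
      σ y = y) → MapsTo σ V V := by
    intro σ hσ y hy
    by_cases hσy : σ y ∈ K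
    · exact hKV hσy
    · rwa [σ.injective (hσ _ hσy)]
  have hθK' : ∀ y ∉ K, θ.symm y = y := fun y hy => by
    rw [Equiv.symm_apply_eq, hθK y hy]
  obtain ⟨g, hg, hgo, hgi⟩ := h.exists_lift b hV hVb hK hKV hθ hθK (hmaps θ hθK) hθΩ
  obtain ⟨g', hg', hgo', hgi'⟩ := h.exists_lift b hV hVb hK hKV hθ' hθK' (hmaps θ.symm hθK') hθΩ'
  have hrep : ∀ q, π q ∈ b.c.source ∧ b.c (π q) ∈ V →
      ∃ y ∈ V, ∃ t, q = S.reebFlow t (b.κ.symm (y, 0)) := fun q hq => by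
    obtain ⟨t, ht⟩ := h.exists_flow_slice b hq.1 (hVb hq.2)
    exact ⟨_, hq.2, t, ht.symm⟩
  let φ : Equiv.Perm M :=
    { toFun := g
      invFun := g'
      left_inv := fun q => by
        by_cases hq : π q ∈ b.c.source ∧ b.c (π q) ∈ V
        · obtain ⟨y, hy, t, rfl⟩ := hrep q hq
          rw [hgi y hy, hgi' _ (hmaps θ hθK hy), θ.symm_apply_apply]
        · rw [hgo q hq, hgo' q hq]
      right_inv := fun q => by
        by_cases hq : π q ∈ b.c.source ∧ b.c (π q) ∈ V
        · obtain ⟨y, hy, t, rfl⟩ := hrep q hq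
          rw [hgi' y hy, hgi _ (hmaps θ.symm hθK' hy), θ.apply_symm_apply]
        · rw [hgo' q hq, hgo q hq] }
  refine ⟨φ, mem_cosymp_iff.2 ⟨hg, hg'⟩, fun q hq => hgo q ?_, ?_⟩
  · rintro ⟨h1, -, -, h2⟩
    apply hq
    rw [← b.c.left_inv h1]
    exact h2
  · have hyV : y ∈ V := hKV (by by_contra hyK; exact hy (hθK y hyK))
    refine ⟨b.κ.symm (y, 0), fun hfix => hy ?_⟩
    have h1 : g (b.κ.symm (y, 0)) = b.κ.symm (θ y, 0) := by
      simpa [S.reebFlow_zero] using hgi y hyV 0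
    have h2 := congrArg b.κ (h1.symm.trans hfix)
    rw [(b.slice (hVb (hmaps θ hθK hyV))).2.1, (b.slice (hVb hyV)).2.1] at h2
    exact congrArg Prod.fst h2

end IsOrbitProjection

end Lift

/-! ### Central elements and periodicity. -/

section Center

variable {n : ℕ} {M : Type*} [TopologicalSpace M] [ChartedSpace (EuclideanSpace ℝ (Fin (2 * n +
    1))) M]
  [IsManifold (𝓡 (2 * n + 1)) (⊤ : ℕ∞) M] [T2Space M] [ConnectedSpace M]
  {B : Type*} [TopologicalSpace B] [ChartedSpace (EuclideanSpace ℝ (Fin (2 * n))) B] [IsManifold (𝓡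
      (2 * n)) (⊤ : ℕ∞) B]
  {S : CosymplecticStructure n M} {π : M → B}

namespace IsOrbitProjection

/-- A central element of the group of cosymplectomorphisms preserves every orbit. -/
theorem proj_eq_of_central [T2Space B] (h : IsOrbitProjection S π) {φ : Equiv.Perm M} (hφ : φ ∈
    S.cosymp)
    (hcent : ∀ g ∈ S.cosymp, ∀ q, g (φ q) = φ (g q)) (x : M) : π (φ x) = π x := by
  have hφc : Continuous φ := hφ.1.continuous
  have hπc : Continuous π := h.contMDiff.continuous
  rcases eq_or_ne n 0 with rfl | hn
  -- For n = 0 no bumps exist, but B is modelled on a point, hence discrete, and π is constant on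
  -- the connected M.
  · have : DiscreteTopology B := by
      have : Subsingleton (EuclideanSpace ℝ (Fin (2 * 0))) := ⟨fun a b => by
        ext i; exact i.elim0⟩
      refine discreteTopology_iff_isOpen_singleton.2 fun z => ?_
      have h1 : (chartAt (EuclideanSpace ℝ (Fin (2 * 0))) z).source = {z} := by
        refine Subset.antisymm (fun z' hz' => ?_) (singleton_subset_iff.2 (mem_chart_source _ z))
        exact (chartAt _ z).injOn hz' (mem_chart_source _ z) (Subsingleton.elim _ _)
      rw [← h1]
      exact (chartAt _ z).open_source
    exact ((IsLocallyConstant.iff_continuous π).2 hπc).apply_eq_of_preconnectedSpace _ _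
  · by_contra hne
    obtain ⟨U₁, U₂, hU₁, hU₂, hx₁, hx₂, hd⟩ := t2_separation hne
    have hN : IsOpen ((fun q => π (φ q)) ⁻¹' U₁ ∩ π ⁻¹' U₂) :=
      (hU₁.preimage (hπc.comp hφc)).inter (hU₂.preimage hπc)
    obtain ⟨b, hb, hb0, -⟩ := h.exists_flowBox x
    let N : Set (EuclideanSpace ℝ (Fin (2 * n))) := b.V ∩ (fun y => b.κ.symm (y, 0)) ⁻¹'
      ((fun q => π (φ q)) ⁻¹' U₁ ∩ π ⁻¹' U₂)
    have hNo : IsOpen N := by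
      refine ContinuousOn.isOpen_inter_preimage ?_ b.isOpen_V hN
      exact b.κ.continuousOn_symm.comp (by fun_prop) fun y hy =>
        b.mem_target.2 ⟨hy, by linarith [b.ε_pos], b.ε_pos⟩
    -- Base points are tested only on the slice. Since φ commutes with the flow, both conditions
    -- depend only on the orbit, so they hold over all of U.
    let U : Set B := b.c.source ∩ b.c ⁻¹' N
    have hU : IsOpen U := b.c.isOpen_inter_preimage hNo
    have hUprop : ∀ q, π q ∈ U → π (φ q) ∈ U₁ ∧ π q ∈ U₂ := by
      rintro q ⟨hq1, hq2, hq3, hq4⟩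
      obtain ⟨t, ht⟩ := h.exists_flow_slice b hq1 hq2
      have e1 : π q = π (b.κ.symm (b.c (π q), 0)) := by
        conv_lhs => rw [← ht, h.apply_flow]
      have e2 : π (φ q) = π (φ (b.κ.symm (b.c (π q), 0))) := by
        conv_lhs => rw [← ht, h.commute_flow hφ, h.apply_flow]
      exact ⟨e2 ▸ hq3, e1 ▸ hq4⟩
    have hxU : π x ∈ U := by
      have e1 : b.κ.symm (b.c (π x), 0) = x := by
        rw [← b.fst_eq x hb, ← hb0, Prod.mk.eta, b.κ.left_inv hb]
      refine ⟨b.maps x hb, ?_, ?_⟩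
      · rw [← b.fst_eq x hb]
        exact (b.map_mem hb).1
      · change b.κ.symm (b.c (π x), 0) ∈ (fun q => π (φ q)) ⁻¹' U₁ ∩ π ⁻¹' U₂
        rw [e1]
        exact ⟨hx₁, hx₂⟩
    obtain ⟨g, hg, hgU, w, hw⟩ := h.exists_bump hn hU hxU
    have hwU : π w ∈ U := by_contra fun hwU => hw (hgU w hwU)
    -- φ(w) does not lie over U, so g fixes it. Commutation gives φ(g w) = φ(w), whereas g moves w.
    have h1 : g (φ w) = φ w := hgU _ fun hφw =>
      hd.le_bot ⟨(hUprop w hwU).1, (hUprop _ hφw).2⟩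
    rw [hcent g hg] at h1
    exact hw (φ.injective h1)

/-- A nontrivial central cosymplectomorphism of finite order forces the Reeb flow to be
periodic. -/
theorem periodic_of_central [T2Space B] (h : IsOrbitProjection S π) {φ : Equiv.Perm M} (hφ : φ ∈
    S.cosymp)
    (hcent : ∀ g ∈ S.cosymp, ∀ q, g (φ q) = φ (g q)) (h1 : φ ≠ 1) {m : ℕ} (hm : m ≠ 0)
    (hφm : φ ^ m = 1) : S.ReebPeriodic := by
  obtain ⟨w⟩ : Nonempty M := inferInstance
  obtain ⟨t, ht⟩ := (h.fiber w (φ w)).1 (h.proj_eq_of_central hφ hcent w).symm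
  have hflow : ∀ q, φ q = S.reebFlow t q := by
    intro q
    have h2 := h.eq_id_of_fixed (φ := S.reebFlow (-t) ∘ φ) (w := w)
      (fun q => (h.cosympAt_flow (-t) _).comp ((mem_cosymp_iff.1 hφ).1 q))
      (fun q => by rw [Function.comp_apply, h.apply_flow, h.proj_eq_of_central hφ hcent])
      (by rw [Function.comp_apply, ← ht, h.flow_neg_flow]) q
    conv_rhs => rw [← h2, Function.comp_apply, h.flow_flow_neg]
  have ht0 : t ≠ 0 := by
    rintro rfl
    exact h1 (Equiv.ext fun q => by rw [hflow, S.reebFlow_zero]; rfl)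
  have hpow : ∀ k : ℕ, ∀ q, (φ ^ k) q = S.reebFlow (k * t) q := by
    intro k q
    induction k with
    | zero => simp [S.reebFlow_zero]
    | succ k ih =>
      rw [pow_succ', Equiv.Perm.mul_apply, ih, hflow, ← h.flow_add]
      congr 1
      push_cast
      ring
  have hper : ∀ q, S.reebFlow (m * t) q = q := fun q => by rw [← hpow, hφm]; rfl
  have hmt : (m : ℝ) * t ≠ 0 := mul_ne_zero (by exact_mod_cast hm) ht0
  -- The time t may be negative, while a period has to be positive.
  refine ⟨|m * t|, abs_pos.2 hmt, fun q => ?_⟩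
  rcases abs_choice (m * t) with h2 | h2 <;> rw [h2]
  · exact hper q
  · conv_lhs => rw [← hper q]
    exact h.flow_neg_flow _ q

/-- If the Reeb flow is periodic, it contains a nontrivial element of finite order. -/
theorem exists_central_of_periodic (h : IsOrbitProjection S π) (hper : S.ReebPeriodic) :
    ∃ φ ∈ S.cosymp, (∀ g ∈ S.cosymp, ∀ q, g (φ q) = φ (g q)) ∧ φ ≠ 1 ∧
      ∃ m : ℕ, m ≠ 0 ∧ φ ^ m = 1 := by
  obtain ⟨T, hT, hper⟩ := hper
  obtain ⟨x⟩ : Nonempty M := inferInstance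
  obtain ⟨b, hb, hb0, -⟩ := h.exists_flowBox x
  -- This gives T / m < ε, so ψ_{T/m} moves the point x at height 0 to height T / m inside the box,
  -- away from x.
  obtain ⟨m, hm⟩ := exists_nat_gt (T / b.ε)
  have hm0 : (0 : ℝ) < m := lt_trans (div_pos hT b.ε_pos) hm
  have hTm : T / m < b.ε := by
    rw [div_lt_iff₀ hm0]
    rwa [div_lt_iff₀ b.ε_pos, mul_comm] at hm
  have hTm0 : 0 < T / m := div_pos hT hm0
  refine ⟨h.flowPerm (T / m), h.flowPerm_mem _, fun g hg q => h.commute_flow hg _ q, ?_, m,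
    by rintro rfl; simp at hm0, ?_⟩
  · intro h1
    have h2 : S.reebFlow (T / m) x = x := congrArg (fun σ : Equiv.Perm M => σ x) h1
    have h3 := h.flow_box b (z := (b.κ x).2) (t := T / m) (b.map_mem hb).1 (b.map_mem hb).2
      (by rw [hb0, zero_add]; exact ⟨by linarith [b.ε_pos], hTm⟩)
    rw [Prod.mk.eta, b.κ.left_inv hb, h2, hb0, zero_add] at h3
    have hmem : ((b.κ x).1, T / m) ∈ b.κ.target :=
      b.mem_target.2 ⟨(b.map_mem hb).1, by linarith [b.ε_pos], hTm⟩
    have h4 := congrArg b.κ h3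
    rw [b.κ.right_inv hmem] at h4
    have h5 := congrArg Prod.snd h4
    rw [hb0] at h5
    exact hTm0.ne h5
  · have hpow : ∀ k : ℕ, ∀ q, ((h.flowPerm (T / m)) ^ k) q = S.reebFlow (k * (T / m)) q := by
      intro k q
      induction k with
      | zero => simp [S.reebFlow_zero]
      | succ k ih =>
        rw [pow_succ', Equiv.Perm.mul_apply, ih]
        change S.reebFlow (T / m) _ = _
        rw [← h.flow_add]
        congr 1
        push_cast
        ring
    ext q
    rw [hpow, mul_div_cancel₀ T hm0.ne', hper]
    rfl

end IsOrbitProjection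

end Center

end Cosymplectic

/-- Being central, nontrivial and of finite order is preserved by any group isomorphism, so the
element found in the first group yields one in the second. -/
theorem mainTheorem5 {n₁ n₂ : ℕ}
    {M₁ : Type*} [TopologicalSpace M₁] [T2Space M₁] [SecondCountableTopology M₁]
    [ConnectedSpace M₁] [ChartedSpace (EuclideanSpace ℝ (Fin (2 * n₁ + 1))) M₁]
    [IsManifold (𝓡 (2 * n₁ + 1)) (⊤ : ℕ∞) M₁]
    {M₂ : Type*} [TopologicalSpace M₂] [T2Space M₂] [SecondCountableTopology M₂]
    [ConnectedSpace M₂] [ChartedSpace (EuclideanSpace ℝ (Fin (2 * n₂ + 1))) M₂]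
    [IsManifold (𝓡 (2 * n₂ + 1)) (⊤ : ℕ∞) M₂]
    (S₁ : Cosymplectic.CosymplecticStructure n₁ M₁)
    (S₂ : Cosymplectic.CosymplecticStructure n₂ M₂)
    (hS₁ : S₁.IsRegular) (hS₂ : S₂.IsRegular)
    (hiso : Nonempty (S₁.cosymp ≃* S₂.cosymp))
    (hper : S₁.ReebPeriodic) :
    S₂.ReebPeriodic := by
  obtain ⟨e⟩ := hiso
  obtain ⟨hc₁, B₁, _, _, π₁, -, -, _, -, hsub₁, hfib₁⟩ := hS₁
  obtain ⟨hc₂, B₂, _, _, π₂, _, -, _, -, hsub₂, hfib₂⟩ := hS₂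
  have h₁ : Cosymplectic.IsOrbitProjection S₁ π₁ := ⟨hc₁, hsub₁, hfib₁⟩
  have h₂ : Cosymplectic.IsOrbitProjection S₂ π₂ := ⟨hc₂, hsub₂, hfib₂⟩
  obtain ⟨φ, hφ, hcent, hne, m, hm, hpow⟩ := h₁.exists_central_of_periodic hper
  refine h₂.periodic_of_central (φ := e ⟨φ, hφ⟩) (e ⟨φ, hφ⟩).2 (fun g hg q => ?_) (fun h => ?_) hm
      ?_
  · obtain ⟨⟨g', hg'⟩, he⟩ := e.surjective ⟨g, hg⟩
    have h3 : (⟨g', hg'⟩ : S₁.cosymp) * ⟨φ, hφ⟩ = ⟨φ, hφ⟩ * ⟨g', hg'⟩ :=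
      Subtype.ext (Equiv.ext fun q => hcent g' hg' q)
    have h4 := congrArg e h3
    rw [map_mul, map_mul, he] at h4
    exact congrArg (fun σ : S₂.cosymp => (σ : Equiv.Perm M₂) q) h4
  · have h3 : e ⟨φ, hφ⟩ = 1 := Subtype.ext h
    rw [EmbeddingLike.map_eq_one_iff] at h3
    exact hne (congrArg Subtype.val h3)
  · have h3 : (⟨φ, hφ⟩ : S₁.cosymp) ^ m = 1 := Subtype.ext hpow
    have h4 := congrArg e h3
    rw [map_pow, map_one] at h4
    exact congrArg Subtype.val h4
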